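/- Let $\mathbb K$ be a field of characteristic $0$ and $n\ge 2$. Let $\ell\ge 1$, let $\theta\in\mathbb K$ be a primitive $\ell$th root of unity, and let $r=\theta^y$, $s=\theta^z$ ($y,z\in\mathbb Z_{\ge0}$), $r\neq s$, where $\ell$ is the least common multiple of the orders of $r$ and $s$. Assume that $y^{n-1}-y^{n-2}z+\cdots+(-1)^{n-1}z^{n-1}$ is relatively prime to $\ell$, that $rs^{-1}$ is a primitive $\ell$th root of unity, and that $n\le 3$ or $r+s\ne 0$. Let $U=U_{r,s}(\mathfrak{sl}_n)$ be the unital associative $\mathbb K$-algebra generated by $e_i,f_i,\omega_i^{\pm1},(\omega_i')^{\pm1}$ $(1\le i<n)$ with the relations, where $\alpha_j=\epsilon_j-\epsilon_{j+1}$ and the $\epsilon_i$ are orthonormal: the $\omega_i^{\pm1},(\omega_j')^{\pm1}$ commute with one another and $\omega_i\omega_i^{-1}=\omega_i'(\omega_i')^{-1}=1$; $\omega_ie_j=r^{\langle\epsilon_i,\alpha_j\rangle}s^{\langle\epsilon_{i+1},\alpha_j\rangle}e_j\omega_i$, $\omega_if_j=r^{-\langle\epsilon_i,\alpha_j\rangle}s^{-\langle\epsilon_{i+1},\alpha_j\rangle}f_j\omega_i$,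 $\omega_i'e_j=r^{\langle\epsilon_{i+1},\alpha_j\rangle}s^{\langle\epsilon_i,\alpha_j\rangle}e_j\omega_i'$, $\omega_i'f_j=r^{-\langle\epsilon_{i+1},\alpha_j\rangle}s^{-\langle\epsilon_i,\alpha_j\rangle}f_j\omega_i'$; $[e_i,f_j]=\delta_{i,j}(r-s)^{-1}(\omega_i-\omega_i')$; $[e_i,e_j]=[f_i,f_j]=0$ for $|i-j|>1$; $e_i^2e_{i+1}-(r+s)e_ie_{i+1}e_i+rs\,e_{i+1}e_i^2=0=e_ie_{i+1}^2-(r+s)e_{i+1}e_ie_{i+1}+rs\,e_{i+1}^2e_i$, and the same two relations with $f,r^{-1},s^{-1}$ in place of $e,r,s$. Its coproduct and counit are given by $\omega_i,\omega_i'$ group-like, $\Delta(e_i)=e_i\otimes1+\omega_i\otimes e_i$, $\Delta(f_i)=1\otimes f_i+f_i\otimes\omega_i'$, $\varepsilon(e_i)=\varepsilon(f_i)=0$. For $1\le j\le i<n$ put $\mathcal E_{j,j}=e_j$, $\mathcal E_{i,j}=e_i\mathcal E_{i-1,j}-r^{-1}\mathcal E_{i-1,j}e_i$, $\mathcal F_{j,j}=f_j$,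 $\mathcal F_{i,j}=f_i\mathcal F_{i-1,j}-s\mathcal F_{i-1,j}f_i$ $(i>j)$. For $\zeta\in Q^+=\bigoplus_i\mathbb Z_{\ge0}\alpha_i$ let $\overline U^+_\zeta$ (resp. $\overline U^-_{-\zeta}$) be the span of all products of powers of the $\mathcal E_{i,j}$ (resp. $\mathcal F_{i,j}$), taken in the lexicographic order of the pairs $(i,j)$, with all exponents less than $\ell$ and of degree $\zeta$ (resp. $-\zeta$), where $\deg e_i=\alpha_i=-\deg f_i$. Let $B$ be the subalgebra of $U$ generated by all $e_i,\omega_i^{\pm1}$ and $B'$ the one generated by all $f_i,(\omega_i')^{\pm1}$. There is exactly one bilinear pairing $(\,|\,)\colon B'\times B\to\mathbb K$ with $(f_i|e_j)=\delta_{i,j}/(s-r)$, $(\omega_i'|\omega_j)=r^{\langle\epsilon_j,\alpha_i\rangle}s^{\langle\epsilon_{j+1},\alpha_i\rangle}$, $(f_i|\omega_j)=(\omega_i'|e_j)=0$, $(1|b)=\varepsilon(b)$, $(b'|1)=\varepsilon(b')$, $(b'|bc)=\sum(b'_{(2)}|b)(b'_{(1)}|c)$ and $(b'c'|b)=\sum(b'|b_{(1)})(c'|b_{(2)})$.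 For every $\zeta\in Q^+$ the spaces $\overline U^+_\zeta$ and $\overline U^-_{-\zeta}$ possess bases $\{u_k^\zeta\}$ and $\{v_k^\zeta\}$ with $(v_k^\zeta|u_l^\zeta)=\delta_{k,l}$. For any choice of such bases let $F=\sum_{\zeta\in Q^+}\sum_k v_k^\zeta\otimes u_k^\zeta\in U\otimes U$ (only finitely many terms are nonzero). Let $\mathfrak K$ be a commutative $\mathbb K$-algebra, $U_{\mathfrak K}=\mathfrak K\otimes_{\mathbb K}U$, and let $\mathcal N$ be the category of $U_{\mathfrak K}$-modules $M$ that are free over $\mathfrak K$, are the direct sum of eigenspaces $M_\chi=\{m\mid \omega_im=\chi(\omega_i)m,\ \omega_i'm=\chi(\omega_i')m\ \forall i\}$ for some set of algebra homomorphisms $\chi\colon U^0_{\mathfrak K}\to\mathfrak K$ (where $U^0$ is the subalgebra generated by the $\omega_i^{\pm1},(\omega_i')^{\pm1}$), and are annihilated by all $\mathcal E_{i,j}^\ell$ and $\mathcal F_{i,j}^\ell$. Then for all $M,M',M''$ in $\mathcal N$ $$\bigl[(\Delta\otimes\mathrm{id})(F)\bigr](F\otimes\mathrm{id})=\bigl[(\mathrm{id}\otimes\Delta)(F)\bigr](\mathrm{id}\otimes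 F)$$ as operators on $M\otimes_{\mathfrak K}M'\otimes_{\mathfrak K}M''$. Hence $F$ is a twisting element for any subcategory of $\mathcal N$ consisting of $U_{\mathfrak K}$-module algebras $A$; that is, in addition to this identity on $A\otimes A\otimes A$, one has $(\varepsilon\otimes\mathrm{id})(F)=\mathrm{id}\otimes\mathrm{id}=(\mathrm{id}\otimes\varepsilon)(F)$ as operators on $A\otimes A$. -/

import Mathlib

open scoped TensorProduct

namespace TwoParam

/-! ## The two-parameter quantum group `U_{r,s}(sl_n)`

The index set `{1, …, n-1}` is represented by `Fin (n - 1)`, with all indices shifted down by one. -/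

section Presentation

/-- `⟨ε_i, α_j⟩` where `α_j = ε_j - ε_{j+1}` and the `ε_i` are orthonormal. -/
def ip (i j : ℕ) : ℤ := (if i = j then 1 else 0) - (if i = j + 1 then 1 else 0)

/-- The letters `ω_i`, `ω_i⁻¹`, `ω'_i`, `(ω'_i)⁻¹`. -/
inductive TorusGen (n : ℕ) : Type
  | w (i : Fin (n - 1))
  | wInv (i : Fin (n - 1))
  | w' (i : Fin (n - 1))
  | wInv' (i : Fin (n - 1))

/-- The generators of `U_{r,s}(sl_n)`. -/
inductive Gen (n : ℕ) : Type
  | e (i : Fin (n - 1))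
  | f (i : Fin (n - 1))
  | t (x : TorusGen n)

variable {K : Type*} [Field K]

/-- A generator as an element of the free algebra. -/
abbrev gen (K : Type*) [Field K] {n : ℕ} (x : Gen n) : FreeAlgebra K (Gen n) := FreeAlgebra.ι K x

/-- The defining relations of `U_{r,s}(sl_n)`. -/
inductive Rel (n : ℕ) (r s : Kˣ) : FreeAlgebra K (Gen n) → FreeAlgebra K (Gen n) → Prop
  | torus_comm (x y : TorusGen n) :
      Rel n r s (gen K (.t x) * gen K (.t y)) (gen K (.t y) * gen K (.t x))
  | w_inv (i : Fin (n - 1)) : Rel n r s (gen K (.t (.w i)) * gen K (.t (.wInv i))) 1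
  | w'_inv (i : Fin (n - 1)) : Rel n r s (gen K (.t (.w' i)) * gen K (.t (.wInv' i))) 1
  | w_e (i j : Fin (n - 1)) : Rel n r s (gen K (.t (.w i)) * gen K (.e j))
      (((r ^ ip i j * s ^ ip (i + 1) j : Kˣ) : K) • (gen K (.e j) * gen K (.t (.w i))))
  | w_f (i j : Fin (n - 1)) : Rel n r s (gen K (.t (.w i)) * gen K (.f j))
      (((r ^ (-ip i j) * s ^ (-ip (i + 1) j) : Kˣ) : K) • (gen K (.f j) * gen K (.t (.w i))))
  | w'_e (i j : Fin (n - 1)) : Rel n r s (gen K (.t (.w' i)) * gen K (.e j))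
      (((r ^ ip (i + 1) j * s ^ ip i j : Kˣ) : K) • (gen K (.e j) * gen K (.t (.w' i))))
  | w'_f (i j : Fin (n - 1)) : Rel n r s (gen K (.t (.w' i)) * gen K (.f j))
      (((r ^ (-ip (i + 1) j) * s ^ (-ip i j) : Kˣ) : K) • (gen K (.f j) * gen K (.t (.w' i))))
  | e_f (i j : Fin (n - 1)) : Rel n r s
      (gen K (.e i) * gen K (.f j) - gen K (.f j) * gen K (.e i))
      (if i = j then ((r : K) - s)⁻¹ • (gen K (.t (.w i)) - gen K (.t (.w' i))) else 0)
  | e_comm (i j : Fin (n - 1)) (h : (i : ℕ) + 1 < j) :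
      Rel n r s (gen K (.e i) * gen K (.e j) - gen K (.e j) * gen K (.e i)) 0
  | f_comm (i j : Fin (n - 1)) (h : (i : ℕ) + 1 < j) :
      Rel n r s (gen K (.f i) * gen K (.f j) - gen K (.f j) * gen K (.f i)) 0
  | serre_e₁ (i j : Fin (n - 1)) (h : (j : ℕ) = i + 1) : Rel n r s
      (gen K (.e i) ^ 2 * gen K (.e j) - ((r : K) + s) • (gen K (.e i) * gen K (.e j) * gen K (.e i))
        + ((r : K) * s) • (gen K (.e j) * gen K (.e i) ^ 2)) 0
  | serre_e₂ (i j : Fin (n - 1)) (h : (j : ℕ) = i + 1) : Rel n r s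
      (gen K (.e i) * gen K (.e j) ^ 2 - ((r : K) + s) • (gen K (.e j) * gen K (.e i) * gen K (.e j))
        + ((r : K) * s) • (gen K (.e j) ^ 2 * gen K (.e i))) 0
  | serre_f₁ (i j : Fin (n - 1)) (h : (j : ℕ) = i + 1) : Rel n r s
      (gen K (.f i) ^ 2 * gen K (.f j)
        - ((r : K)⁻¹ + (s : K)⁻¹) • (gen K (.f i) * gen K (.f j) * gen K (.f i))
        + ((r : K)⁻¹ * (s : K)⁻¹) • (gen K (.f j) * gen K (.f i) ^ 2)) 0
  | serre_f₂ (i j : Fin (n - 1)) (h : (j : ℕ) = i + 1) : Rel n r s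
      (gen K (.f i) * gen K (.f j) ^ 2
        - ((r : K)⁻¹ + (s : K)⁻¹) • (gen K (.f j) * gen K (.f i) * gen K (.f j))
        + ((r : K)⁻¹ * (s : K)⁻¹) • (gen K (.f j) ^ 2 * gen K (.f i))) 0

/-- The algebra `U_{r,s}(sl_n)`. -/
def U (n : ℕ) (r s : Kˣ) : Type _ := RingQuot (Rel n r s)

noncomputable instance (n : ℕ) (r s : Kˣ) : Ring (U n r s) :=
  inferInstanceAs (Ring (RingQuot (Rel n r s)))

noncomputable instance (n : ℕ) (r s : Kˣ) : Algebra K (U n r s) :=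
  inferInstanceAs (Algebra K (RingQuot (Rel n r s)))

/-- The quotient map from the free algebra. -/
noncomputable def proj (n : ℕ) (r s : Kˣ) : FreeAlgebra K (Gen n) →ₐ[K] U n r s :=
  RingQuot.mkAlgHom K (Rel n r s)

noncomputable def e {n : ℕ} (r s : Kˣ) (i : Fin (n - 1)) : U n r s := proj n r s (gen K (.e i))
noncomputable def f {n : ℕ} (r s : Kˣ) (i : Fin (n - 1)) : U n r s := proj n r s (gen K (.f i))
noncomputable def tor {n : ℕ} (r s : Kˣ) (x : TorusGen n) : U n r s := proj n r s (gen K (.t x))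
/-- `ω_i` -/
noncomputable abbrev w {n : ℕ} (r s : Kˣ) (i : Fin (n - 1)) : U n r s := tor r s (.w i)
/-- `ω'_i` -/
noncomputable abbrev w' {n : ℕ} (r s : Kˣ) (i : Fin (n - 1)) : U n r s := tor r s (.w' i)

theorem proj_rel {n : ℕ} {r s : Kˣ} {a b : FreeAlgebra K (Gen n)} (h : Rel n r s a b) :
    proj n r s a = proj n r s b := RingQuot.mkAlgHom_rel K h

/-- The universal property of `U_{r,s}(sl_n)`. -/
noncomputable def lift {n : ℕ} {r s : Kˣ} {A : Type*} [Ring A] [Algebra K A] (φ : Gen n → A)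
    (h : ∀ a b, Rel n r s a b → FreeAlgebra.lift K φ a = FreeAlgebra.lift K φ b) :
    U n r s →ₐ[K] A :=
  RingQuot.liftAlgHom K ⟨FreeAlgebra.lift K φ, fun a b hab => h a b hab⟩

theorem lift_proj {n : ℕ} {r s : Kˣ} {A : Type*} [Ring A] [Algebra K A] (φ : Gen n → A)
    (h : ∀ a b, Rel n r s a b → FreeAlgebra.lift K φ a = FreeAlgebra.lift K φ b) (x : Gen n) :
    lift φ h (proj n r s (gen K x)) = φ x :=
  (RingQuot.liftAlgHom_mkAlgHom_apply K _ _ _).trans (FreeAlgebra.lift_ι_apply _ _)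

end Presentation

section Comul

variable {K : Type*} [Field K] {n : ℕ}

/-- The coproduct on generators. -/
noncomputable def comulGen (r s : Kˣ) : Gen n → U n r s ⊗[K] U n r s
  | .e i => e r s i ⊗ₜ 1 + w r s i ⊗ₜ e r s i
  | .f i => 1 ⊗ₜ f r s i + f r s i ⊗ₜ w' r s i
  | .t x => tor r s x ⊗ₜ tor r s x

/-- The counit on generators. -/
def counitGen (K : Type*) [Field K] : Gen n → K
  | .e _ => 0
  | .f _ => 0
  | .t _ => 1

theorem tor_comm (r s : Kˣ) (x y : TorusGen n) : tor r s x * tor r s y = tor r s y * tor r s x := by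
  simpa [tor] using proj_rel (Rel.torus_comm (r := r) (s := s) x y)

theorem w_e_rel (r s : Kˣ) (i j : Fin (n - 1)) : w r s i * e r s j
    = ((r ^ ip i j * s ^ ip (i + 1) j : Kˣ) : K) • (e r s j * w r s i) := by
  simpa [tor, e] using proj_rel (Rel.w_e (r := r) (s := s) i j)

theorem w_f_rel (r s : Kˣ) (i j : Fin (n - 1)) : w r s i * f r s j
    = ((r ^ (-ip i j) * s ^ (-ip (i + 1) j) : Kˣ) : K) • (f r s j * w r s i) := by
  simpa [tor, f] using proj_rel (Rel.w_f (r := r) (s := s) i j)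

theorem w'_e_rel (r s : Kˣ) (i j : Fin (n - 1)) : w' r s i * e r s j
    = ((r ^ ip (i + 1) j * s ^ ip i j : Kˣ) : K) • (e r s j * w' r s i) := by
  simpa [tor, e] using proj_rel (Rel.w'_e (r := r) (s := s) i j)

theorem w'_f_rel (r s : Kˣ) (i j : Fin (n - 1)) : w' r s i * f r s j
    = ((r ^ (-ip (i + 1) j) * s ^ (-ip i j) : Kˣ) : K) • (f r s j * w' r s i) := by
  simpa [tor, f] using proj_rel (Rel.w'_f (r := r) (s := s) i j)

theorem e_f_rel (r s : Kˣ) (i j : Fin (n - 1)) : e r s i * f r s j = f r s j * e r s i +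
    if i = j then ((r : K) - s)⁻¹ • (w r s i - w' r s i) else 0 := by
  have := proj_rel (Rel.e_f (r := r) (s := s) i j)
  rw [map_sub, map_mul, map_mul, sub_eq_iff_eq_add'] at this
  rw [e, f, this]
  split_ifs <;> simp [tor]

theorem e_comm_rel (r s : Kˣ) (i j : Fin (n - 1)) (h : (i : ℕ) + 1 < j) :
    e r s i * e r s j = e r s j * e r s i := by
  simpa [e, sub_eq_zero] using proj_rel (Rel.e_comm (r := r) (s := s) i j h)

theorem f_comm_rel (r s : Kˣ) (i j : Fin (n - 1)) (h : (i : ℕ) + 1 < j) :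
    f r s i * f r s j = f r s j * f r s i := by
  simpa [f, sub_eq_zero] using proj_rel (Rel.f_comm (r := r) (s := s) i j h)

/-- Compatibility of the coproduct with a Serre relation. -/
theorem serre_aux {K A : Type*} [Field K] [Ring A] [Algebra K A] (p q : K) (hp : p ≠ 0) (hq : q ≠ 0)
    (a b u v : A) (hvu : v * u = u * v)
    (hua : u * a = (p * q⁻¹) • (a * u)) (hub : u * b = q • (b * u))
    (hva : v * a = p⁻¹ • (a * v))
    (h : a ^ 2 * b - (p + q) • (a * b * a) + (p * q) • (b * a ^ 2) = 0) :
    (a ⊗ₜ[K] (1 : A) + u ⊗ₜ a) ^ 2 * (b ⊗ₜ 1 + v ⊗ₜ b)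
      - (p + q) • ((a ⊗ₜ[K] (1 : A) + u ⊗ₜ a) * (b ⊗ₜ 1 + v ⊗ₜ b) * (a ⊗ₜ[K] (1 : A) + u ⊗ₜ a))
      + (p * q) • ((b ⊗ₜ 1 + v ⊗ₜ b) * (a ⊗ₜ[K] (1 : A) + u ⊗ₜ a) ^ 2) = 0 := by
  have e1 : ∀ x, u * (a * x) = (p * q⁻¹) • (a * (u * x)) := fun x => by
    rw [← mul_assoc, hua, smul_mul_assoc, mul_assoc]
  have e2 : ∀ x, u * (b * x) = q • (b * (u * x)) := fun x => by
    rw [← mul_assoc, hub, smul_mul_assoc, mul_assoc]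
  have e3 : ∀ x, v * (a * x) = p⁻¹ • (a * (v * x)) := fun x => by
    rw [← mul_assoc, hva, smul_mul_assoc, mul_assoc]
  have e5 : ∀ x, v * (u * x) = u * (v * x) := fun x => by
    rw [← mul_assoc, hvu, mul_assoc]
  have h0 : a * (a * b) = (p + q) • (a * (b * a)) - (p * q) • (b * (a * a)) := by
    have : a * (a * b) - ((p + q) • (a * (b * a)) - (p * q) • (b * (a * a))) = 0 := by
      rw [← h]; simp only [pow_two, mul_assoc]; abel
    exact sub_eq_zero.1 this
  simp only [pow_two, mul_add, add_mul, Algebra.TensorProduct.tmul_mul_tmul, mul_one, one_mul,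
    mul_assoc, hua, hub, hva, hvu, e1, e2, e3, e5, mul_smul_comm, smul_mul_assoc, h0,
    TensorProduct.tmul_smul, smul_add, smul_smul, TensorProduct.tmul_sub,
    TensorProduct.sub_tmul,
    ← TensorProduct.smul_tmul']
  match_scalars <;> field_simp <;> ring

theorem serre_aux' {K A : Type*} [Field K] [Ring A] [Algebra K A] (p q : K) (hp : p ≠ 0)
    (hq : q ≠ 0) (a b u v : A) (hvu : v * u = u * v)
    (hua : u * a = (p * q⁻¹) • (a * u)) (hub : u * b = q • (b * u))
    (hva : v * a = p⁻¹ • (a * v))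
    (h : a ^ 2 * b - (p + q) • (a * b * a) + (p * q) • (b * a ^ 2) = 0) :
    ((1 : A) ⊗ₜ[K] a + a ⊗ₜ u) ^ 2 * (1 ⊗ₜ b + b ⊗ₜ v)
      - (p + q) • (((1 : A) ⊗ₜ[K] a + a ⊗ₜ u) * (1 ⊗ₜ b + b ⊗ₜ v) * ((1 : A) ⊗ₜ[K] a + a ⊗ₜ u))
      + (p * q) • ((1 ⊗ₜ b + b ⊗ₜ v) * ((1 : A) ⊗ₜ[K] a + a ⊗ₜ u) ^ 2) = 0 := by
  have := congrArg (Algebra.TensorProduct.comm K A A)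
    (serre_aux p q hp hq a b u v hvu hua hub hva h)
  simpa only [map_mul, map_add, map_sub, map_smul, map_pow, map_zero,
    Algebra.TensorProduct.comm_tmul] using this

theorem serre_inv {K A : Type*} [Field K] [Ring A] [Algebra K A] {p q : K} (hp : p ≠ 0)
    (hq : q ≠ 0) {a b : A} :
    a * b ^ 2 - (p + q) • (b * a * b) + (p * q) • (b ^ 2 * a) = 0 ↔
    b ^ 2 * a - (q⁻¹ + p⁻¹) • (b * a * b) + (q⁻¹ * p⁻¹) • (a * b ^ 2) = 0 := by
  have : b ^ 2 * a - (q⁻¹ + p⁻¹) • (b * a * b) + (q⁻¹ * p⁻¹) • (a * b ^ 2)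
      = (q⁻¹ * p⁻¹) • (a * b ^ 2 - (p + q) • (b * a * b) + (p * q) • (b ^ 2 * a)) := by
    match_scalars <;> field_simp
  rw [this, smul_eq_zero_iff_right (mul_ne_zero (inv_ne_zero hq) (inv_ne_zero hp))]

theorem comul_rel (r s : Kˣ) {a b : FreeAlgebra K (Gen n)} (h : Rel n r s a b) :
    FreeAlgebra.lift K (comulGen r s) a = FreeAlgebra.lift K (comulGen r s) b := by
  have hr : (r : K) ≠ 0 := r.ne_zero
  have hs : (s : K) ≠ 0 := s.ne_zero
  induction h with
  | torus_comm x y =>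
    simp [comulGen, tor_comm r s x y]
  | w_inv i =>
    have := proj_rel (Rel.w_inv (r := r) (s := s) i)
    simp only [map_mul, map_one] at this
    simp [comulGen, tor, this, Algebra.TensorProduct.one_def]
  | w'_inv i =>
    have := proj_rel (Rel.w'_inv (r := r) (s := s) i)
    simp only [map_mul, map_one] at this
    simp [comulGen, tor, this, Algebra.TensorProduct.one_def]
  | w_e i j =>
    simp only [comulGen, map_mul, map_smul, FreeAlgebra.lift_ι_apply, mul_add, add_mul,
      Algebra.TensorProduct.tmul_mul_tmul, mul_one, one_mul, w_e_rel,
      TensorProduct.tmul_smul, ← TensorProduct.smul_tmul', smul_add, tor_comm r s (.w i) (.w j)]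
  | w_f i j =>
    simp only [comulGen, map_mul, map_smul, FreeAlgebra.lift_ι_apply, mul_add, add_mul,
      Algebra.TensorProduct.tmul_mul_tmul, mul_one, one_mul, w_f_rel,
      TensorProduct.tmul_smul, ← TensorProduct.smul_tmul', smul_add, tor_comm r s (.w i) (.w' j)]
  | w'_e i j =>
    simp only [comulGen, map_mul, map_smul, FreeAlgebra.lift_ι_apply, mul_add, add_mul,
      Algebra.TensorProduct.tmul_mul_tmul, mul_one, one_mul, w'_e_rel,
      TensorProduct.tmul_smul, ← TensorProduct.smul_tmul', smul_add, tor_comm r s (.w' i) (.w j)]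
  | w'_f i j =>
    simp only [comulGen, map_mul, map_smul, FreeAlgebra.lift_ι_apply, mul_add, add_mul,
      Algebra.TensorProduct.tmul_mul_tmul, mul_one, one_mul, w'_f_rel,
      TensorProduct.tmul_smul, ← TensorProduct.smul_tmul', smul_add, tor_comm r s (.w' i) (.w' j)]
  | e_f i j =>
    have h1 : ip i j = -ip ((j : ℕ) + 1) i := by unfold ip; grind
    have h2 : ip ((i : ℕ) + 1) j = -ip j i := by unfold ip; grind
    have h3 : (comulGen r s (.e i)) * comulGen r s (.f j) - comulGen r s (.f j) * comulGen r s (.e i)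
        = (e r s i * f r s j - f r s j * e r s i) ⊗ₜ w' r s j
          + w r s i ⊗ₜ (e r s i * f r s j - f r s j * e r s i) := by
      simp only [comulGen, mul_add, add_mul, Algebra.TensorProduct.tmul_mul_tmul, mul_one,
        one_mul, w_f_rel, w'_e_rel, h1, h2, neg_neg, TensorProduct.tmul_smul,
        ← TensorProduct.smul_tmul', TensorProduct.sub_tmul, TensorProduct.tmul_sub]
      abel
    simp only [map_mul, map_sub, FreeAlgebra.lift_ι_apply]
    rw [h3, e_f_rel, add_sub_cancel_left]
    split_ifs with hij
    · subst hij
      simp only [map_smul, map_sub, FreeAlgebra.lift_ι_apply, comulGen, TensorProduct.tmul_smul,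
        ← TensorProduct.smul_tmul', ← smul_add, TensorProduct.sub_tmul, TensorProduct.tmul_sub]
      congr 1
      abel
    · simp
  | e_comm i j h =>
    have h1 : ip i j = 0 := by unfold ip; grind
    have h2 : ip ((i : ℕ) + 1) j = 0 := by unfold ip; grind
    have h3 : ip j i = 0 := by unfold ip; grind
    have h4 : ip ((j : ℕ) + 1) i = 0 := by unfold ip; grind
    simp only [map_mul, map_sub, map_zero, FreeAlgebra.lift_ι_apply]
    simp only [comulGen, mul_add, add_mul, Algebra.TensorProduct.tmul_mul_tmul, mul_one,
      one_mul, w_e_rel, h1, h2, h3, h4, zpow_zero, Units.val_one, one_smul,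
      e_comm_rel r s i j h, tor_comm r s (.w i) (.w j)]
    abel
  | f_comm i j h =>
    have h1 : ip i j = 0 := by unfold ip; grind
    have h2 : ip ((i : ℕ) + 1) j = 0 := by unfold ip; grind
    have h3 : ip j i = 0 := by unfold ip; grind
    have h4 : ip ((j : ℕ) + 1) i = 0 := by unfold ip; grind
    simp only [map_mul, map_sub, map_zero, FreeAlgebra.lift_ι_apply]
    simp only [comulGen, mul_add, add_mul, Algebra.TensorProduct.tmul_mul_tmul, mul_one,
      one_mul, w'_f_rel, h1, h2, h3, h4, neg_zero, zpow_zero, Units.val_one, one_smul,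
      f_comm_rel r s i j h, tor_comm r s (.w' i) (.w' j)]
    abel
  | serre_e₁ i j h =>
    have hs := proj_rel (Rel.serre_e₁ (r := r) (s := s) i j h)
    simp only [map_mul, map_add, map_sub, map_smul, map_pow, map_zero] at hs ⊢
    simp only [comulGen, FreeAlgebra.lift_ι_apply]
    refine serre_aux _ _ r.ne_zero s.ne_zero _ _ _ _ (tor_comm ..) ?_ ?_ ?_ hs
    · simp [w_e_rel, ip]
    · simp [w_e_rel, ip, h, add_assoc]
    · simp [w_e_rel, ip, h, add_assoc]
  | serre_e₂ i j h =>
    have hs := proj_rel (Rel.serre_e₂ (r := r) (s := s) i j h)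
    simp only [map_mul, map_add, map_sub, map_smul, map_pow, map_zero] at hs ⊢
    rw [serre_inv r.ne_zero s.ne_zero] at hs ⊢
    simp only [comulGen, FreeAlgebra.lift_ι_apply]
    refine serre_aux _ _ (inv_ne_zero s.ne_zero) (inv_ne_zero r.ne_zero) _ _ _ _
      (tor_comm ..) ?_ ?_ ?_ hs
    · simp [w_e_rel, ip, mul_comm]
    · simp [w_e_rel, ip, h, add_assoc]
    · simp [w_e_rel, ip, h, add_assoc]
  | serre_f₁ i j h =>
    have hs := proj_rel (Rel.serre_f₁ (r := r) (s := s) i j h)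
    simp only [map_mul, map_add, map_sub, map_smul, map_pow, map_zero] at hs ⊢
    simp only [comulGen, FreeAlgebra.lift_ι_apply]
    rw [add_comm (r : K)⁻¹, mul_comm (r : K)⁻¹] at hs ⊢
    refine serre_aux' _ _ (inv_ne_zero s.ne_zero) (inv_ne_zero r.ne_zero) _ _ _ _
      (tor_comm ..) ?_ ?_ ?_ hs
    · simp [w'_f_rel, ip, mul_comm]
    · simp [w'_f_rel, ip, h, add_assoc]
    · simp [w'_f_rel, ip, h, add_assoc]
  | serre_f₂ i j h =>
    have hs := proj_rel (Rel.serre_f₂ (r := r) (s := s) i j h)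
    simp only [map_mul, map_add, map_sub, map_smul, map_pow, map_zero] at hs ⊢
    rw [serre_inv (inv_ne_zero r.ne_zero) (inv_ne_zero s.ne_zero), inv_inv, inv_inv,
      add_comm (s : K), mul_comm (s : K)] at hs ⊢
    simp only [comulGen, FreeAlgebra.lift_ι_apply]
    refine serre_aux' _ _ r.ne_zero s.ne_zero _ _ _ _ (tor_comm ..) ?_ ?_ ?_ hs
    · simp [w'_f_rel, ip]
    · simp [w'_f_rel, ip, h, add_assoc]
    · simp [w'_f_rel, ip, h, add_assoc]

/-- The coproduct `Δ` of `U_{r,s}(sl_n)`. -/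
noncomputable def comul (n : ℕ) (r s : Kˣ) : U n r s →ₐ[K] U n r s ⊗[K] U n r s :=
  lift (comulGen r s) fun _ _ h => comul_rel r s h

theorem counit_rel (r s : Kˣ) {a b : FreeAlgebra K (Gen n)} (h : Rel n r s a b) :
    FreeAlgebra.lift K (counitGen K) a = FreeAlgebra.lift K (counitGen K) b := by
  induction h with
  | e_f i j => split_ifs <;> simp [counitGen]
  | _ => simp [counitGen]

/-- The counit `ε` of `U_{r,s}(sl_n)`. -/
noncomputable def counit (n : ℕ) (r s : Kˣ) : U n r s →ₐ[K] K :=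
  lift (counitGen K) fun _ _ h => counit_rel r s h

theorem comul_e (r s : Kˣ) (i : Fin (n - 1)) :
    comul n r s (e r s i) = e r s i ⊗ₜ 1 + w r s i ⊗ₜ e r s i := lift_proj _ _ _

theorem comul_f (r s : Kˣ) (i : Fin (n - 1)) :
    comul n r s (f r s i) = 1 ⊗ₜ f r s i + f r s i ⊗ₜ w' r s i := lift_proj _ _ _

theorem comul_tor (r s : Kˣ) (x : TorusGen n) :
    comul n r s (tor r s x) = tor r s x ⊗ₜ tor r s x := lift_proj _ _ _

theorem counit_e (r s : Kˣ) (i : Fin (n - 1)) : counit n r s (e r s i) = 0 := lift_proj _ _ _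

theorem counit_f (r s : Kˣ) (i : Fin (n - 1)) : counit n r s (f r s i) = 0 := lift_proj _ _ _

theorem counit_tor (r s : Kˣ) (x : TorusGen n) : counit n r s (tor r s x) = 1 := lift_proj _ _ _

end Comul

section Truncated

variable {K : Type*} [Field K] {n : ℕ}

/-- `e_i` for a natural number index (zero out of range). -/
noncomputable def eN (n : ℕ) (r s : Kˣ) (i : ℕ) : U n r s :=
  if h : i < n - 1 then e r s ⟨i, h⟩ else 0

/-- `f_i` for a natural number index (zero out of range). -/
noncomputable def fN (n : ℕ) (r s : Kˣ) (i : ℕ) : U n r s :=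
  if h : i < n - 1 then f r s ⟨i, h⟩ else 0

/-- `rootEAux n r s j k` is `𝓔_{j+k,j}`. -/
noncomputable def rootEAux (n : ℕ) (r s : Kˣ) (j : ℕ) : ℕ → U n r s
  | 0 => eN n r s j
  | k + 1 => eN n r s (j + k + 1) * rootEAux n r s j k
      - (r : K)⁻¹ • (rootEAux n r s j k * eN n r s (j + k + 1))

/-- `rootFAux n r s j k` is `𝓕_{j+k,j}`. -/
noncomputable def rootFAux (n : ℕ) (r s : Kˣ) (j : ℕ) : ℕ → U n r s
  | 0 => fN n r s j
  | k + 1 => fN n r s (j + k + 1) * rootFAux n r s j k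
      - (s : K) • (rootFAux n r s j k * fN n r s (j + k + 1))

/-- `𝓔_{i,j}`, for `j ≤ i`. -/
noncomputable def rootE (r s : Kˣ) (i j : Fin (n - 1)) : U n r s := rootEAux n r s j (i - j)

/-- `𝓕_{i,j}`, for `j ≤ i`. -/
noncomputable def rootF (r s : Kˣ) (i j : Fin (n - 1)) : U n r s := rootFAux n r s j (i - j)

/-- The product of the `x i j ^ a i j` over all pairs `(i, j)` with `j ≤ i`, taken in the
lexicographic order of the pairs, from the smallest (on the left) to the largest. -/
def orderedProd {A : Type*} [Monoid A] {m : ℕ} (x : Fin m → Fin m → A) (a : Fin m → Fin m → ℕ) :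
    A :=
  ((List.finRange m).map fun i =>
    (((List.finRange m).filter fun j => j ≤ i).map fun j => x i j ^ a i j).prod).prod

/-- The degree of the PBW monomial with exponents `a`, as an element `∑ ζ_k α_k` of `Q⁺`:
`𝓔_{i,j}` has degree `α_j + ⋯ + α_i`. -/
def pbwDegree {m : ℕ} (a : Fin m → Fin m → ℕ) (k : Fin m) : ℕ :=
  ∑ i, ∑ j, if j ≤ k ∧ k ≤ i then a i j else 0

/-- The span `Ū⁺_ζ` of the PBW monomials of degree `ζ` in which each `𝓔_{i,j}` has
exponent less than `ℓ`. -/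
noncomputable def truncPos (n : ℕ) (r s : Kˣ) (ℓ : ℕ) (ζ : Fin (n - 1) → ℕ) :
    Submodule K (U n r s) :=
  Submodule.span K {x | ∃ a : Fin (n - 1) → Fin (n - 1) → ℕ,
    (∀ i j, a i j < ℓ) ∧ pbwDegree a = ζ ∧ x = orderedProd (rootE r s) a}

/-- The span `Ū⁻_{-ζ}` of the PBW monomials of degree `-ζ` in which each `𝓕_{i,j}` has
exponent less than `ℓ`. -/
noncomputable def truncNeg (n : ℕ) (r s : Kˣ) (ℓ : ℕ) (ζ : Fin (n - 1) → ℕ) :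
    Submodule K (U n r s) :=
  Submodule.span K {x | ∃ a : Fin (n - 1) → Fin (n - 1) → ℕ,
    (∀ i j, a i j < ℓ) ∧ pbwDegree a = ζ ∧ x = orderedProd (rootF r s) a}

end Truncated

/-! ## The Hopf pairing -/

section Pairing

variable {K : Type*} [Field K]

/-- The subalgebra generated by all `e_i` and `ω_i^{±1}`. -/
noncomputable def borelPos (n : ℕ) (r s : Kˣ) : Subalgebra K (U n r s) :=
  Algebra.adjoin K (Set.range (e r s) ∪ Set.range (w r s)
    ∪ Set.range fun i => tor r s (.wInv i))

/-- The subalgebra generated by all `f_i` and `(ω'_i)^{±1}`. -/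
noncomputable def borelNeg (n : ℕ) (r s : Kˣ) : Subalgebra K (U n r s) :=
  Algebra.adjoin K (Set.range (f r s) ∪ Set.range (w' r s)
    ∪ Set.range fun i => tor r s (.wInv' i))

variable {n : ℕ} {r s : Kˣ}

theorem e_mem (i : Fin (n - 1)) : e r s i ∈ borelPos n r s :=
  Algebra.subset_adjoin (.inl (.inl ⟨i, rfl⟩))

theorem w_mem (i : Fin (n - 1)) : w r s i ∈ borelPos n r s :=
  Algebra.subset_adjoin (.inl (.inr ⟨i, rfl⟩))

theorem f_mem (i : Fin (n - 1)) : f r s i ∈ borelNeg n r s :=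
  Algebra.subset_adjoin (.inl (.inl ⟨i, rfl⟩))

theorem w'_mem (i : Fin (n - 1)) : w' r s i ∈ borelNeg n r s :=
  Algebra.subset_adjoin (.inl (.inr ⟨i, rfl⟩))

theorem eN_mem (i : ℕ) : eN n r s i ∈ borelPos n r s := by
  unfold eN; split_ifs
  exacts [e_mem _, zero_mem _]

theorem fN_mem (i : ℕ) : fN n r s i ∈ borelNeg n r s := by
  unfold fN; split_ifs
  exacts [f_mem _, zero_mem _]

theorem rootEAux_mem (j k : ℕ) : rootEAux n r s j k ∈ borelPos n r s := by
  induction k with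
  | zero => exact eN_mem j
  | succ k ih =>
    exact sub_mem (mul_mem (eN_mem _) ih) (Subalgebra.smul_mem _ (mul_mem ih (eN_mem _)) _)

theorem rootFAux_mem (j k : ℕ) : rootFAux n r s j k ∈ borelNeg n r s := by
  induction k with
  | zero => exact fN_mem j
  | succ k ih =>
    exact sub_mem (mul_mem (fN_mem _) ih) (Subalgebra.smul_mem _ (mul_mem ih (fN_mem _)) _)

theorem orderedProd_mem {A : Type*} [Ring A] [Algebra K A] (B : Subalgebra K A) {m : ℕ}
    {x : Fin m → Fin m → A} (hx : ∀ i j, x i j ∈ B) (a : Fin m → Fin m → ℕ) :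
    orderedProd x a ∈ B := by
  refine list_prod_mem fun y hy => ?_
  obtain ⟨i, -, rfl⟩ := List.mem_map.1 hy
  refine list_prod_mem fun z hz => ?_
  obtain ⟨j, -, rfl⟩ := List.mem_map.1 hz
  exact pow_mem (hx i j) _

theorem truncPos_le (ℓ : ℕ) (ζ : Fin (n - 1) → ℕ) :
    truncPos n r s ℓ ζ ≤ (borelPos n r s).toSubmodule := by
  refine Submodule.span_le.2 ?_
  rintro _ ⟨a, -, -, rfl⟩
  exact orderedProd_mem _ (fun _ _ => rootEAux_mem _ _) a

theorem truncNeg_le (ℓ : ℕ) (ζ : Fin (n - 1) → ℕ) :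
    truncNeg n r s ℓ ζ ≤ (borelNeg n r s).toSubmodule := by
  refine Submodule.span_le.2 ?_
  rintro _ ⟨a, -, -, rfl⟩
  exact orderedProd_mem _ (fun _ _ => rootFAux_mem _ _) a

/-- `p` is the Hopf pairing `(b' | b) = p b' b` of `borelNeg`, taken with the opposite coproduct,
and `borelPos`, with the prescribed values on generators. The tensor `t` in the last two fields is
the coproduct of an element of one of the two subalgebras, seen as a tensor over that subalgebra
(which it is, in exactly one way). -/
structure IsHopfPairing (p : borelNeg n r s →ₗ[K] borelPos n r s →ₗ[K] K) : Prop where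
  f_e : ∀ i j, p ⟨f r s i, f_mem i⟩ ⟨e r s j, e_mem j⟩ = if i = j then ((s : K) - r)⁻¹ else 0
  w'_w : ∀ i j : Fin (n - 1), p ⟨w' r s i, w'_mem i⟩ ⟨w r s j, w_mem j⟩
    = ((r ^ ip j i * s ^ ip (j + 1) i : Kˣ) : K)
  f_w : ∀ i j, p ⟨f r s i, f_mem i⟩ ⟨w r s j, w_mem j⟩ = 0
  w'_e : ∀ i j, p ⟨w' r s i, w'_mem i⟩ ⟨e r s j, e_mem j⟩ = 0
  one_left : ∀ b, p 1 b = counit n r s b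
  one_right : ∀ b', p b' 1 = counit n r s b'
  /-- `(b' | b c) = ∑ (b'₂ | b) (b'₁ | c)` -/
  mul_right : ∀ (b' : borelNeg n r s) (b c : borelPos n r s)
    (t : borelNeg n r s ⊗[K] borelNeg n r s),
    TensorProduct.map (borelNeg n r s).val.toLinearMap (borelNeg n r s).val.toLinearMap t
      = comul n r s b' →
    p b' (b * c) = LinearMap.mul' K K (TensorProduct.map (p.flip c) (p.flip b) t)
  /-- `(b' c' | b) = ∑ (b' | b₁) (c' | b₂)` -/
  mul_left : ∀ (b' c' : borelNeg n r s) (b : borelPos n r s)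
    (t : borelPos n r s ⊗[K] borelPos n r s),
    TensorProduct.map (borelPos n r s).val.toLinearMap (borelPos n r s).val.toLinearMap t
      = comul n r s b →
    p (b' * c') b = LinearMap.mul' K K (TensorProduct.map (p b') (p c') t)

/-- A choice, for every `ζ ∈ Q⁺`, of a basis of `Ū⁺_ζ` and of a basis of `Ū⁻_{-ζ}` which are dual
to each other under the pairing `p`. -/
structure DualBases (p : borelNeg n r s →ₗ[K] borelPos n r s →ₗ[K] K) (ℓ : ℕ) where
  u : ∀ ζ, Module.Basis (Fin (Module.finrank K (truncPos n r s ℓ ζ))) K (truncPos n r s ℓ ζ)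
  v : ∀ ζ, Module.Basis (Fin (Module.finrank K (truncPos n r s ℓ ζ))) K (truncNeg n r s ℓ ζ)
  dual : ∀ ζ k l, p ⟨v ζ k, truncNeg_le ℓ ζ (v ζ k).2⟩ ⟨u ζ l, truncPos_le ℓ ζ (u ζ l).2⟩
    = if k = l then 1 else 0

variable {p : borelNeg n r s →ₗ[K] borelPos n r s →ₗ[K] K} {ℓ : ℕ}

/-- `F_ζ = ∑ₖ v_k ⊗ u_k` -/
noncomputable def DualBases.Fcomp (D : DualBases p ℓ) (ζ : Fin (n - 1) → ℕ) :
    U n r s ⊗[K] U n r s :=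
  ∑ k, (D.v ζ k : U n r s) ⊗ₜ[K] (D.u ζ k : U n r s)

/-- `F = ∑_{ζ ∈ Q⁺} F_ζ`; only finitely many summands are nonzero
(see `DualBases.finite_support`). -/
noncomputable def DualBases.F (D : DualBases p ℓ) : U n r s ⊗[K] U n r s :=
  ∑ᶠ ζ, D.Fcomp ζ

theorem finite_pbwDegree (m ℓ : ℕ) :
    {ζ | ∃ a : Fin m → Fin m → ℕ, (∀ i j, a i j < ℓ) ∧ pbwDegree a = ζ}.Finite := by
  have h : Set.Finite {a : Fin m → Fin m → ℕ | ∀ i j, a i j < ℓ} := by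
    have := Set.Finite.pi' (fun _ : Fin m => Set.Finite.pi' fun _ : Fin m => Set.finite_lt_nat ℓ)
    exact this
  exact h.image pbwDegree

theorem DualBases.finite_support (D : DualBases p ℓ) :
    (Function.support D.Fcomp).Finite := by
  refine (finite_pbwDegree (n - 1) ℓ).subset fun ζ hζ => ?_
  by_contra hno
  refine hζ (Finset.sum_eq_zero fun k _ => ?_)
  have hbot : truncPos n r s ℓ ζ = ⊥ := by
    refine Submodule.span_eq_bot.2 ?_
    rintro _ ⟨a, ha, hd, -⟩
    exact (hno ⟨a, ha, hd⟩).elim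
  have : (D.u ζ k : U n r s) = 0 := (Submodule.mem_bot K).1 (hbot ▸ (D.u ζ k).2)
  rw [this, TensorProduct.tmul_zero]

end Pairing

/-! ## Modules over a coefficient ring `𝔎`

A module over `U_𝔎 = 𝔎 ⊗_K U` is the same as a `𝔎`-module `M` together with a homomorphism of
`K`-algebras from `U` to the `𝔎`-linear endomorphisms of `M`. -/

section Modules

variable {K : Type*} [Field K]
variable {𝔎 : Type*} [CommRing 𝔎] [Algebra K 𝔎]

theorem tensorAct_commute {A B M N : Type*} [Ring A] [Algebra K A] [Ring B] [Algebra K B]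
    [AddCommGroup M] [Module 𝔎 M] [Module K M] [IsScalarTower K 𝔎 M]
    [AddCommGroup N] [Module 𝔎 N] [Module K N] [IsScalarTower K 𝔎 N]
    (ρ : A →ₐ[K] Module.End 𝔎 M) (σ : B →ₐ[K] Module.End 𝔎 N) (a : A) (b : B) :
    Commute (((Module.End.rTensorAlgHom 𝔎 M N).restrictScalars K).comp ρ a)
      (((Module.End.lTensorAlgHom 𝔎 N M).restrictScalars K).comp σ b) :=
  TensorProduct.ext' fun _ _ => rfl

/-- The action of `A ⊗_K B` on `M ⊗_𝔎 N`, where `A` acts on `M` and `B` acts on `N`. -/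
noncomputable def tensorAct {A B M N : Type*} [Ring A] [Algebra K A] [Ring B] [Algebra K B]
    [AddCommGroup M] [Module 𝔎 M] [Module K M] [IsScalarTower K 𝔎 M]
    [AddCommGroup N] [Module 𝔎 N] [Module K N] [IsScalarTower K 𝔎 N]
    (ρ : A →ₐ[K] Module.End 𝔎 M) (σ : B →ₐ[K] Module.End 𝔎 N) :
    A ⊗[K] B →ₐ[K] Module.End 𝔎 (M ⊗[𝔎] N) :=
  Algebra.TensorProduct.lift
    (((Module.End.rTensorAlgHom 𝔎 M N).restrictScalars K).comp ρ)
    (((Module.End.lTensorAlgHom 𝔎 N M).restrictScalars K).comp σ)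
    (tensorAct_commute ρ σ)

theorem tensorAct_tmul {A B M N : Type*} [Ring A] [Algebra K A] [Ring B] [Algebra K B]
    [AddCommGroup M] [Module 𝔎 M] [Module K M] [IsScalarTower K 𝔎 M]
    [AddCommGroup N] [Module 𝔎 N] [Module K N] [IsScalarTower K 𝔎 N]
    (ρ : A →ₐ[K] Module.End 𝔎 M) (σ : B →ₐ[K] Module.End 𝔎 N) (a : A) (b : B) (x : M) (y : N) :
    tensorAct ρ σ (a ⊗ₜ b) (x ⊗ₜ y) = ρ a x ⊗ₜ σ b y := by
  rw [tensorAct, Algebra.TensorProduct.lift_tmul]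
  rfl

/-- The algebra `U⁰` generated by all `ω_i^{±1}` and `(ω'_i)^{±1}`. -/
noncomputable def torus (n : ℕ) (r s : Kˣ) : Subalgebra K (U n r s) :=
  Algebra.adjoin K (Set.range (tor r s))

variable {n : ℕ} {r s : Kˣ}

theorem tor_mem (x : TorusGen n) : tor r s x ∈ torus n r s := Algebra.subset_adjoin ⟨x, rfl⟩

section Rep

variable {M M' M'' : Type*}
  [AddCommGroup M] [Module 𝔎 M] [Module K M] [IsScalarTower K 𝔎 M]
  [AddCommGroup M'] [Module 𝔎 M'] [Module K M'] [IsScalarTower K 𝔎 M']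
  [AddCommGroup M''] [Module 𝔎 M''] [Module K M''] [IsScalarTower K 𝔎 M'']

/-- The eigenspace `M_χ`. -/
noncomputable def weightSpace (ρ : U n r s →ₐ[K] Module.End 𝔎 M) (χ : torus n r s →ₐ[K] 𝔎) : Submodule 𝔎 M :=
  (⨅ i, LinearMap.ker (ρ (w r s i) - χ ⟨w r s i, tor_mem _⟩ • 1)) ⊓
    ⨅ i, LinearMap.ker (ρ (w' r s i) - χ ⟨w' r s i, tor_mem _⟩ • 1)

/-- The module `M` belongs to the category `𝓝`: it is free over `𝔎`, it is the direct sum of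
eigenspaces of `U⁰`, and all `𝓔_{i,j}^ℓ` and `𝓕_{i,j}^ℓ` annihilate it. -/
structure InN (ℓ : ℕ) (ρ : U n r s →ₐ[K] Module.End 𝔎 M) : Prop where
  free : Module.Free 𝔎 M
  semisimple : ∃ S : Set (torus n r s →ₐ[K] 𝔎),
    iSupIndep (fun χ : S => weightSpace ρ χ) ∧ ⨆ χ : S, weightSpace ρ χ = ⊤
  rootE_pow : ∀ i j, j ≤ i → ρ (rootE r s i j ^ ℓ) = 0
  rootF_pow : ∀ i j, j ≤ i → ρ (rootF r s i j ^ ℓ) = 0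

/-- `[(Δ ⊗ id) F] (F ⊗ id) = [(id ⊗ Δ) F] (id ⊗ F)` as operators on `M ⊗ M' ⊗ M''`. -/
def TwistIdentity (F : U n r s ⊗[K] U n r s) (ρ : U n r s →ₐ[K] Module.End 𝔎 M)
    (ρ' : U n r s →ₐ[K] Module.End 𝔎 M') (ρ'' : U n r s →ₐ[K] Module.End 𝔎 M'') : Prop :=
  tensorAct ρ (tensorAct ρ' ρ'') (Algebra.TensorProduct.assoc K K K _ _ _
      (Algebra.TensorProduct.map (comul n r s) (AlgHom.id K _) F)) ∘ₗ
    tensorAct ρ (tensorAct ρ' ρ'') (Algebra.TensorProduct.assoc K K K _ _ _ (F ⊗ₜ[K] 1))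
  = tensorAct ρ (tensorAct ρ' ρ'')
      (Algebra.TensorProduct.map (AlgHom.id K _) (comul n r s) F) ∘ₗ
    tensorAct ρ (tensorAct ρ' ρ'') (1 ⊗ₜ[K] F)

end Rep

/-- A (unital, associative) `U_𝔎`-module algebra. -/
structure ModuleAlgebra.{v, u, k} {K : Type k} [Field K] (n : ℕ) (r s : Kˣ) (𝔎 : Type u)
    [CommRing 𝔎] [Algebra K 𝔎] where
  carrier : Type v
  [ring : Ring carrier]
  [algebra : Algebra 𝔎 carrier]
  [module : Module K carrier]
  [isScalarTower : IsScalarTower K 𝔎 carrier]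
  ρ : U n r s →ₐ[K] Module.End 𝔎 carrier
  act_one : ∀ b, ρ b 1 = counit n r s b • (1 : carrier)
  /-- `b.(a a') = ∑ (b₁.a) (b₂.a')` -/
  act_mul : ∀ b a a', ρ b (a * a')
    = LinearMap.mul' 𝔎 carrier (tensorAct ρ ρ (comul n r s b) (a ⊗ₜ[𝔎] a'))

attribute [instance] ModuleAlgebra.ring ModuleAlgebra.algebra ModuleAlgebra.module
  ModuleAlgebra.isScalarTower

/-- `F` is a twisting element for the class `𝒞` of module algebras. -/
def IsTwistingElement (𝒞 : Set (ModuleAlgebra n r s 𝔎)) (F : U n r s ⊗[K] U n r s) : Prop :=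
  ∀ A ∈ 𝒞,
    tensorAct A.ρ A.ρ (Algebra.TensorProduct.map
      ((Algebra.ofId K (U n r s)).comp (counit n r s)) (AlgHom.id K _) F) = LinearMap.id ∧
    tensorAct A.ρ A.ρ (Algebra.TensorProduct.map
      (AlgHom.id K _) ((Algebra.ofId K (U n r s)).comp (counit n r s)) F) = LinearMap.id ∧
    TwistIdentity F A.ρ A.ρ A.ρ

end Modules

end TwoParam

/-!
The argument follows Drinfeld's description of a twist as the canonical element of a pairing.

*The pairing.* Two Borel subalgebras with a Hopf pairing `p` carry the operators
`L_x b' = ∑ (b'₁ | x) b'₂` and `R_x b' = ∑ (b'₂ | x) b'₁` (`actL`, `actR`). The pairing is built by pairing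
the free algebra on the `f_i`, `ω'_i^{±1}` with `borelPos` in the convolution algebra; it descends because
the functionals defined by the generators of `borelPos` are characters and skew derivations of `borelNeg`,
which are obtained from matrix coefficients of the natural representation and its dual
(`exists_isPairing`, `exists_skewDerivation_pos`, `exists_skewDerivation_neg`, `exists_isHopfPairing`).
This avoids any knowledge of a basis of `U`. In `U` one has the relation
`∑ L_{b₁}(b') b₂ = ∑ b₁ R_{b₂}(b')` of the quantum double (`IsHopfPairing.doubleRel`), which for `b = e_i`
is the commutator formula for `e_i` and `b'`.

*PBW monomials.* From the quantum Serre relations the ordered monomials in the root vectors span the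
algebra generated by the `e_i` (`SerreRel.adjoin_le_span_ordMon`); the hypothesis `n ≤ 3` or `r + s ≠ 0`
enters only in `commute_middle_pos` and `commute_middle_neg`. The coproduct formula for root vectors
(`SkewRel.comul_rootVec`) shows that each `𝓔_{i,j}` acts on monomials in the `𝓕` as a `q`-derivative, with
`q = r / s`, whence the monomials are orthogonal and
`(𝓕^a | 𝓔^a)` is a product of nonzero scalars and of `q`-factorials `[a_{i,j}]!`
(`BorelPairing.apply_ordMon`). As `q` is a primitive `ℓ`-th root of unity, this value is nonzero exactly
when all exponents are less than `ℓ`. Hence the truncated spaces are dual to each other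
(`IsHopfPairing.nonempty_dualBases`), and a PBW monomial with some exponent at least `ℓ` both pairs to zero
with everything and acts by zero on the modules of the category.

*The twist identity.* By the last remark the dual bases are complete on these modules: an element `b` of
the algebra generated by the `e_i` acts as `∑ (v_k | b) u_k`, and similarly on the negative side
(`DualBases.isCompletePos`, `DualBases.isCompleteNeg`). Completeness turns the two sides of the identity into
`∑ v_σ ⊗ L_{u_σ₁}(v_k) u_σ₂ ⊗ u_k` and `∑ v_σ ⊗ u_σ₁ R_{u_σ₂}(v_k) ⊗ u_k`, which agree by the relation of the
quantum double (`IsPairing.twist_identity`). The normalization by the counit is completeness at `b = 1`.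
-/


/-! ### Bialgebra structures -/

namespace SkewPairing

open Coalgebra

section SubBialgebra

variable {K A : Type*} [Field K] [Ring A] [Bialgebra K A]

theorem map_val_injective (S T : Subalgebra K A) :
    Function.Injective (Algebra.TensorProduct.map S.val T.val) :=
  TensorProduct.map_injective_of_flat_flat' S.val.toLinearMap T.val.toLinearMap
    Subtype.val_injective Subtype.val_injective

theorem comul_mem_range_of_adjoin {X : Set A} (S T : Subalgebra K A)
    (hX : ∀ x ∈ X, comul (R := K) x ∈ (Algebra.TensorProduct.map S.val T.val).range) :
    ∀ x ∈ Algebra.adjoin K X, comul (R := K) x ∈ (Algebra.TensorProduct.map S.val T.val).range := by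
  have : Algebra.adjoin K X ≤
      (Algebra.TensorProduct.map S.val T.val).range.comap (Bialgebra.comulAlgHom K A) :=
    Algebra.adjoin_le hX
  exact this

theorem tmul_mem_range {S T : Subalgebra K A} {x y : A} (hx : x ∈ S) (hy : y ∈ T) :
    x ⊗ₜ[K] y ∈ (Algebra.TensorProduct.map S.val T.val).range :=
  ⟨⟨x, hx⟩ ⊗ₜ ⟨y, hy⟩, rfl⟩

variable (S : Subalgebra K A)
  (h : ∀ x ∈ S, comul (R := K) x ∈ (Algebra.TensorProduct.map S.val S.val).range)

/-- The coproduct of a bialgebra, restricted to a subalgebra `S` with `Δ(S) ⊆ S ⊗ S`. -/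
noncomputable def comulRestrict : S →ₐ[K] S ⊗[K] S :=
  (AlgEquiv.ofInjective _ (map_val_injective S S)).symm.toAlgHom.comp
    (((Bialgebra.comulAlgHom K A).comp S.val).codRestrict _ fun x => h x x.2)

theorem map_comulRestrict (x : S) :
    Algebra.TensorProduct.map S.val S.val (comulRestrict S h x) = comul (R := K) (x : A) := by
  have := AlgEquiv.apply_symm_apply (AlgEquiv.ofInjective _ (map_val_injective S S))
    (((Bialgebra.comulAlgHom K A).comp S.val).codRestrict _ (fun x => h x x.2) x)
  exact congrArg Subtype.val this

/-- The bialgebra structure on a subalgebra `S` with `Δ(S) ⊆ S ⊗ S`. -/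
@[reducible]
noncomputable def subBialgebra : Bialgebra K S :=
  Bialgebra.ofAlgHom (comulRestrict S h) ((Bialgebra.counitAlgHom K A).comp S.val)
    (by
      have hinj : Function.Injective
          (Algebra.TensorProduct.map S.val (Algebra.TensorProduct.map S.val S.val)) :=
        TensorProduct.map_injective_of_flat_flat' S.val.toLinearMap
          (Algebra.TensorProduct.map S.val S.val).toLinearMap
          Subtype.val_injective (map_val_injective S S)
      refine AlgHom.ext fun x => hinj ?_
      have h1 : ∀ t : S ⊗[K] S, Algebra.TensorProduct.map S.val (Algebra.TensorProduct.map S.val S.val)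
          (Algebra.TensorProduct.assoc K K K S S S
            (Algebra.TensorProduct.map (comulRestrict S h) (.id K S) t))
          = TensorProduct.assoc K A A A (comul.rTensor A (Algebra.TensorProduct.map S.val S.val t)) := by
        intro t
        induction t with
        | zero => simp
        | add a b ha hb => simp only [map_add, ha, hb]
        | tmul a b =>
          have h2 := map_comulRestrict S h a
          simp only [Algebra.TensorProduct.map_tmul, AlgHom.id_apply, LinearMap.rTensor_tmul,
            Subalgebra.coe_val, ← h2]
          generalize comulRestrict S h a = t
          induction t with
          | zero => simp
          | add a b ha hb => simp only [map_add, TensorProduct.add_tmul, ha, hb]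
          | tmul c d => simp
      have h3 : ∀ t : S ⊗[K] S, Algebra.TensorProduct.map S.val (Algebra.TensorProduct.map S.val S.val)
          (Algebra.TensorProduct.map (.id K S) (comulRestrict S h) t)
          = comul.lTensor A (Algebra.TensorProduct.map S.val S.val t) := by
        intro t
        induction t with
        | zero => simp
        | add a b ha hb => simp only [map_add, ha, hb]
        | tmul a b => simp [map_comulRestrict S h b]
      have := coassoc_apply (R := K) (x : A)
      rw [← map_comulRestrict S h x, ← h1, ← h3] at this
      exact this)
    (by
      refine AlgHom.ext fun x => ?_
      have hinj : Function.Injective (Algebra.TensorProduct.map (AlgHom.id K K) S.val) :=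
        TensorProduct.map_injective_of_flat_flat' LinearMap.id S.val.toLinearMap
          Function.injective_id Subtype.val_injective
      apply hinj
      have h1 : ∀ t : S ⊗[K] S, Algebra.TensorProduct.map (AlgHom.id K K) S.val
          (Algebra.TensorProduct.map ((Bialgebra.counitAlgHom K A).comp S.val) (.id K S) t)
          = counit.rTensor A (Algebra.TensorProduct.map S.val S.val t) := by
        intro t
        induction t with
        | zero => simp
        | add a b ha hb => simp only [map_add, ha, hb]
        | tmul a b => simp
      have := rTensor_counit_comul (R := K) (x : A)
      rw [← map_comulRestrict S h x, ← h1] at this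
      simpa using this)
    (by
      refine AlgHom.ext fun x => ?_
      have hinj : Function.Injective (Algebra.TensorProduct.map S.val (AlgHom.id K K)) :=
        TensorProduct.map_injective_of_flat_flat' S.val.toLinearMap LinearMap.id
          Subtype.val_injective Function.injective_id
      apply hinj
      have h1 : ∀ t : S ⊗[K] S, Algebra.TensorProduct.map S.val (AlgHom.id K K)
          (Algebra.TensorProduct.map (.id K S) ((Bialgebra.counitAlgHom K A).comp S.val) t)
          = counit.lTensor A (Algebra.TensorProduct.map S.val S.val t) := by
        intro t
        induction t with
        | zero => simp
        | add a b ha hb => simp only [map_add, ha, hb]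
        | tmul a b => simp
      have := lTensor_counit_comul (R := K) (x : A)
      rw [← map_comulRestrict S h x, ← h1] at this
      simpa using this)

end SubBialgebra

end SkewPairing

namespace TwoParam

open SkewPairing

section QuantumBialgebra

variable {K : Type*} [Field K] {n : ℕ} {r s : Kˣ}

theorem algHom_ext_gen {A : Type*} [Ring A] [Algebra K A] {φ ψ : U n r s →ₐ[K] A}
    (he : ∀ i, φ (e r s i) = ψ (e r s i)) (hf : ∀ i, φ (f r s i) = ψ (f r s i))
    (ht : ∀ x, φ (tor r s x) = ψ (tor r s x)) : φ = ψ := by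
  refine RingQuot.ringQuot_ext' K φ ψ (FreeAlgebra.hom_ext (funext fun x => ?_))
  cases x with
  | e i => exact he i
  | f i => exact hf i
  | t x => exact ht x

noncomputable instance : Bialgebra K (U n r s) :=
  Bialgebra.ofAlgHom (comul n r s) (counit n r s)
    (by
      apply algHom_ext_gen <;> intro i
      · simp [comul_e, comul_tor, TensorProduct.add_tmul, TensorProduct.tmul_add,
          Algebra.TensorProduct.one_def, add_assoc]
      · simp [comul_f, comul_tor, TensorProduct.add_tmul, TensorProduct.tmul_add,
          Algebra.TensorProduct.one_def, add_assoc]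
      · simp [comul_tor])
    (by
      apply algHom_ext_gen <;> intro i
      · simp [comul_e, counit_e, counit_tor]
      · simp [comul_f, counit_f]
      · simp [comul_tor, counit_tor])
    (by
      apply algHom_ext_gen <;> intro i
      · simp [comul_e, counit_e]
      · simp [comul_f, counit_f, counit_tor]
      · simp [comul_tor, counit_tor])

theorem coalgebra_comul_eq (x : U n r s) : Coalgebra.comul (R := K) x = comul n r s x := rfl

theorem wInv_mem (i : Fin (n - 1)) : tor r s (.wInv i) ∈ borelPos n r s :=
  Algebra.subset_adjoin (.inr ⟨i, rfl⟩)

theorem wInv'_mem (i : Fin (n - 1)) : tor r s (.wInv' i) ∈ borelNeg n r s :=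
  Algebra.subset_adjoin (.inr ⟨i, rfl⟩)

theorem comul_mem_borelPos : ∀ x ∈ borelPos n r s, Coalgebra.comul (R := K) x ∈
    (Algebra.TensorProduct.map (borelPos n r s).val (borelPos n r s).val).range := by
  refine comul_mem_range_of_adjoin _ _ ?_
  rintro _ ((⟨i, rfl⟩ | ⟨i, rfl⟩) | ⟨i, rfl⟩) <;> rw [coalgebra_comul_eq]
  · rw [comul_e]
    exact add_mem (tmul_mem_range (e_mem i) (one_mem _)) (tmul_mem_range (w_mem i) (e_mem i))
  · rw [comul_tor]
    exact tmul_mem_range (w_mem i) (w_mem i)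
  · simp only [comul_tor]
    exact tmul_mem_range (wInv_mem i) (wInv_mem i)

theorem comul_mem_borelNeg : ∀ x ∈ borelNeg n r s, Coalgebra.comul (R := K) x ∈
    (Algebra.TensorProduct.map (borelNeg n r s).val (borelNeg n r s).val).range := by
  refine comul_mem_range_of_adjoin _ _ ?_
  rintro _ ((⟨i, rfl⟩ | ⟨i, rfl⟩) | ⟨i, rfl⟩) <;> rw [coalgebra_comul_eq]
  · rw [comul_f]
    exact add_mem (tmul_mem_range (one_mem _) (f_mem i)) (tmul_mem_range (f_mem i) (w'_mem i))
  · rw [comul_tor]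
    exact tmul_mem_range (w'_mem i) (w'_mem i)
  · simp only [comul_tor]
    exact tmul_mem_range (wInv'_mem i) (wInv'_mem i)

noncomputable instance : Bialgebra K (borelPos n r s) := subBialgebra _ comul_mem_borelPos

noncomputable instance : Bialgebra K (borelNeg n r s) := subBialgebra _ comul_mem_borelNeg

theorem map_comul_borelPos (x : borelPos n r s) :
    Algebra.TensorProduct.map (borelPos n r s).val (borelPos n r s).val
      (Coalgebra.comul (R := K) x) = comul n r s x := map_comulRestrict _ comul_mem_borelPos x

theorem map_comul_borelNeg (x : borelNeg n r s) :
    Algebra.TensorProduct.map (borelNeg n r s).val (borelNeg n r s).val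
      (Coalgebra.comul (R := K) x) = comul n r s x := map_comulRestrict _ comul_mem_borelNeg x

theorem comul_borelPos_eq {x : borelPos n r s} {t : borelPos n r s ⊗[K] borelPos n r s}
    (h : Algebra.TensorProduct.map (borelPos n r s).val (borelPos n r s).val t
      = comul n r s x) : Coalgebra.comul (R := K) x = t :=
  map_val_injective _ _ ((map_comul_borelPos x).trans h.symm)

theorem comul_borelNeg_eq {x : borelNeg n r s} {t : borelNeg n r s ⊗[K] borelNeg n r s}
    (h : Algebra.TensorProduct.map (borelNeg n r s).val (borelNeg n r s).val t
      = comul n r s x) : Coalgebra.comul (R := K) x = t :=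
  map_val_injective _ _ ((map_comul_borelNeg x).trans h.symm)

end QuantumBialgebra

end TwoParam

/-! ### Skew Hopf pairings and the two actions they define -/

namespace SkewPairing

open Coalgebra

variable {K H' H : Type*} [Field K] [Ring H'] [Bialgebra K H'] [Ring H] [Bialgebra K H]

/-- A Hopf pairing of `H'`, taken with the opposite coproduct, and `H`. -/
structure IsPairing (p : H' →ₗ[K] H →ₗ[K] K) : Prop where
  one_left : ∀ b, p 1 b = counit (R := K) b
  one_right : ∀ b', p b' 1 = counit (R := K) b'
  mul_right : ∀ b' b c, p b' (b * c)
    = LinearMap.mul' K K (TensorProduct.map (p.flip c) (p.flip b) (comul b'))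
  mul_left : ∀ b' c' b, p (b' * c') b
    = LinearMap.mul' K K (TensorProduct.map (p b') (p c') (comul b))

/-- The operator `b' ↦ ∑ (b'₁ | x) b'₂`. -/
noncomputable def actL (p : H' →ₗ[K] H →ₗ[K] K) : H →ₗ[K] H' →ₗ[K] H' where
  toFun x := TensorProduct.lid K H' ∘ₗ (p.flip x).rTensor H' ∘ₗ comul
  map_add' x y := by ext; simp [LinearMap.rTensor_add]
  map_smul' c x := by ext; simp [LinearMap.rTensor_smul]

/-- The operator `b' ↦ ∑ (b'₂ | x) b'₁`. -/
noncomputable def actR (p : H' →ₗ[K] H →ₗ[K] K) : H →ₗ[K] H' →ₗ[K] H' where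
  toFun x := TensorProduct.rid K H' ∘ₗ (p.flip x).lTensor H' ∘ₗ comul
  map_add' x y := by ext; simp [LinearMap.lTensor_add]
  map_smul' c x := by ext; simp [LinearMap.lTensor_smul]

variable {p : H' →ₗ[K] H →ₗ[K] K}

theorem actL_apply (x : H) (v : H') :
    actL p x v = TensorProduct.lid K H' ((p.flip x).rTensor H' (comul v)) := rfl

theorem actR_apply (x : H) (v : H') :
    actR p x v = TensorProduct.rid K H' ((p.flip x).lTensor H' (comul v)) := rfl

theorem actL_eq_sum {ι : Type*} {v : H'} {s : Finset ι} {l m : ι → H'}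
    (h : comul (R := K) v = ∑ i ∈ s, l i ⊗ₜ m i) (x : H) :
    actL p x v = ∑ i ∈ s, p (l i) x • m i := by
  simp [actL_apply, h]

theorem actR_eq_sum {ι : Type*} {v : H'} {s : Finset ι} {l m : ι → H'}
    (h : comul (R := K) v = ∑ i ∈ s, l i ⊗ₜ m i) (x : H) :
    actR p x v = ∑ i ∈ s, p (m i) x • l i := by
  simp [actR_apply, h]

namespace IsPairing

variable (hp : IsPairing p)
include hp

theorem actL_one (v : H') : actL p 1 v = v := by
  have h := congrArg (TensorProduct.lid K H') (rTensor_counit_comul (R := K) v)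
  rw [TensorProduct.lid_tmul, one_smul] at h
  have h2 : p.flip 1 = counit := LinearMap.ext hp.one_right
  rw [actL_apply, h2, h]

theorem actR_one (v : H') : actR p 1 v = v := by
  have h := congrArg (TensorProduct.rid K H') (lTensor_counit_comul (R := K) v)
  rw [TensorProduct.rid_tmul, one_smul] at h
  have h2 : p.flip 1 = counit := LinearMap.ext hp.one_right
  rw [actR_apply, h2, h]

theorem actL_one_right (x : H) : actL p x 1 = counit (R := K) x • 1 := by
  simp [actL_apply, Algebra.TensorProduct.one_def, hp.one_left]

theorem actR_one_right (x : H) : actR p x 1 = counit (R := K) x • 1 := by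
  simp [actR_apply, Algebra.TensorProduct.one_def, hp.one_left]

theorem apply_mul (v : H') (x y : H) : p v (x * y) = p (actL p y v) x := by
  rw [hp.mul_right, actL_apply]
  generalize comul (R := K) v = t
  induction t with
  | zero => simp
  | add a b ha hb => simp only [map_add, ha, hb, LinearMap.add_apply]
  | tmul a b => simp

theorem apply_mul' (v : H') (x y : H) : p v (x * y) = p (actR p x v) y := by
  rw [hp.mul_right, actR_apply]
  generalize comul (R := K) v = t
  induction t with
  | zero => simp
  | add a b ha hb => simp only [map_add, ha, hb, LinearMap.add_apply]
  | tmul a b => simp [mul_comm]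

omit hp in
/-- The two actions commute, by coassociativity. -/
theorem actL_actR (x y : H) (v : H') : actL p x (actR p y v) = actR p y (actL p x v) := by
  have h := coassoc_apply (R := K) v
  have h1 : ∀ t : H' ⊗[K] H', actL p x (TensorProduct.rid K H' ((p.flip y).lTensor H' t))
      = TensorProduct.lid K H' (TensorProduct.map (p.flip x)
        (TensorProduct.rid K H' ∘ₗ (p.flip y).lTensor H')
        (TensorProduct.assoc K H' H' H' (comul.rTensor H' t))) := by
    intro t
    induction t with
    | zero => simp
    | add a b ha hb => simp only [map_add, ha, hb]
    | tmul a b =>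
      simp only [LinearMap.lTensor_tmul, TensorProduct.rid_tmul, map_smul, LinearMap.rTensor_tmul,
        actL_apply]
      generalize comul (R := K) a = u
      induction u with
      | zero => simp
      | add a b ha hb => simp only [map_add, ha, hb, TensorProduct.add_tmul, smul_add]
      | tmul c d => simp [smul_smul]
  have h2 : ∀ t : H' ⊗[K] H', actR p y (TensorProduct.lid K H' ((p.flip x).rTensor H' t))
      = TensorProduct.lid K H' (TensorProduct.map (p.flip x)
        (TensorProduct.rid K H' ∘ₗ (p.flip y).lTensor H') (comul.lTensor H' t)) := by
    intro t
    induction t with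
    | zero => simp
    | add a b ha hb => simp only [map_add, ha, hb]
    | tmul a b => simp [actR_apply]
  rw [actR_apply, h1, h, ← h2, actL_apply x]

theorem actL_mul (x y : H) (v : H') : actL p (x * y) v = actL p x (actL p y v) := by
  have h := coassoc_apply (R := K) v
  have h1 : ∀ t : H' ⊗[K] H', TensorProduct.lid K H' ((p.flip (x * y)).rTensor H' t)
      = TensorProduct.lid K H' (TensorProduct.map (p.flip y)
        (TensorProduct.lid K H' ∘ₗ (p.flip x).rTensor H')
        (TensorProduct.assoc K H' H' H' (comul.rTensor H' t))) := by
    intro t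
    induction t with
    | zero => simp
    | add a b ha hb => simp only [map_add, ha, hb]
    | tmul a b =>
      simp only [TensorProduct.lid_tmul, LinearMap.rTensor_tmul, LinearMap.flip_apply, hp.mul_right]
      generalize comul (R := K) a = u
      induction u with
      | zero => simp
      | add a b ha hb => simp only [map_add, ha, hb, TensorProduct.add_tmul, add_smul]
      | tmul c d => simp [smul_smul, mul_comm]
  have h2 : ∀ t : H' ⊗[K] H', actL p x (TensorProduct.lid K H' ((p.flip y).rTensor H' t))
      = TensorProduct.lid K H' (TensorProduct.map (p.flip y)
        (TensorProduct.lid K H' ∘ₗ (p.flip x).rTensor H') (comul.lTensor H' t)) := by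
    intro t
    induction t with
    | zero => simp
    | add a b ha hb => simp only [map_add, ha, hb]
    | tmul a b => simp [actL_apply]
  rw [actL_apply, h1, h, ← h2, actL_apply y]

theorem actR_mul (x y : H) (v : H') : actR p (x * y) v = actR p y (actR p x v) := by
  have h := coassoc_apply (R := K) v
  have h1 : ∀ t : H' ⊗[K] H', TensorProduct.rid K H' ((p.flip (x * y)).lTensor H' t)
      = TensorProduct.rid K H' (TensorProduct.map (LinearMap.id (M := H'))
        (LinearMap.mul' K K ∘ₗ TensorProduct.map (p.flip y) (p.flip x)) (comul.lTensor H' t)) := by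
    intro t
    induction t with
    | zero => simp
    | add a b ha hb => simp only [map_add, ha, hb]
    | tmul a b => simp [hp.mul_right]
  have h2 : ∀ t : H' ⊗[K] H', actR p y (TensorProduct.rid K H' ((p.flip x).lTensor H' t))
      = TensorProduct.rid K H' (TensorProduct.map (LinearMap.id (M := H'))
        (LinearMap.mul' K K ∘ₗ TensorProduct.map (p.flip y) (p.flip x))
        (TensorProduct.assoc K H' H' H' (comul.rTensor H' t))) := by
    intro t
    induction t with
    | zero => simp
    | add a b ha hb => simp only [map_add, ha, hb]
    | tmul a b =>
      simp only [LinearMap.lTensor_tmul, TensorProduct.rid_tmul, map_smul, LinearMap.rTensor_tmul,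
        actR_apply]
      generalize comul (R := K) a = u
      induction u with
      | zero => simp
      | add a b ha hb => simp only [map_add, ha, hb, TensorProduct.add_tmul, smul_add]
      | tmul c d => simp [smul_smul, mul_comm]
  rw [actR_apply, h1, ← h, ← h2, actR_apply x]

/-- `H` acts on the algebra `H'` through `actL` as on a module algebra. -/
theorem actL_mul_right {ι : Type*} {x : H} {s : Finset ι} {l m : ι → H}
    (h : comul (R := K) x = ∑ i ∈ s, l i ⊗ₜ m i) (v w : H') :
    actL p x (v * w) = ∑ i ∈ s, actL p (l i) v * actL p (m i) w := by
  simp only [actL_apply, Bialgebra.comul_mul]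
  generalize comul (R := K) v = t
  generalize comul (R := K) w = u
  induction t with
  | zero => simp
  | add a b ha hb => simp only [map_add, ha, hb, add_mul, Finset.sum_add_distrib]
  | tmul a b =>
    induction u with
    | zero => simp
    | add a b ha hb => simp only [map_add, ha, hb, mul_add, Finset.sum_add_distrib]
    | tmul c d => simp [hp.mul_left, h, Finset.sum_smul, smul_smul, mul_comm]

theorem actR_mul_right {ι : Type*} {x : H} {s : Finset ι} {l m : ι → H}
    (h : comul (R := K) x = ∑ i ∈ s, l i ⊗ₜ m i) (v w : H') :
    actR p x (v * w) = ∑ i ∈ s, actR p (l i) v * actR p (m i) w := by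
  simp only [actR_apply, Bialgebra.comul_mul]
  generalize comul (R := K) v = t
  generalize comul (R := K) w = u
  induction t with
  | zero => simp
  | add a b ha hb => simp only [map_add, ha, hb, add_mul, Finset.sum_add_distrib]
  | tmul a b =>
    induction u with
    | zero => simp
    | add a b ha hb => simp only [map_add, ha, hb, mul_add, Finset.sum_add_distrib]
    | tmul c d => simp [hp.mul_left, h, Finset.sum_smul, smul_smul, mul_comm]

end IsPairing

theorem exists_comul_eq_sum {C : Type*} [AddCommGroup C] [Module K C] [Coalgebra K C] (x : C) :
    ∃ (s : Finset (C × C)), comul (R := K) x = ∑ i ∈ s, i.1 ⊗ₜ i.2 :=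
  TensorProduct.exists_finset _

variable {U : Type*} [Ring U] [Algebra K U] (ι' : H' →ₐ[K] U) (ι : H →ₐ[K] U)

/-- The relation `∑ (b'₁ | b₁) b'₂ b₂ = ∑ b₁ b'₁ (b'₂ | b₂)` of the quantum double, for a fixed `b` and
all `b'`. -/
def DoubleRel (p : H' →ₗ[K] H →ₗ[K] K) (b : H) : Prop :=
  ∀ b' : H', LinearMap.mul' K U (TensorProduct.map (ι'.toLinearMap ∘ₗ (actL p).flip b')
      ι.toLinearMap (comul b))
    = LinearMap.mul' K U (TensorProduct.map ι.toLinearMap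
      (ι'.toLinearMap ∘ₗ (actR p).flip b') (comul b))

variable {ι' ι}

theorem doubleRel_iff {κ : Type*} {b : H} {s : Finset κ} {l m : κ → H}
    (h : comul (R := K) b = ∑ i ∈ s, l i ⊗ₜ m i) : DoubleRel ι' ι p b ↔
    ∀ b', ∑ i ∈ s, ι' (actL p (l i) b') * ι (m i) = ∑ i ∈ s, ι (l i) * ι' (actR p (m i) b') := by
  simp [DoubleRel, h]

theorem DoubleRel.mul (hp : IsPairing p) {c d : H} (hc : DoubleRel ι' ι p c)
    (hd : DoubleRel ι' ι p d) : DoubleRel ι' ι p (c * d) := by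
  obtain ⟨s, hs⟩ := exists_comul_eq_sum (K := K) c
  obtain ⟨t, ht⟩ := exists_comul_eq_sum (K := K) d
  rw [doubleRel_iff hs] at hc
  rw [doubleRel_iff ht] at hd
  have h : comul (R := K) (c * d) = ∑ i ∈ s ×ˢ t, (i.1.1 * i.2.1) ⊗ₜ (i.1.2 * i.2.2) := by
    rw [Bialgebra.comul_mul, hs, ht, Finset.sum_mul_sum, Finset.sum_product]
    simp
  rw [doubleRel_iff h]
  intro b'
  simp only [Finset.sum_product, map_mul, hp.actL_mul, hp.actR_mul]
  calc ∑ x ∈ s, ∑ y ∈ t, ι' (actL p x.1 (actL p y.1 b')) * (ι x.2 * ι y.2)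
      = ∑ y ∈ t, (∑ x ∈ s, ι' (actL p x.1 (actL p y.1 b')) * ι x.2) * ι y.2 := by
        rw [Finset.sum_comm]; simp only [Finset.sum_mul, mul_assoc]
    _ = ∑ x ∈ s, ι x.1 * ∑ y ∈ t, ι' (actL p y.1 (actR p x.2 b')) * ι y.2 := by
        simp only [hc, Finset.sum_mul, Finset.mul_sum, mul_assoc, IsPairing.actL_actR]
        rw [Finset.sum_comm]
    _ = _ := by simp only [hd, Finset.mul_sum, mul_assoc]

theorem DoubleRel.add {c d : H} (hc : DoubleRel ι' ι p c)
    (hd : DoubleRel ι' ι p d) : DoubleRel ι' ι p (c + d) := fun b' => by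
  simp only [map_add, hc b', hd b']

theorem DoubleRel.algebraMap (hp : IsPairing p) (c : K) :
    DoubleRel ι' ι p (algebraMap K H c) := fun b' => by
  simp [Algebra.algebraMap_eq_smul_one, hp.actL_one,
    hp.actR_one, Algebra.TensorProduct.one_def, TensorProduct.smul_tmul']

theorem DoubleRel.of_adjoin (hp : IsPairing p) {X : Set H} (hX : ∀ x ∈ X, DoubleRel ι' ι p x)
    {b : H} (hb : b ∈ Algebra.adjoin K X) : DoubleRel ι' ι p b := by
  induction hb using Algebra.adjoin_induction with
  | mem x hx => exact hX x hx
  | algebraMap c => exact .algebraMap hp c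
  | add x y _ _ hx hy => exact hx.add hy
  | mul x y _ _ hx hy => exact hx.mul hp hy

end SkewPairing

/-! ### Quantum Serre relations of type `A` and ordered monomials in root vectors -/

namespace SerreTypeA

variable {K A : Type*} [Field K] [Ring A] [Algebra K A]

/-- The elements `x 0, x 1, …` satisfy the quantum Serre relations of type `A` with parameters
`p` and `q`. -/
structure SerreRel (p q : K) (x : ℕ → A) : Prop where
  p_ne : p ≠ 0
  q_ne : q ≠ 0
  comm : ∀ i j, i + 1 < j → Commute (x i) (x j)
  serre₁ : ∀ i, x i ^ 2 * x (i + 1) - (p + q) • (x i * x (i + 1) * x i)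
    + (p * q) • (x (i + 1) * x i ^ 2) = 0
  serre₂ : ∀ i, x i * x (i + 1) ^ 2 - (p + q) • (x (i + 1) * x i * x (i + 1))
    + (p * q) • (x (i + 1) ^ 2 * x i) = 0

/-- `rootVec c x j l` is the root vector of the root `α_j + ⋯ + α_{j+l}`. -/
def rootVec (c : K) (x : ℕ → A) (j : ℕ) : ℕ → A
  | 0 => x j
  | l + 1 => x (j + l + 1) * rootVec c x j l - c • (rootVec c x j l * x (j + l + 1))

theorem commute_rootVec {c : K} {x : ℕ → A} {y : A} {j l : ℕ}
    (h : ∀ i ≤ l, Commute y (x (j + i))) : Commute y (rootVec c x j l) := by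
  induction l with
  | zero => exact h 0 le_rfl
  | succ l ih =>
    have h1 := ih fun i hi => h i (by omega)
    have h2 := h (l + 1) le_rfl
    exact (h2.mul_right h1).sub_right ((h1.mul_right h2).smul_right c)

namespace SerreRel

variable {p q : K} {x : ℕ → A} (h : SerreRel p q x)
include h

/-- Root vectors can also be built up from the largest index down to the smallest. -/
theorem rootVec_succ' (j l : ℕ) : rootVec p⁻¹ x j (l + 1)
    = rootVec p⁻¹ x (j + 1) l * x j - p⁻¹ • (x j * rootVec p⁻¹ x (j + 1) l) := by
  induction l with
  | zero => rfl
  | succ l ih =>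
    rw [rootVec, ih, rootVec, show j + (l + 1) + 1 = j + 1 + l + 1 by ring]
    have h1 := (h.comm j (j + 1 + l + 1) (by omega)).eq
    have h2 : ∀ z, x (j + 1 + l + 1) * (x j * z) = x j * (x (j + 1 + l + 1) * z) := fun z => by
      rw [← mul_assoc, ← h1, mul_assoc]
    simp only [mul_sub, sub_mul, mul_smul_comm, smul_mul_assoc, smul_sub, mul_assoc, ← h1, h2]
    abel

theorem rel_left (i : ℕ) : x i * rootVec p⁻¹ x i 1 = q • (rootVec p⁻¹ x i 1 * x i) := by
  have hp := h.p_ne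
  have h1 := congrArg (fun z => (-p⁻¹) • z) (h.serre₁ i)
  simp only [smul_zero] at h1
  rw [← sub_eq_zero, ← h1]
  simp only [rootVec, add_zero, pow_two, mul_sub, sub_mul, mul_smul_comm, smul_mul_assoc, mul_assoc]
  match_scalars <;> field_simp
  ring

theorem rel_right (i : ℕ) : rootVec p⁻¹ x i 1 * x (i + 1) = q • (x (i + 1) * rootVec p⁻¹ x i 1) := by
  have hp := h.p_ne
  have h1 := congrArg (fun z => (-p⁻¹) • z) (h.serre₂ i)
  simp only [smul_zero] at h1
  rw [← sub_eq_zero, ← h1]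
  simp only [rootVec, add_zero, pow_two, mul_sub, sub_mul, mul_smul_comm, smul_mul_assoc, mul_assoc]
  match_scalars <;> field_simp
  ring

theorem mul_rootVec_self (j l : ℕ) :
    x j * rootVec p⁻¹ x j (l + 1) = q • (rootVec p⁻¹ x j (l + 1) * x j) := by
  induction l with
  | zero => exact h.rel_left j
  | succ l ih =>
    have h1 := (h.comm j (j + (l + 1) + 1) (by omega)).eq
    rw [rootVec]
    generalize rootVec p⁻¹ x j (l + 1) = Y at ih
    generalize x (j + (l + 1) + 1) = z at h1
    have e1 : ∀ t, x j * (z * t) = z * (x j * t) := fun t => by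
      rw [← mul_assoc, h1, mul_assoc]
    have e2 : ∀ t, x j * (Y * t) = q • (Y * (x j * t)) := fun t => by
      rw [← mul_assoc, ih, smul_mul_assoc, mul_assoc]
    simp only [mul_sub, sub_mul, mul_smul_comm, smul_mul_assoc, mul_assoc, h1, ih, e1, e2, smul_sub]
    rw [smul_comm]

/-- The generator of the middle node commutes with the root vector of a chain of three nodes. -/
theorem commute_middle (hpq : p + q ≠ 0) (j : ℕ) :
    Commute (x (j + 1)) (rootVec p⁻¹ x j 2) := by
  have hp := h.p_ne
  have hq := h.q_ne
  have hZ := h.rootVec_succ' j 1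
  have hZ' : rootVec p⁻¹ x j 2 = x (j + 2) * rootVec p⁻¹ x j 1
    - p⁻¹ • (rootVec p⁻¹ x j 1 * x (j + 2)) := rfl
  have hA := h.rel_left (j + 1)
  have hB := h.rel_right j
  have hY : rootVec p⁻¹ x j 1 = x (j + 1) * x j - p⁻¹ • (x j * x (j + 1)) := rfl
  have hY' : rootVec p⁻¹ x (j + 1) 1 = x (j + 2) * x (j + 1) - p⁻¹ • (x (j + 1) * x (j + 2)) := rfl
  generalize rootVec p⁻¹ x j 2 = Z at *
  generalize rootVec p⁻¹ x j 1 = Y at *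
  generalize rootVec p⁻¹ x (j + 1) 1 = Y' at *
  generalize x j = a at *
  generalize x (j + 1) = b at *
  generalize x (j + 2) = c at *
  have hba : b * a = Y + p⁻¹ • (a * b) := by rw [hY]; abel
  have hbc : b * c = p • (c * b - Y') := by
    rw [hY', sub_sub_cancel, smul_smul, mul_inv_cancel₀ hp, one_smul]
  have hbY : b * Y = q⁻¹ • (Y * b) := by rw [hB, smul_smul, inv_mul_cancel₀ hq, one_smul]
  -- Two expressions for `b Z`, from the two ways of writing `Z` as a `q`-commutator.
  have e1 : b * Z = (q * p⁻¹) • (Z * b) + q • (Y' * Y) - p⁻¹ • (Y * Y') := by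
    have e2 : b * (Y' * a) = q • (Y' * Y) + (q * p⁻¹) • (Y' * a * b) := by
      rw [← mul_assoc, hA, smul_mul_assoc, mul_assoc, hba, mul_add, mul_smul_comm, smul_add,
        smul_smul, mul_assoc]
    have e3 : b * (a * Y') = Y * Y' + (q * p⁻¹) • (a * Y' * b) := by
      rw [← mul_assoc, hba, add_mul, smul_mul_assoc, mul_assoc, hA, mul_smul_comm, smul_smul,
        mul_comm q, mul_assoc]
    rw [hZ, mul_sub, mul_smul_comm, e2, e3, sub_mul, smul_mul_assoc]
    match_scalars <;> ring
  have e4 : b * Z = (p * q⁻¹) • (Z * b) - p • (Y' * Y) + q⁻¹ • (Y * Y') := by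
    have e2 : b * (c * Y) = (p * q⁻¹) • (c * Y * b) - p • (Y' * Y) := by
      rw [← mul_assoc, hbc, smul_mul_assoc, sub_mul, mul_assoc, hbY, mul_smul_comm, smul_sub,
        smul_smul, mul_assoc]
    have e3 : b * (Y * c) = (p * q⁻¹) • (Y * c * b) - (p * q⁻¹) • (Y * Y') := by
      rw [← mul_assoc, hbY, smul_mul_assoc, mul_assoc, hbc, mul_smul_comm, smul_smul, mul_sub,
        smul_sub, mul_comm q⁻¹, mul_assoc]
    rw [hZ', mul_sub, mul_smul_comm, e2, e3, sub_mul, smul_mul_assoc]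
    match_scalars <;> field_simp
  have e5 : (p + q) • (b * Z) = (p + q) • (Z * b) := by
    rw [add_smul]
    nth_rewrite 1 [e1]
    nth_rewrite 1 [e4]
    match_scalars <;> field_simp <;> ring
  have e6 := congrArg (fun z => (p + q)⁻¹ • z) e5
  simp only [smul_smul, inv_mul_cancel₀ hpq, one_smul] at e6
  exact e6

variable (hC : ∀ j, Commute (x (j + 1)) (rootVec p⁻¹ x j 2))
include hC

theorem commute_inner (j t u : ℕ) : Commute (x (j + 1 + t)) (rootVec p⁻¹ x j (t + 2 + u)) := by
  induction t generalizing j with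
  | zero =>
    induction u with
    | zero => exact hC j
    | succ u ih =>
      have h1 := h.comm (j + 1) (j + (0 + 2 + u) + 1) (by omega)
      exact (h1.mul_right ih).sub_right ((ih.mul_right h1).smul_right _)
  | succ t ih =>
    have h1 := (h.comm j (j + 1 + (t + 1)) (by omega)).symm
    have h2 := ih (j + 1)
    rw [show j + 1 + 1 + t = j + 1 + (t + 1) by ring] at h2
    rw [show t + 1 + 2 + u = t + 2 + u + 1 by ring, h.rootVec_succ']
    exact (h2.mul_right h1).sub_right ((h1.mul_right h2).smul_right _)

theorem rootVec_mul_rootVec (k l : ℕ) : rootVec p⁻¹ x k (l + 1) * rootVec p⁻¹ x (k + 1) l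
    = q • (rootVec p⁻¹ x (k + 1) l * rootVec p⁻¹ x k (l + 1)) := by
  induction l generalizing k with
  | zero => exact h.rel_right k
  | succ l ih =>
    have h1 := h.commute_inner hC k 0 l
    rw [show 0 + 2 + l = l + 1 + 1 by ring, add_zero] at h1
    have h2 : rootVec p⁻¹ x k (l + 1 + 1) * rootVec p⁻¹ x (k + 2) l
        = q • (rootVec p⁻¹ x (k + 2) l * rootVec p⁻¹ x k (l + 1 + 1)) := by
      have h3 := ih (k + 1)
      have h4 : Commute (x k) (rootVec p⁻¹ x (k + 1 + 1) l) :=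
        commute_rootVec fun i _ => h.comm _ _ (by omega)
      rw [h.rootVec_succ' k]
      change _ * rootVec p⁻¹ x (k + 1 + 1) l = q • (rootVec p⁻¹ x (k + 1 + 1) l * _)
      generalize rootVec p⁻¹ x (k + 1 + 1) l = Y at *
      generalize rootVec p⁻¹ x (k + 1) (l + 1) = Z at *
      have e1 : ∀ t, Z * (Y * t) = q • (Y * (Z * t)) := fun t => by
        rw [← mul_assoc, h3, smul_mul_assoc, mul_assoc]
      have e2 : ∀ t, x k * (Y * t) = Y * (x k * t) := fun t => by
        rw [← mul_assoc, h4.eq, mul_assoc]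
      simp only [sub_mul, mul_sub, smul_mul_assoc, mul_smul_comm, mul_assoc, h4.eq, h3, e1, e2,
        smul_sub]
      rw [smul_comm]
    rw [h.rootVec_succ' (k + 1)]
    change _ * (rootVec p⁻¹ x (k + 2) l * _ - p⁻¹ • (_ * rootVec p⁻¹ x (k + 2) l)) = _ •
      ((rootVec p⁻¹ x (k + 2) l * _ - p⁻¹ • (_ * rootVec p⁻¹ x (k + 2) l)) * _)
    generalize rootVec p⁻¹ x (k + 2) l = Y at *
    generalize rootVec p⁻¹ x k (l + 1 + 1) = Z at *
    have e1 : ∀ t, Z * (Y * t) = q • (Y * (Z * t)) := fun t => by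
      rw [← mul_assoc, h2, smul_mul_assoc, mul_assoc]
    have e2 : ∀ t, Z * (x (k + 1) * t) = x (k + 1) * (Z * t) := fun t => by
      rw [← mul_assoc, ← h1.eq, mul_assoc]
    simp only [sub_mul, mul_sub, smul_mul_assoc, mul_smul_comm, mul_assoc, ← h1.eq, h2, e1, e2,
      smul_sub]
    rw [smul_comm]

end SerreRel

/-- `row g a j = g 0 ^ a 0 * ⋯ * g (j - 1) ^ a (j - 1)`. -/
def row {M : Type*} [Monoid M] (g : ℕ → M) (a : ℕ → ℕ) : ℕ → M
  | 0 => 1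
  | j + 1 => row g a j * g j ^ a j

/-- The ordered monomial with exponents `a` in the elements `G i j` with `j ≤ i < m`. -/
def ordMon {M : Type*} [Monoid M] (G : ℕ → ℕ → M) (a : ℕ → ℕ → ℕ) : ℕ → M
  | 0 => 1
  | m + 1 => ordMon G a m * row (G m) (a m) (m + 1)

theorem row_congr {M : Type*} [Monoid M] (g : ℕ → M) {a b : ℕ → ℕ} {j : ℕ}
    (h : ∀ i < j, a i = b i) : row g a j = row g b j := by
  induction j with
  | zero => rfl
  | succ j ih => rw [row, row, ih fun i hi => h i (by omega), h j (by omega)]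

theorem ordMon_congr {M : Type*} [Monoid M] (G : ℕ → ℕ → M) {a b : ℕ → ℕ → ℕ} {m : ℕ}
    (h : ∀ i < m, ∀ j ≤ i, a i j = b i j) : ordMon G a m = ordMon G b m := by
  induction m with
  | zero => rfl
  | succ m ih =>
    rw [ordMon, ordMon, ih fun i hi => h i (by omega),
      row_congr _ fun i hi => h m (by omega) i (by omega)]

section Span

variable (K)

/-- The span of all powers of `g`. -/
def powSpan (g : A) : Submodule K A := Submodule.span K (Set.range fun a : ℕ => g ^ a)

/-- The span of all ordered monomials in `g 0, …, g (j - 1)`. -/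
def rowSpan (g : ℕ → A) : ℕ → Submodule K A
  | 0 => 1
  | j + 1 => rowSpan g j * powSpan K (g j)

/-- The span of all ordered monomials in the `G i j` with `j ≤ i < m`. -/
def monSpan (G : ℕ → ℕ → A) : ℕ → Submodule K A
  | 0 => 1
  | m + 1 => monSpan G m * rowSpan K (G m) (m + 1)

variable {K}

theorem pow_mem_powSpan (g : A) (a : ℕ) : g ^ a ∈ powSpan K g := Submodule.subset_span ⟨a, rfl⟩

theorem one_mem_rowSpan (g : ℕ → A) (j : ℕ) : (1 : A) ∈ rowSpan K g j := by
  induction j with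
  | zero => exact Submodule.one_le.1 le_rfl
  | succ j ih => simpa [rowSpan] using Submodule.mul_mem_mul ih (pow_mem_powSpan (g j) 0)

theorem one_mem_monSpan (G : ℕ → ℕ → A) (m : ℕ) : (1 : A) ∈ monSpan K G m := by
  induction m with
  | zero => exact Submodule.one_le.1 le_rfl
  | succ m ih => simpa [monSpan] using Submodule.mul_mem_mul ih (one_mem_rowSpan (G m) (m + 1))

theorem rowSpan_le (g : ℕ → A) (j : ℕ) :
    rowSpan K g j ≤ Submodule.span K (Set.range fun a => row g a j) := by
  induction j with
  | zero =>
    refine Submodule.one_le.2 (Submodule.subset_span ⟨0, rfl⟩)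
  | succ j ih =>
    rw [rowSpan]
    refine (mul_le_mul' ih le_rfl).trans ?_
    rw [powSpan, Submodule.span_mul_span]
    refine Submodule.span_mono ?_
    rintro _ ⟨_, ⟨a, rfl⟩, _, ⟨k, rfl⟩, rfl⟩
    refine ⟨fun i => if i = j then k else a i, ?_⟩
    simp only [row, if_true]
    congr 1
    exact row_congr _ fun i hi => if_neg hi.ne

theorem monSpan_le (G : ℕ → ℕ → A) (m : ℕ) :
    monSpan K G m ≤ Submodule.span K (Set.range fun a => ordMon G a m) := by
  induction m with
  | zero =>
    refine Submodule.one_le.2 (Submodule.subset_span ⟨0, rfl⟩)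
  | succ m ih =>
    rw [monSpan]
    refine (mul_le_mul' ih (rowSpan_le _ _)).trans ?_
    rw [Submodule.span_mul_span]
    refine Submodule.span_mono ?_
    rintro _ ⟨_, ⟨a, rfl⟩, _, ⟨b, rfl⟩, rfl⟩
    refine ⟨fun i => if i = m then b else a i, ?_⟩
    simp only [ordMon, if_true]
    congr 1
    exact ordMon_congr _ fun i hi j _ => by rw [if_neg hi.ne]

theorem pow_mul_comm_smul {g y : A} {c : K} (h : g * y = c • (y * g)) (a : ℕ) :
    g ^ a * y = c ^ a • (y * g ^ a) := by
  induction a with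
  | zero => simp
  | succ a ih =>
    rw [pow_succ, mul_assoc, h, mul_smul_comm, ← mul_assoc, ih, smul_mul_assoc, smul_smul,
      mul_assoc, pow_succ, mul_comm c]

theorem mem_span_pair_mul {S : Submodule K A} {y z w : A} (hz : z ∈ S) (hw : w ∈ S) (c : K) :
    z + c • (y * w) ∈ Submodule.span K {1, y} * S := by
  refine add_mem ?_ (Submodule.smul_mem _ _ (Submodule.mul_mem_mul ?_ hw))
  · simpa using Submodule.mul_mem_mul (Submodule.subset_span (Set.mem_insert 1 {y})) hz
  · exact Submodule.subset_span (Set.mem_insert_of_mem _ rfl)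

theorem powSpan_mul_le {g y : A} {c : K} (h : g * y = c • (y * g)) :
    powSpan K g * Submodule.span K {1, y} ≤ Submodule.span K {1, y} * powSpan K g := by
  have h0 := pow_mem_powSpan (K := K) g
  rw [powSpan, Submodule.span_mul_span, Submodule.span_le, ← powSpan]
  rintro _ ⟨_, ⟨a, rfl⟩, z, hz, rfl⟩
  obtain rfl | rfl := hz
  · simpa using mem_span_pair_mul (y := y) (h0 a) (h0 a) 0
  · simpa [pow_mul_comm_smul h a] using
      mem_span_pair_mul (y := z) (zero_mem (powSpan K g)) (h0 a) (c ^ a)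

/-- Two `q`-commuting elements `f` and `g` such that `y` fails to `d`-commute with `g` only by `f`: the
ordered monomials in `f` and `g` can be moved past `y`. -/
theorem powSpan_mul_powSpan_mul_le {g f y : A} {c d q : K} (hf : f * y = c • (y * f))
    (hg : g * y = f + d • (y * g)) (hq : q ≠ 0) (hfg : f * g = q • (g * f)) :
    powSpan K f * powSpan K g * Submodule.span K {1, y}
      ≤ Submodule.span K {1, y} * (powSpan K f * powSpan K g) := by
  have hgf : g * f = q⁻¹ • (f * g) := by rw [hfg, smul_smul, inv_mul_cancel₀ hq, one_smul]
  have hpow : ∀ b : ℕ, ∃ β γ : K, g ^ (b + 1) * y = β • (f * g ^ b) + γ • (y * g ^ (b + 1)) := by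
    intro b
    induction b with
    | zero => exact ⟨1, d, by simp [hg]⟩
    | succ b ih =>
      obtain ⟨β, γ, hb⟩ := ih
      refine ⟨(q⁻¹) ^ (b + 1) + d * β, d * γ, ?_⟩
      have h1 : g ^ (b + 1) * f = (q⁻¹) ^ (b + 1) • (f * g ^ (b + 1)) := pow_mul_comm_smul hgf _
      rw [pow_succ _ (b + 1), mul_assoc, hg, mul_add, mul_smul_comm, ← mul_assoc, hb, h1]
      simp only [add_mul, smul_mul_assoc, mul_assoc, smul_add, smul_smul, add_smul, ← pow_succ]
      abel
  have h0 : ∀ a b, f ^ a * g ^ b ∈ powSpan K f * powSpan K g := fun a b =>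
    Submodule.mul_mem_mul (pow_mem_powSpan f a) (pow_mem_powSpan g b)
  refine Submodule.mul_le.2 fun t ht z hz => ?_
  rw [powSpan, powSpan, Submodule.span_mul_span] at ht
  induction ht using Submodule.span_induction with
  | zero => simp
  | add a b _ _ ha hb => rw [add_mul]; exact add_mem ha hb
  | smul c a _ ha => rw [smul_mul_assoc]; exact Submodule.smul_mem _ _ ha
  | mem t ht =>
    obtain ⟨_, ⟨a, rfl⟩, _, ⟨b, rfl⟩, rfl⟩ := ht
    obtain ⟨u, v, rfl⟩ := Submodule.mem_span_pair.1 hz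
    simp only [mul_add, mul_smul_comm, mul_one]
    refine add_mem (Submodule.smul_mem _ _ ?_) (Submodule.smul_mem _ _ ?_)
    · simpa using mem_span_pair_mul (y := y) (h0 a b) (h0 a b) 0
    · rcases b with _ | b
      · simpa [pow_mul_comm_smul hf a] using mem_span_pair_mul (y := y) (zero_mem _) (h0 a 0) (c ^ a)
      · obtain ⟨β, γ, hb⟩ := hpow b
        have := mem_span_pair_mul (y := y) (Submodule.smul_mem _ β (h0 (a + 1) b)) (h0 a (b + 1))
          (γ * c ^ a)
        convert this using 1
        rw [mul_assoc, hb, mul_add, mul_smul_comm, mul_smul_comm, ← mul_assoc, ← mul_assoc,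
          pow_mul_comm_smul hf, pow_succ f, smul_mul_assoc, smul_smul, mul_assoc y]

end Span

namespace SerreRel

variable {p q : K} {x : ℕ → A} (h : SerreRel p q x)
  (hC : ∀ j, Commute (x (j + 1)) (rootVec p⁻¹ x j 2))
include h hC

/-- The row of root vectors with the last index `m` can be moved past `x k`, for `k < m`. -/
theorem rowSpan_mul_le {k m : ℕ} (hk : k < m) {j : ℕ} (hj : j ≤ m + 1) (hjk : j ≠ k + 1) :
    rowSpan K (fun j => rootVec p⁻¹ x j (m - j)) j * Submodule.span K {1, x k}
      ≤ Submodule.span K {1, x k} * rowSpan K (fun j => rootVec p⁻¹ x j (m - j)) j := by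
  have hself : rootVec p⁻¹ x k (m - k) * x k = q⁻¹ • (x k * rootVec p⁻¹ x k (m - k)) := by
    obtain ⟨l, rfl⟩ : ∃ l, m = k + (l + 1) := ⟨m - k - 1, by omega⟩
    rw [Nat.add_sub_cancel_left, h.mul_rootVec_self, smul_smul, inv_mul_cancel₀ h.q_ne, one_smul]
  induction j with
  | zero => simp [rowSpan]
  | succ j ih =>
    by_cases hj2 : j = k + 1
    · -- The two neighbouring root vectors, which have to be moved together.
      subst hj2
      obtain ⟨l, rfl⟩ : ∃ l, m = k + 1 + l := ⟨m - (k + 1), by omega⟩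
      have key := powSpan_mul_powSpan_mul_le (c := q⁻¹) (d := p⁻¹) hself
        (g := rootVec p⁻¹ x (k + 1) l)
        (by
          rw [show k + 1 + l - k = l + 1 by omega, h.rootVec_succ', sub_add_cancel])
        h.q_ne
        (by
          rw [show k + 1 + l - k = l + 1 by omega]
          exact h.rootVec_mul_rootVec hC k l)
      have hlow : ∀ i ≤ k, rowSpan K (fun j => rootVec p⁻¹ x j (k + 1 + l - j)) i
          * Submodule.span K {1, x k} ≤ Submodule.span K {1, x k}
            * rowSpan K (fun j => rootVec p⁻¹ x j (k + 1 + l - j)) i := by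
        intro i hi
        induction i with
        | zero => simp [rowSpan]
        | succ i ih =>
          have hc : Commute (x k) (rootVec p⁻¹ x i (k + 1 + l - i)) := by
            have := h.commute_inner hC i (k - i - 1) l
            rwa [show i + 1 + (k - i - 1) = k by omega,
              show k - i - 1 + 2 + l = k + 1 + l - i by omega] at this
          rw [rowSpan, mul_assoc]
          refine (mul_le_mul' le_rfl (powSpan_mul_le (c := 1) (by rw [one_smul, hc.eq]))).trans ?_
          rw [← mul_assoc, ← mul_assoc]
          exact mul_le_mul' (ih (by omega)) le_rfl
      rw [rowSpan, rowSpan, mul_assoc (rowSpan K _ k), mul_assoc (rowSpan K _ k)]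
      simp only [Nat.add_sub_cancel_left]
      refine (mul_le_mul' le_rfl key).trans ?_
      rw [← mul_assoc, ← mul_assoc _ (rowSpan K _ k)]
      exact mul_le_mul' (hlow k le_rfl) le_rfl
    · have hq : ∃ c : K, rootVec p⁻¹ x j (m - j) * x k = c • (x k * rootVec p⁻¹ x j (m - j)) := by
        rcases lt_trichotomy j k with hlt | rfl | hgt
        · have := h.commute_inner hC j (k - j - 1) (m - k - 1)
          rw [show j + 1 + (k - j - 1) = k by omega,
              show k - j - 1 + 2 + (m - k - 1) = m - j by omega] at this
          exact ⟨1, by rw [one_smul, this.eq]⟩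
        · exact ⟨_, hself⟩
        · have : Commute (x k) (rootVec p⁻¹ x j (m - j)) :=
            commute_rootVec fun i _ => h.comm _ _ (by omega)
          exact ⟨1, by rw [one_smul, this.eq]⟩
      obtain ⟨c, hc⟩ := hq
      rw [rowSpan, mul_assoc]
      refine (mul_le_mul' le_rfl (powSpan_mul_le hc)).trans ?_
      rw [← mul_assoc, ← mul_assoc]
      exact mul_le_mul' (ih (by omega) hj2) le_rfl

/-- The span of the ordered monomials is stable under right multiplication by generators. -/
theorem monSpan_mul_le {k m : ℕ} (hk : k < m) :
    monSpan K (fun m j => rootVec p⁻¹ x j (m - j)) m * Submodule.span K {1, x k}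
      ≤ monSpan K (fun m j => rootVec p⁻¹ x j (m - j)) m := by
  induction m with
  | zero => omega
  | succ m ih =>
    rw [monSpan, mul_assoc]
    by_cases hkm : k = m
    · subst hkm
      refine mul_le_mul' le_rfl ?_
      rw [rowSpan, mul_assoc]
      refine mul_le_mul' le_rfl ?_
      simp only [Nat.sub_self, rootVec]
      rw [powSpan, Submodule.span_mul_span]
      refine Submodule.span_mono ?_
      rintro _ ⟨_, ⟨a, rfl⟩, z, hz, rfl⟩
      obtain rfl | rfl := hz
      · exact ⟨a, by simp⟩
      · exact ⟨a + 1, by simp [pow_succ]⟩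
    · refine (mul_le_mul' le_rfl (h.rowSpan_mul_le hC (by omega) le_rfl (by omega))).trans ?_
      rw [← mul_assoc]
      exact mul_le_mul' (ih (by omega)) le_rfl

/-- The ordered monomials in the root vectors span the algebra generated by the `x i`. -/
theorem adjoin_le_span_ordMon (m : ℕ) {y : A} (hy : y ∈ Algebra.adjoin K (x '' Set.Iio m)) :
    y ∈ Submodule.span K
      (Set.range fun a => ordMon (fun m j => rootVec p⁻¹ x j (m - j)) a m) := by
  refine monSpan_le _ _ ?_
  rw [← Subalgebra.mem_toSubmodule, Algebra.adjoin_eq_span] at hy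
  refine Submodule.span_le.2 ?_ hy
  intro z hz
  induction hz using Submonoid.closure_induction_right with
  | one => exact one_mem_monSpan _ _
  | mul_right y _ z hz hy =>
    obtain ⟨k, hk, rfl⟩ := hz
    exact h.monSpan_mul_le hC hk (Submodule.mul_mem_mul hy
      (Submodule.subset_span (Set.mem_insert_of_mem _ rfl)))

end SerreRel

end SerreTypeA

/-! ### Coproducts of root vectors -/

namespace SerreTypeA

section Coproduct

variable {K A : Type*} [Field K] [Ring A] [Algebra K A]

/-- `torProd w j l = w j * w (j + 1) * ⋯ * w (j + l)`. -/
def torProd (w : ℕ → A) (j : ℕ) : ℕ → A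
  | 0 => w j
  | l + 1 => torProd w j l * w (j + l + 1)

/-- The commutation relations of the generators `x i` and of the torus elements `w i` of a Borel
subalgebra (for indices below `N`) on which the coproduct of the root vectors depends. -/
structure SkewRel (c d : K) (N : ℕ) (x w : ℕ → A) : Prop where
  comm_x : ∀ i j, i + 1 < j → j < N → Commute (x i) (x j)
  comm_w : ∀ i j, i < N → j < N → Commute (w i) (w j)
  far : ∀ i j, i < N → j < N → i + 1 < j ∨ j + 1 < i → Commute (w i) (x j)
  next : ∀ i, i + 1 < N → w i * x (i + 1) = d • (x (i + 1) * w i)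
  prev : ∀ i, i + 1 < N → w (i + 1) * x i = c • (x i * w (i + 1))

namespace SkewRel

variable {c d : K} {N : ℕ} {x w : ℕ → A} (h : SkewRel c d N x w)
include h

theorem commute_torProd_x {j l k : ℕ} (h1 : j + l + 1 < k) (hk : k < N) :
    Commute (torProd w j l) (x k) := by
  induction l with
  | zero => exact h.far j k (by omega) hk (.inl h1)
  | succ l ih => exact (ih (by omega)).mul_left (h.far _ k (by omega) hk (.inl (by omega)))

theorem torProd_mul_next {j l : ℕ} (hk : j + l + 1 < N) :
    torProd w j l * x (j + l + 1) = d • (x (j + l + 1) * torProd w j l) := by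
  cases l with
  | zero => exact h.next j hk
  | succ l =>
    have h1 := (h.commute_torProd_x (j := j) (l := l) (k := j + (l + 1) + 1) (by omega) hk).eq
    rw [torProd, mul_assoc, show j + l + 1 = j + (l + 1) by ring, h.next _ hk, mul_smul_comm,
      ← mul_assoc, h1, mul_assoc]

theorem commute_torProd_w {j l k : ℕ} (h1 : j + l < N) (hk : k < N) :
    Commute (torProd w j l) (w k) := by
  induction l with
  | zero => exact h.comm_w j k (by omega) hk
  | succ l ih => exact (ih (by omega)).mul_left (h.comm_w _ k (by omega) hk)

theorem commute_w_rootVec {j l k : ℕ} (h1 : j + l + 1 < k) (hk : k < N) :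
    Commute (w k) (rootVec c x j l) :=
  commute_rootVec fun i hi => h.far k (j + i) hk (by omega) (.inr (by omega))

theorem commute_x_rootVec {j l k : ℕ} (h1 : j + l + 1 < k) (hk : k < N) :
    Commute (x k) (rootVec c x j l) :=
  commute_rootVec fun i hi => (h.comm_x (j + i) k (by omega) hk).symm

theorem w_mul_rootVec {j l : ℕ} (hk : j + l + 1 < N) :
    w (j + l + 1) * rootVec c x j l = c • (rootVec c x j l * w (j + l + 1)) := by
  cases l with
  | zero => exact h.prev j hk
  | succ l =>
    have h1 := (h.commute_w_rootVec (j := j) (l := l) (k := j + (l + 1) + 1) (by omega) hk).eq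
    have h2 := h.prev (j + l + 1) hk
    rw [rootVec]
    change w (j + l + 1 + 1) * _ = _ at h1
    change w (j + l + 1 + 1) * _ = _ • (_ * w (j + l + 1 + 1))
    generalize w (j + l + 1 + 1) = u at *
    generalize rootVec c x j l = Y at *
    generalize x (j + l + 1) = z at *
    have e1 : ∀ t, u * (Y * t) = Y * (u * t) := fun t => by rw [← mul_assoc, h1, mul_assoc]
    have e2 : ∀ t, u * (z * t) = c • (z * (u * t)) := fun t => by
      rw [← mul_assoc, h2, smul_mul_assoc, mul_assoc]
    simp only [mul_sub, sub_mul, mul_smul_comm, smul_mul_assoc, mul_assoc, h1, h2, e1, e2, smul_sub]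

theorem torProd_mul_rootVec {q : K} (hq : ∀ i < N, w i * x i = q • (x i * w i)) (hcd : c * d * q = 1)
    {j l : ℕ} (hk : j + l < N) :
    torProd w j l * rootVec c x j l = q • (rootVec c x j l * torProd w j l) := by
  induction l with
  | zero => exact hq j hk
  | succ l ih =>
    have h1 := ih (by omega)
    have h2 := h.torProd_mul_next (j := j) (l := l) hk
    have h3 := h.w_mul_rootVec (j := j) (l := l) hk
    have h4 := hq (j + l + 1) hk
    rw [torProd, rootVec]
    generalize w (j + l + 1) = u at *
    generalize rootVec c x j l = Y at *
    generalize torProd w j l = W at *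
    generalize x (j + l + 1) = z at *
    have e1 : ∀ t, W * (Y * t) = q • (Y * (W * t)) := fun t => by
      rw [← mul_assoc, h1, smul_mul_assoc, mul_assoc]
    have e2 : ∀ t, W * (z * t) = d • (z * (W * t)) := fun t => by
      rw [← mul_assoc, h2, smul_mul_assoc, mul_assoc]
    have e3 : ∀ t, u * (Y * t) = c • (Y * (u * t)) := fun t => by
      rw [← mul_assoc, h3, smul_mul_assoc, mul_assoc]
    have e4 : ∀ t, u * (z * t) = q • (z * (u * t)) := fun t => by
      rw [← mul_assoc, h4, smul_mul_assoc, mul_assoc]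
    simp only [mul_sub, sub_mul, mul_smul_comm, smul_mul_assoc, mul_assoc, h3, h4, e1, e2,
      e3, e4, smul_sub, smul_smul]
    match_scalars
    · linear_combination q * hcd
    · linear_combination -(q * c) * hcd

/-- The coproduct of a root vector, for an algebra map `D` such that the `x i` are skew primitive
and the `w i` are group-like. -/
theorem comul_rootVec {D : A →ₐ[K] A ⊗[K] A}
    (hD : ∀ i < N, D (x i) = x i ⊗ₜ 1 + w i ⊗ₜ x i) {j l : ℕ} (hk : j + l < N) :
    D (rootVec c x j l) = rootVec c x j l ⊗ₜ 1 + torProd w j l ⊗ₜ rootVec c x j l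
      + (1 - c * d) • ∑ t ∈ Finset.range l,
        (rootVec c x (j + t + 1) (l - t - 1) * torProd w j t) ⊗ₜ rootVec c x j t := by
  induction l with
  | zero => simp [rootVec, torProd, hD j hk]
  | succ l ih =>
    have ih := ih (by omega)
    have hW := h.torProd_mul_next (j := j) (l := l) hk
    have hV := h.w_mul_rootVec (j := j) (l := l) hk
    have hWw := (h.commute_torProd_w (j := j) (l := l) (k := j + l + 1) (by omega) hk).eq
    have hsum : ∀ t ∈ Finset.range l,
        (x (j + l + 1) ⊗ₜ[K] (1 : A) + w (j + l + 1) ⊗ₜ x (j + l + 1))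
          * ((rootVec c x (j + t + 1) (l - t - 1) * torProd w j t) ⊗ₜ rootVec c x j t)
        - c • (((rootVec c x (j + t + 1) (l - t - 1) * torProd w j t) ⊗ₜ rootVec c x j t)
          * (x (j + l + 1) ⊗ₜ[K] (1 : A) + w (j + l + 1) ⊗ₜ x (j + l + 1)))
        = (rootVec c x (j + t + 1) (l + 1 - t - 1) * torProd w j t) ⊗ₜ rootVec c x j t := by
      intro t ht
      have ht := Finset.mem_range.1 ht
      have h1 := (h.commute_x_rootVec (j := j) (l := t) (k := j + l + 1) (by omega) hk).eq
      have h2 := (h.commute_torProd_x (j := j) (l := t) (k := j + l + 1) (by omega) hk).eq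
      have h3 := (h.commute_torProd_w (j := j) (l := t) (k := j + l + 1) (by omega) hk).eq
      have h4 := h.w_mul_rootVec (j := j + t + 1) (l := l - t - 1) (by omega)
      rw [show j + t + 1 + (l - t - 1) + 1 = j + l + 1 by omega] at h4
      have h5 : rootVec c x (j + t + 1) (l + 1 - t - 1)
          = x (j + l + 1) * rootVec c x (j + t + 1) (l - t - 1)
            - c • (rootVec c x (j + t + 1) (l - t - 1) * x (j + l + 1)) := by
        rw [show l + 1 - t - 1 = l - t - 1 + 1 by omega, rootVec,
          show j + t + 1 + (l - t - 1) + 1 = j + l + 1 by omega]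
      rw [h5]
      generalize x (j + l + 1) = z at *
      generalize w (j + l + 1) = u at *
      generalize rootVec c x (j + t + 1) (l - t - 1) = Y at *
      generalize torProd w j t = W at *
      have e4 : ∀ a, u * (Y * a) = c • (Y * (u * a)) := fun a => by
        rw [← mul_assoc, h4, smul_mul_assoc, mul_assoc]
      simp only [mul_add, add_mul, sub_mul, Algebra.TensorProduct.tmul_mul_tmul, one_mul, mul_one,
        mul_assoc, smul_mul_assoc, h1, h2, h3, e4, TensorProduct.sub_tmul,
        ← TensorProduct.smul_tmul', smul_add]
      abel
    rw [rootVec, map_sub, map_smul, map_mul, map_mul, hD (j + l + 1) hk, ih, torProd, Finset.sum_range_succ]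
    have hsum' := Finset.sum_congr rfl hsum
    rw [Finset.sum_sub_distrib, ← Finset.mul_sum, ← Finset.smul_sum, ← Finset.sum_mul] at hsum'
    rw [← hsum']
    rw [show l + 1 - l - 1 = 0 by omega]
    generalize ∑ t ∈ Finset.range l,
        (rootVec c x (j + t + 1) (l - t - 1) * torProd w j t) ⊗ₜ[K] rootVec c x j t = S
    rw [show rootVec c x (j + l + 1) 0 = x (j + l + 1) from rfl]
    generalize x (j + l + 1) = z at *
    generalize w (j + l + 1) = u at *
    generalize rootVec c x j l = Y at *
    generalize torProd w j l = W at *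
    simp only [mul_add, add_mul, Algebra.TensorProduct.tmul_mul_tmul, one_mul, mul_one,
      mul_smul_comm, smul_mul_assoc, hW, hV, ← hWw, TensorProduct.sub_tmul, TensorProduct.tmul_sub,
      ← TensorProduct.smul_tmul', TensorProduct.tmul_smul, smul_add, smul_sub]
    module

end SkewRel

end Coproduct

end SerreTypeA

/-! ### Orthogonality of ordered monomials in root vectors -/

namespace SerreTypeA

open SkewPairing Coalgebra

variable {K H' H : Type*} [Field K] [Ring H'] [Bialgebra K H'] [Ring H] [Bialgebra K H]

theorem actL_mul_eq {p : H' →ₗ[K] H →ₗ[K] K} (hp : IsPairing p) (x : H) (v v' : H') :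
    actL p x (v * v') = LinearMap.mul' K H'
      (TensorProduct.map ((actL p).flip v) ((actL p).flip v') (comul x)) := by
  obtain ⟨s, hs⟩ := exists_comul_eq_sum (K := K) x
  rw [hp.actL_mul_right hs, hs]
  simp

theorem rootVec_mem {A : Type*} [Ring A] [Algebra K A] {c : K} {x : ℕ → A} {j l m : ℕ}
    (h : j + l < m) : rootVec c x j l ∈ Algebra.adjoin K (x '' Set.Iio m) := by
  induction l with
  | zero => exact Algebra.subset_adjoin ⟨j, h, rfl⟩
  | succ l ih =>
    have h1 : x (j + l + 1) ∈ Algebra.adjoin K (x '' Set.Iio m) :=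
      Algebra.subset_adjoin ⟨j + l + 1, h, rfl⟩
    have h2 := ih (by omega)
    exact sub_mem (mul_mem h1 h2) (Subalgebra.smul_mem _ (mul_mem h2 h1) _)

/-- A Hopf pairing of two Borel subalgebras of type `A` of rank `N`, given by their generators
`x i`, `w i` and `y i`, `w' i` with `i < N`. -/
structure BorelPairing (p : H' →ₗ[K] H →ₗ[K] K) (c d q κ : K) (N : ℕ) (x w : ℕ → H)
    (y w' : ℕ → H') : Prop where
  pairing : IsPairing p
  skew : SkewRel c d N x w
  skew' : SkewRel d c N y w'
  self : ∀ i < N, w' i * y i = q • (y i * w' i)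
  cdq : c * d * q = 1
  comul_x : ∀ i < N, comul (R := K) (x i) = x i ⊗ₜ 1 + w i ⊗ₜ x i
  comul_w : ∀ i < N, comul (R := K) (w i) = w i ⊗ₜ w i
  comul_y : ∀ i < N, comul (R := K) (y i) = 1 ⊗ₜ y i + y i ⊗ₜ w' i
  comul_w' : ∀ i < N, comul (R := K) (w' i) = w' i ⊗ₜ w' i
  counit_x : ∀ i < N, counit (R := K) (x i) = 0
  counit_w : ∀ i < N, counit (R := K) (w i) = 1
  counit_y : ∀ i < N, counit (R := K) (y i) = 0
  counit_w' : ∀ i < N, counit (R := K) (w' i) = 1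
  y_x : ∀ i j, i < N → j < N → p (y i) (x j) = if i = j then κ else 0
  y_w : ∀ i j, i < N → j < N → p (y i) (w j) = 0
  w'_x : ∀ i j, i < N → j < N → p (w' i) (x j) = 0

namespace BorelPairing

variable {p : H' →ₗ[K] H →ₗ[K] K} {c d q κ : K} {N : ℕ} {x w : ℕ → H} {y w' : ℕ → H'}
  (B : BorelPairing p c d q κ N x w y w')
include B

theorem comul_E {j l : ℕ} (h : j + l < N) : comul (R := K) (rootVec c x j l)
    = rootVec c x j l ⊗ₜ 1 + torProd w j l ⊗ₜ rootVec c x j l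
      + (1 - c * d) • ∑ t ∈ Finset.range l,
        (rootVec c x (j + t + 1) (l - t - 1) * torProd w j t) ⊗ₜ[K] rootVec c x j t :=
  B.skew.comul_rootVec (D := Bialgebra.comulAlgHom K H) B.comul_x h

theorem comul_F {j l : ℕ} (h : j + l < N) : comul (R := K) (rootVec d y j l)
    = 1 ⊗ₜ rootVec d y j l + rootVec d y j l ⊗ₜ torProd w' j l
      + (1 - c * d) • ∑ t ∈ Finset.range l,
        rootVec d y j t ⊗ₜ[K] (rootVec d y (j + t + 1) (l - t - 1) * torProd w' j t) := by
  have h1 := B.skew'.comul_rootVec (D := ((Algebra.TensorProduct.comm K H' H').toAlgHom.comp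
    (Bialgebra.comulAlgHom K H'))) (fun i hi => by simp [B.comul_y i hi]) h
  have h2 : TensorProduct.comm K H' H' (comul (rootVec d y j l)) = _ := h1
  have h3 := congrArg (TensorProduct.comm K H' H') h2
  simp only [TensorProduct.comm_comm, map_add, map_smul, map_sum, TensorProduct.comm_tmul] at h3
  rw [h3, mul_comm d c]

theorem counit_E {j l : ℕ} (h : j + l < N) : counit (R := K) (rootVec c x j l) = 0 := by
  induction l with
  | zero => exact B.counit_x j h
  | succ l ih => simp [rootVec, ih (by omega)]

theorem counit_F {j l : ℕ} (h : j + l < N) : counit (R := K) (rootVec d y j l) = 0 := by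
  induction l with
  | zero => exact B.counit_y j h
  | succ l ih => simp [rootVec, ih (by omega)]

theorem actL_x_mul {i : ℕ} (hi : i < N) (v v' : H') :
    actL p (x i) (v * v') = actL p (x i) v * v' + actL p (w i) v * actL p (x i) v' := by
  simp [actL_mul_eq B.pairing, B.comul_x i hi, B.pairing.actL_one]

theorem actL_w_mul {i : ℕ} (hi : i < N) (v v' : H') :
    actL p (w i) (v * v') = actL p (w i) v * actL p (w i) v' := by
  simp [actL_mul_eq B.pairing, B.comul_w i hi]

theorem actL_w {i : ℕ} (hi : i < N) {v : H'} (hv : v ∈ Algebra.adjoin K (y '' Set.Iio N)) :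
    actL p (w i) v = v := by
  induction hv using Algebra.adjoin_induction with
  | mem v hv =>
    obtain ⟨j, hj, rfl⟩ := hv
    simp [actL_apply, B.comul_y j hj, B.y_w j i hj hi, B.pairing.one_left, B.counit_w i hi]
  | algebraMap a =>
    simp [Algebra.algebraMap_eq_smul_one, B.pairing.actL_one_right, B.counit_w i hi]
  | add a b _ _ ha hb => rw [map_add, ha, hb]
  | mul a b _ _ ha hb => rw [B.actL_w_mul hi, ha, hb]

theorem actL_torProd {j l : ℕ} (h : j + l < N) {v : H'}
    (hv : v ∈ Algebra.adjoin K (y '' Set.Iio N)) : actL p (torProd w j l) v = v := by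
  induction l with
  | zero => exact B.actL_w h hv
  | succ l ih =>
    rw [torProd, B.pairing.actL_mul, B.actL_w (i := j + l + 1) h hv, ih (by omega)]

theorem actL_E_mul {j l : ℕ} (h : j + l < N) {v : H'} (hv : v ∈ Algebra.adjoin K (y '' Set.Iio N))
    (v' : H') : actL p (rootVec c x j l) (v * v')
      = actL p (rootVec c x j l) v * v' + v * actL p (rootVec c x j l) v'
        + (1 - c * d) • ∑ t ∈ Finset.range l,
          actL p (rootVec c x (j + t + 1) (l - t - 1)) v * actL p (rootVec c x j t) v' := by
  rw [actL_mul_eq B.pairing, B.comul_E h]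
  simp only [map_add, map_smul, map_sum, TensorProduct.map_tmul, LinearMap.mul'_apply,
    LinearMap.flip_apply, B.pairing.actL_one, B.actL_torProd h hv]
  congr 2
  refine Finset.sum_congr rfl fun t ht => ?_
  have := Finset.mem_range.1 ht
  rw [B.pairing.actL_mul, B.actL_torProd (by omega) hv]

/-- Group-like elements of `H'` do not contribute to the pairing with the subalgebra generated by the
`x i`. -/
theorem apply_mul_groupLike {g : H'} (hg : comul (R := K) g = g ⊗ₜ g)
    (hg1 : counit (R := K) g = 1) (hgx : ∀ i < N, p g (x i) = 0) {u : H}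
    (hu : u ∈ Algebra.adjoin K (x '' Set.Iio N)) (v : H') : p (v * g) u = p v u := by
  rw [← Subalgebra.mem_toSubmodule, Algebra.adjoin_eq_span] at hu
  induction hu using Submodule.span_induction with
  | zero => simp
  | add a b _ _ ha hb => rw [map_add, map_add, ha, hb]
  | smul a b _ hb => rw [map_smul, map_smul, hb]
  | mem u hu =>
    induction hu using Submonoid.closure_induction_right generalizing v with
    | one => simp [B.pairing.one_right, hg1]
    | mul_right u _ z hz ih =>
      obtain ⟨i, hi, rfl⟩ := hz
      have h1 : actL p (x i) g = 0 := by simp [actL_apply, hg, hgx i hi]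
      rw [B.pairing.apply_mul, B.pairing.apply_mul, B.actL_x_mul hi, h1, mul_zero, add_zero, ih]

theorem groupLike_torProd {j l : ℕ} (h : j + l < N) :
    comul (R := K) (torProd w' j l) = torProd w' j l ⊗ₜ torProd w' j l
      ∧ counit (R := K) (torProd w' j l) = 1 ∧ ∀ i < N, p (torProd w' j l) (x i) = 0 := by
  induction l with
  | zero => exact ⟨B.comul_w' j h, B.counit_w' j h, fun i hi => B.w'_x j i h hi⟩
  | succ l ih =>
    obtain ⟨h1, h2, h3⟩ := ih (by omega)
    have h : j + l + 1 < N := h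
    refine ⟨?_, ?_, fun i hi => ?_⟩
    · simp [torProd, h1, B.comul_w' _ h]
    · simp [torProd, h2, B.counit_w' _ h]
    · simp [torProd, B.pairing.mul_left, B.comul_x i hi, h3 i hi, B.w'_x _ i h hi]

theorem apply_mul_torProd {j l : ℕ} (h : j + l < N) {u : H}
    (hu : u ∈ Algebra.adjoin K (x '' Set.Iio N)) (v : H') :
    p (v * torProd w' j l) u = p v u :=
  have h1 := B.groupLike_torProd h
  B.apply_mul_groupLike h1.1 h1.2.1 h1.2.2 hu v

theorem apply_torProd_E {j l j' l' : ℕ} (h : j + l < N) (h' : j' + l' < N) :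
    p (torProd w' j l) (rootVec c x j' l') = 0 := by
  have := B.apply_mul_torProd h (rootVec_mem (c := c) h') 1
  rw [one_mul] at this
  rw [this, B.pairing.one_left, B.counit_E h']

theorem apply_F_w {j l i : ℕ} (h : j + l < N) (hi : i < N) : p (rootVec d y j l) (w i) = 0 := by
  induction l with
  | zero => exact B.y_w j i h hi
  | succ l ih =>
    simp [rootVec, B.pairing.mul_left, B.comul_w i hi, ih (by omega)]

theorem apply_F_x {j l i : ℕ} (h : j + l < N) (hi : i < N) :
    p (rootVec d y j l) (x i) = if j = i ∧ l = 0 then κ else 0 := by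
  cases l with
  | zero => simpa [rootVec] using B.y_x j i h hi
  | succ l =>
    have h : j + l + 1 < N := h
    simp [rootVec, B.pairing.mul_left, B.comul_x i hi, B.pairing.one_right,
      B.counit_F (show j + l < N by omega), B.counit_y _ h, B.apply_F_w (show j + l < N by omega) hi,
      B.y_w _ i h hi]

/-- The value of `p` on a pair of root vectors determines the action of `E` on `F`. -/
theorem actL_E_F_of_apply {j l j' l' : ℕ} {b : K} (h : j + l < N) (h' : j' + l' < N)
    (hb : ∀ t, j' + t < N →
      p (rootVec d y j' t) (rootVec c x j l) = if j' = j ∧ t = l then b else 0) :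
    actL p (rootVec c x j l) (rootVec d y j' l') =
      if j' = j then if l' = l then b • torProd w' j l else if l < l' then
        ((1 - c * d) * b) • (rootVec d y (j + l + 1) (l' - l - 1) * torProd w' j l) else 0 else 0 := by
  rw [actL_apply, B.comul_F h']
  simp only [map_add, map_smul, map_sum, LinearMap.rTensor_tmul, LinearMap.flip_apply,
    TensorProduct.lid_tmul, B.pairing.one_left, B.counit_E h, zero_smul, zero_add, hb l' h']
  have h1 : ∀ t ∈ Finset.range l', p (rootVec d y j' t) (rootVec c x j l)
      • (rootVec d y (j' + t + 1) (l' - t - 1) * torProd w' j' t)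
      = if t = l then (if j' = j then b else 0)
        • (rootVec d y (j' + l + 1) (l' - l - 1) * torProd w' j' l) else 0 := by
    intro t ht
    rw [hb t (by have := Finset.mem_range.1 ht; omega)]
    by_cases h1 : t = l
    · subst h1; simp
    · simp [h1]
  rw [Finset.sum_congr rfl h1, Finset.sum_ite_eq']
  by_cases hj : j' = j
  · subst hj
    by_cases hl : l' = l
    · subst hl; simp
    · by_cases hl2 : l < l' <;> simp [hl, hl2, smul_smul]
  · simp [hj]

theorem apply_F_E {j l j' l' : ℕ} (h : j + l < N) (h' : j' + l' < N) :
    p (rootVec d y j' l') (rootVec c x j l)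
      = if j' = j ∧ l' = l then ((1 - c * d) * κ) ^ l * κ else 0 := by
  induction l generalizing j' l' with
  | zero => simpa [rootVec] using B.apply_F_x h' (i := j) h
  | succ l ih =>
    have h : j + l + 1 < N := h
    have ih : ∀ {j' l' : ℕ}, j' + l' < N → _ := fun {j' l'} => ih (by omega) (j' := j') (l' := l')
    have hx : ∀ {j' t : ℕ}, j' + t < N → p (rootVec d y j' t) (rootVec c x (j + l + 1) 0)
        = if j' = j + l + 1 ∧ t = 0 then κ else 0 := fun ht => B.apply_F_x ht h
    have hE : rootVec c x j l ∈ Algebra.adjoin K (x '' Set.Iio N) := rootVec_mem (by omega)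
    have hx' : x (j + l + 1) ∈ Algebra.adjoin K (x '' Set.Iio N) :=
      Algebra.subset_adjoin ⟨_, h, rfl⟩
    rw [rootVec, map_sub, map_smul, B.pairing.apply_mul, B.pairing.apply_mul,
      B.actL_E_F_of_apply (by omega) h' fun t ht => ih ht,
      show x (j + l + 1) = rootVec c x (j + l + 1) 0 from rfl,
      B.actL_E_F_of_apply (j := j + l + 1) (l := 0) h h' fun t ht => hx ht]
    have e2 : p (if j' = j + l + 1 then if l' = 0 then κ • torProd w' (j + l + 1) 0
        else if 0 < l' then ((1 - c * d) * κ) • (rootVec d y (j + l + 1 + 0 + 1) (l' - 0 - 1)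
          * torProd w' (j + l + 1) 0) else 0 else 0) (rootVec c x j l) = 0 := by
      split_ifs with h1 h2 h3
      · rw [map_smul, LinearMap.smul_apply, B.apply_torProd_E (by omega) (by omega), smul_zero]
      · rw [map_smul, LinearMap.smul_apply, B.apply_mul_torProd (by omega) hE, ih (by omega),
          if_neg (by omega), smul_zero]
      · simp
      · simp
    rw [e2, smul_zero, sub_zero, show rootVec c x (j + l + 1) 0 = x (j + l + 1) from rfl]
    by_cases hj : j' = j
    · subst hj
      rcases lt_trichotomy l' l with hlt | rfl | hgt
      · simp [hlt.ne, hlt.not_gt, show l' ≠ l + 1 by omega]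
      · simp [(B.groupLike_torProd (show j' + l' < N by omega)).2.2 _ h]
      · have e3 := B.apply_F_x (j := j' + l + 1) (l := l' - l - 1) (i := j' + l + 1) (by omega) h
        simp only [hgt, hgt.ne', if_true, if_false, map_smul, LinearMap.smul_apply, smul_eq_mul,
          true_and]
        rw [B.apply_mul_torProd (by omega) hx', e3]
        by_cases hl : l' = l + 1
        · subst hl
          rw [if_pos (by omega), if_pos rfl]
          ring
        · simp [hl, show ¬ (l' - l - 1 = 0) by omega]
    · simp [hj]

theorem actL_E_F {j l j' l' : ℕ} (h : j + l < N) (h' : j' + l' < N) :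
    actL p (rootVec c x j l) (rootVec d y j' l') =
      if j' = j then if l' = l then (((1 - c * d) * κ) ^ l * κ) • torProd w' j l else if l < l' then
        ((1 - c * d) * (((1 - c * d) * κ) ^ l * κ))
          • (rootVec d y (j + l + 1) (l' - l - 1) * torProd w' j l) else 0 else 0 :=
  B.actL_E_F_of_apply h h' fun _ ht => B.apply_F_E h ht

end BorelPairing

/-- The algebra generated by `x 0, …, x (m - 1)` and by the first `j` root vectors of the row `m`. -/
def lowAlg {A : Type*} [Ring A] [Algebra K A] (c : K) (x : ℕ → A) (m j : ℕ) : Subalgebra K A :=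
  Algebra.adjoin K (x '' Set.Iio m ∪ (fun i => rootVec c x i (m - i)) '' Set.Iio j)

section LowAlg

variable {A : Type*} [Ring A] [Algebra K A] {c : K} {x : ℕ → A} {m j : ℕ}

theorem gen_mem_lowAlg {k : ℕ} (hk : k < m) : x k ∈ lowAlg c x m j :=
  Algebra.subset_adjoin (.inl ⟨k, hk, rfl⟩)

theorem rootVec_mem_lowAlg {i : ℕ} (hi : i < j) : rootVec c x i (m - i) ∈ lowAlg c x m j :=
  Algebra.subset_adjoin (.inr ⟨i, hi, rfl⟩)

theorem adjoin_le_lowAlg : Algebra.adjoin K (x '' Set.Iio m) ≤ lowAlg c x m j :=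
  Algebra.adjoin_mono Set.subset_union_left

theorem lowAlg_le {N : ℕ} (hm : m < N) (hj : j ≤ m + 1) :
    lowAlg c x m j ≤ Algebra.adjoin K (x '' Set.Iio N) := by
  refine Algebra.adjoin_le ?_
  rintro _ (⟨k, hk, rfl⟩ | ⟨k, hk, rfl⟩)
  · exact Algebra.subset_adjoin ⟨k, lt_trans hk hm, rfl⟩
  · exact rootVec_mem (by have := Set.mem_Iio.1 hk; omega)

theorem mul_row_mem_lowAlg {y : A} (hy : y ∈ Algebra.adjoin K (x '' Set.Iio m)) (a : ℕ → ℕ) (j : ℕ) :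
    y * row (fun i => rootVec c x i (m - i)) a j ∈ lowAlg c x m j := by
  refine mul_mem (adjoin_le_lowAlg hy) ?_
  have : ∀ i ≤ j, row (fun i => rootVec c x i (m - i)) a i ∈ lowAlg c x m j := by
    intro i hi
    induction i with
    | zero => exact one_mem _
    | succ i ih => exact mul_mem (ih (by omega)) (pow_mem (rootVec_mem_lowAlg (by omega)) _)
  exact this j le_rfl

theorem ordMon_mem_adjoin (a : ℕ → ℕ → ℕ) (m : ℕ) :
    ordMon (fun m j => rootVec c x j (m - j)) a m ∈ Algebra.adjoin K (x '' Set.Iio m) := by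
  induction m with
  | zero => exact one_mem _
  | succ m ih => exact lowAlg_le (Nat.lt_succ_self m) le_rfl (mul_row_mem_lowAlg ih _ _)

theorem mul_pow_comm_smul {g y : A} {q : K} (h : y * g = q • (g * y)) (a : ℕ) :
    y * g ^ a = q ^ a • (g ^ a * y) := by
  induction a with
  | zero => simp
  | succ a ih =>
    rw [pow_succ, ← mul_assoc, ih, smul_mul_assoc, mul_assoc, h, mul_smul_comm, smul_smul, pow_succ,
      mul_assoc]

end LowAlg

/-- The quantum factorial `∏_{1 ≤ i ≤ a} (1 + q + ⋯ + q^{i-1})`. -/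
def qFactorial (q : K) (a : ℕ) : K := ∏ i ∈ Finset.range a, ∑ k ∈ Finset.range (i + 1), q ^ k

namespace BorelPairing

variable {p : H' →ₗ[K] H →ₗ[K] K} {c d q κ : K} {N : ℕ} {x w : ℕ → H} {y w' : ℕ → H'}
  (B : BorelPairing p c d q κ N x w y w') {m : ℕ} (hm : m < N)
include B hm

/-- The root vectors `E` of the row `m` from the `j`-th on kill the elements of lower order. -/
theorem actL_eq_zero_of_mem_lowAlg {j t : ℕ} (hjt : j ≤ t) (ht : t ≤ m) {X : H'}
    (hX : X ∈ lowAlg d y m j) : actL p (rootVec c x t (m - t)) X = 0 := by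
  have key : ∀ t, j ≤ t → t ≤ m → actL p (rootVec c x t (m - t)) X = 0 := by
    induction hX using Algebra.adjoin_induction with
    | mem v hv =>
      intro t hjt ht
      obtain ⟨k, hk, rfl⟩ | ⟨k, hk, rfl⟩ := hv <;> have hk := Set.mem_Iio.1 hk
      · have := B.actL_E_F (j := t) (l := m - t) (j' := k) (l' := 0) (by omega) (by omega)
        rw [show y k = rootVec d y k 0 from rfl, this]
        split_ifs <;> first | rfl | omega
      · rw [B.actL_E_F (by omega) (by omega), if_neg (by omega)]
    | algebraMap a =>
      intro t hjt ht
      rw [Algebra.algebraMap_eq_smul_one, map_smul, B.pairing.actL_one_right,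
        B.counit_E (by omega), zero_smul, smul_zero]
    | add a b _ _ ha hb => intro t hjt ht; rw [map_add, ha t hjt ht, hb t hjt ht, add_zero]
    | mul a b ha' _ ha hb =>
      intro t hjt ht
      rw [B.actL_E_mul (by omega) (lowAlg_le hm (by omega) ha'), ha t hjt ht, hb t hjt ht,
        Finset.sum_eq_zero]
      · simp
      · intro i hi
        have hi := Finset.mem_range.1 hi
        have := ha (t + i + 1) (by omega) (by omega)
        rw [show m - (t + i + 1) = m - t - i - 1 by omega] at this
        rw [this, zero_mul]
  exact key t hjt ht

theorem actL_lowAlg_mul {j : ℕ} (hj : j ≤ m) {X : H'} (hX : X ∈ lowAlg d y m j) (v : H') :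
    actL p (rootVec c x j (m - j)) (X * v) = X * actL p (rootVec c x j (m - j)) v := by
  rw [B.actL_E_mul (by omega) (lowAlg_le hm (by omega) hX),
    B.actL_eq_zero_of_mem_lowAlg hm le_rfl hj hX, Finset.sum_eq_zero]
  · simp
  · intro i hi
    have hi := Finset.mem_range.1 hi
    have := B.actL_eq_zero_of_mem_lowAlg hm (t := j + i + 1) (by omega) (by omega) hX
    rw [show m - (j + i + 1) = m - j - i - 1 by omega] at this
    rw [this, zero_mul]

/-- A root vector `E` acts on products with the corresponding `F` by a twisted Leibniz rule. -/
theorem actL_F_mul {j : ℕ} (hj : j ≤ m) (v : H') :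
    actL p (rootVec c x j (m - j)) (rootVec d y j (m - j) * v)
      = (((1 - c * d) * κ) ^ (m - j) * κ) • (torProd w' j (m - j) * v)
        + rootVec d y j (m - j) * actL p (rootVec c x j (m - j)) v := by
  rw [B.actL_E_mul (by omega) (rootVec_mem (by omega)), B.actL_E_F (by omega) (by omega),
    if_pos rfl, if_pos rfl, smul_mul_assoc, Finset.sum_eq_zero]
  · simp
  · intro i hi
    have hi := Finset.mem_range.1 hi
    rw [B.actL_E_F (by omega) (by omega), if_neg (by omega), zero_mul]

/-- A root vector `E` acts on the powers of the corresponding `F` as a `q`-derivative. -/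
theorem actL_F_pow {j : ℕ} (hj : j ≤ m) (a : ℕ) :
    actL p (rootVec c x j (m - j)) (rootVec d y j (m - j) ^ (a + 1))
      = ((((1 - c * d) * κ) ^ (m - j) * κ) * ∑ k ∈ Finset.range (a + 1), q ^ k)
        • (rootVec d y j (m - j) ^ a * torProd w' j (m - j)) := by
  have hW : torProd w' j (m - j) * rootVec d y j (m - j)
      = q • (rootVec d y j (m - j) * torProd w' j (m - j)) :=
    B.skew'.torProd_mul_rootVec B.self (by rw [mul_comm d c, B.cdq]) (by omega)
  induction a with
  | zero =>
    have := B.actL_F_mul hm hj 1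
    simpa [B.pairing.actL_one_right, B.counit_E (show j + (m - j) < N by omega)] using this
  | succ a ih =>
    rw [pow_succ', B.actL_F_mul hm hj, ih, mul_pow_comm_smul hW, mul_smul_comm, ← mul_assoc,
      ← pow_succ', Finset.sum_range_succ _ (a + 1)]
    module

/-- A root vector `F` of the row `m` is orthogonal to the elements of lower order. -/
theorem apply_F_lowAlg {i j : ℕ} (hij : j ≤ i) (hi : i ≤ m) {Y : H} (hY : Y ∈ lowAlg c x m j) :
    p (rootVec d y i (m - i)) Y = 0 := by
  rw [lowAlg, ← Subalgebra.mem_toSubmodule, Algebra.adjoin_eq_span] at hY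
  induction hY using Submodule.span_induction with
  | zero => simp
  | add a b _ _ ha hb => rw [map_add, ha, hb, add_zero]
  | smul a b _ hb => rw [map_smul, hb, smul_zero]
  | mem Y hY =>
    induction hY using Submonoid.closure_induction_right generalizing i with
    | one => rw [B.pairing.one_right, B.counit_F (by omega)]
    | mul_right Y hY z hz ih =>
      rw [B.pairing.apply_mul]
      obtain ⟨k, hk, rfl⟩ | ⟨k, hk, rfl⟩ := hz <;> have hk := Set.mem_Iio.1 hk
      · have h1 := B.actL_E_F (j := k) (l := 0) (j' := i) (l' := m - i) (by omega) (by omega)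
        rw [show x k = rootVec c x k 0 from rfl, h1]
        have hY2 : Y ∈ lowAlg c x m j := by
          rw [lowAlg, ← Subalgebra.mem_toSubmodule, Algebra.adjoin_eq_span]
          exact Submodule.subset_span hY
        split_ifs with h2 h3 h4
        · omega
        · subst h2
          have h5 := ih (i := i + 1) (by omega) (by omega)
          rw [map_smul, LinearMap.smul_apply, B.apply_mul_torProd (by omega)
            (lowAlg_le hm (by omega) hY2), add_zero, Nat.sub_zero,
            show m - i - 1 = m - (i + 1) by omega, h5, smul_zero]
        · simp
        · simp
      · rw [B.actL_E_F (by omega) (by omega), if_neg (by omega)]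
        simp

theorem apply_mul_F_lowAlg {j : ℕ} (hj : j ≤ m) {Y : H} (hY : Y ∈ lowAlg c x m j) (X : H') :
    p (X * rootVec d y j (m - j)) Y = 0 := by
  have hr : comul (R := K) Y ∈ (Algebra.TensorProduct.map
      (⊤ : Subalgebra K H).val (lowAlg c x m j).val).range := by
    refine comul_mem_range_of_adjoin _ _ ?_ Y hY
    rintro _ (⟨k, hk, rfl⟩ | ⟨k, hk, rfl⟩) <;> have hk := Set.mem_Iio.1 hk
    · rw [B.comul_x k (by omega)]
      exact add_mem (tmul_mem_range Algebra.mem_top (one_mem _))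
        (tmul_mem_range Algebra.mem_top (gen_mem_lowAlg hk))
    · simp only [B.comul_E (j := k) (l := m - k) (by omega)]
      refine add_mem (add_mem (tmul_mem_range Algebra.mem_top (one_mem _))
        (tmul_mem_range Algebra.mem_top (rootVec_mem_lowAlg hk)))
        (Subalgebra.smul_mem _ (sum_mem fun t ht => tmul_mem_range Algebra.mem_top
          (adjoin_le_lowAlg (rootVec_mem (by have := Finset.mem_range.1 ht; omega)))) _)
  obtain ⟨t, ht⟩ : ∃ t, Algebra.TensorProduct.map (⊤ : Subalgebra K H).val (lowAlg c x m j).val t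
    = comul (R := K) Y := hr
  rw [B.pairing.mul_left, ← ht]
  clear ht
  induction t with
  | zero => simp
  | add a b ha hb => simp only [map_add, ha, hb, add_zero]
  | tmul a b => simp [B.apply_F_lowAlg hm le_rfl hj b.2]

theorem apply_mul_pow {j : ℕ} (hj : j ≤ m) {X : H'} (hX : X ∈ lowAlg d y m j) {Y : H}
    (hY : Y ∈ lowAlg c x m j) (a b : ℕ) :
    p (X * rootVec d y j (m - j) ^ a) (Y * rootVec c x j (m - j) ^ b)
      = (if a = b then (((1 - c * d) * κ) ^ (m - j) * κ) ^ a * qFactorial q a else 0) * p X Y := by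
  induction b generalizing a with
  | zero =>
    cases a with
    | zero => simp [qFactorial]
    | succ a => simp [pow_succ, ← mul_assoc, B.apply_mul_F_lowAlg hm hj hY]
  | succ b ih =>
    rw [pow_succ, ← mul_assoc, B.pairing.apply_mul, B.actL_lowAlg_mul hm hj hX]
    cases a with
    | zero =>
      simp [B.pairing.actL_one_right, B.counit_E (show j + (m - j) < N by omega)]
    | succ a =>
      have hY2 : Y * rootVec c x j (m - j) ^ b ∈ Algebra.adjoin K (x '' Set.Iio N) :=
        mul_mem (lowAlg_le hm (by omega) hY) (pow_mem (rootVec_mem (by omega)) _)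
      rw [B.actL_F_pow hm hj, mul_smul_comm, map_smul, LinearMap.smul_apply, ← mul_assoc,
        B.apply_mul_torProd (by omega) hY2, ih]
      by_cases hab : a = b
      · subst hab
        simp only [if_true, smul_eq_mul, qFactorial, Finset.prod_range_succ _ a]
        ring
      · simp [hab]

theorem apply_mul_row {j : ℕ} (hj : j ≤ m + 1) {X : H'} (hX : X ∈ Algebra.adjoin K (y '' Set.Iio m))
    {Y : H} (hY : Y ∈ Algebra.adjoin K (x '' Set.Iio m)) (a b : ℕ → ℕ) :
    p (X * row (fun i => rootVec d y i (m - i)) a j) (Y * row (fun i => rootVec c x i (m - i)) b j)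
      = (∏ i ∈ Finset.range j, if a i = b i then
          (((1 - c * d) * κ) ^ (m - i) * κ) ^ a i * qFactorial q (a i) else 0) * p X Y := by
  induction j with
  | zero => simp [row]
  | succ j ih =>
    rw [row, row, ← mul_assoc, ← mul_assoc, B.apply_mul_pow hm (by omega)
      (mul_row_mem_lowAlg hX _ _) (mul_row_mem_lowAlg hY _ _), ih (by omega),
      Finset.prod_range_succ]
    ring

omit hm in
/-- The ordered monomials in the `F` are orthogonal to those in the `E`. -/
theorem apply_ordMon {M : ℕ} (hM : M ≤ N) (a b : ℕ → ℕ → ℕ) :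
    p (ordMon (fun m j => rootVec d y j (m - j)) a M) (ordMon (fun m j => rootVec c x j (m - j)) b M)
      = ∏ m ∈ Finset.range M, ∏ i ∈ Finset.range (m + 1), if a m i = b m i then
          (((1 - c * d) * κ) ^ (m - i) * κ) ^ a m i * qFactorial q (a m i) else 0 := by
  induction M with
  | zero => simp [ordMon, B.pairing.one_left]
  | succ M ih =>
    rw [ordMon, ordMon, B.apply_mul_row (by omega) le_rfl (ordMon_mem_adjoin _ _)
      (ordMon_mem_adjoin _ _), ih (by omega), mul_comm]
    exact (Finset.prod_range_succ _ M).symm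

end BorelPairing

end SerreTypeA

/-! ### Existence and uniqueness of Hopf pairings given on generators -/

namespace SkewPairing

open Coalgebra WithConv

variable {K H' H : Type*} [Field K] [Ring H'] [Bialgebra K H'] [Ring H] [Bialgebra K H]

section Exists

variable {X' : Type*} {Φ : FreeAlgebra K X' →ₐ[K] WithConv (H →ₗ[K] K)}
  {π' : FreeAlgebra K X' →ₐ[K] H'}

theorem convMul_eq_sum {ι : Type*} {s : Finset ι} {l m : ι → H} {b : H}
    (h : comul (R := K) b = ∑ i ∈ s, l i ⊗ₜ m i) (φ ψ : WithConv (H →ₗ[K] K)) :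
    (φ * ψ).ofConv b = ∑ i ∈ s, φ.ofConv (l i) * ψ.ofConv (m i) := by
  rw [LinearMap.convMul_apply, h]
  simp

/-- `Φ x (b c) = ∑ Φ x₂ b · Φ x₁ c`, where `∑ x₁ ⊗ x₂` is some lift of the coproduct of `π' x`. -/
def CompatMul (Φ : FreeAlgebra K X' →ₐ[K] WithConv (H →ₗ[K] K))
    (π' : FreeAlgebra K X' →ₐ[K] H') (x : FreeAlgebra K X') : Prop :=
  ∃ (ι : Type) (s : Finset ι) (l m : ι → FreeAlgebra K X'),
    comul (R := K) (π' x) = ∑ i ∈ s, π' (l i) ⊗ₜ π' (m i) ∧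
    ∀ b c : H, (Φ x).ofConv (b * c) = ∑ i ∈ s, (Φ (m i)).ofConv b * (Φ (l i)).ofConv c

theorem CompatMul.add {x y : FreeAlgebra K X'} (hx : CompatMul Φ π' x) (hy : CompatMul Φ π' y) :
    CompatMul Φ π' (x + y) := by
  obtain ⟨ι, s, l, m, h1, h2⟩ := hx
  obtain ⟨κ, t, l', m', h3, h4⟩ := hy
  refine ⟨ι ⊕ κ, s.disjSum t, Sum.elim l l', Sum.elim m m', ?_, fun b c => ?_⟩
  · simp [h1, h3]
  · simp [h2, h4]

theorem CompatMul.mul {x y : FreeAlgebra K X'} (hx : CompatMul Φ π' x) (hy : CompatMul Φ π' y) :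
    CompatMul Φ π' (x * y) := by
  obtain ⟨ι, s, l, m, h1, h2⟩ := hx
  obtain ⟨κ, t, l', m', h3, h4⟩ := hy
  refine ⟨ι × κ, s ×ˢ t, fun i => l i.1 * l' i.2, fun i => m i.1 * m' i.2, ?_, fun b c => ?_⟩
  · rw [map_mul, Bialgebra.comul_mul, h1, h3, Finset.sum_mul_sum, Finset.sum_product]
    simp
  · obtain ⟨u, hu⟩ := exists_comul_eq_sum (K := K) b
    obtain ⟨v, hv⟩ := exists_comul_eq_sum (K := K) c
    have huv : comul (R := K) (b * c)
        = ∑ i ∈ u ×ˢ v, (i.1.1 * i.2.1) ⊗ₜ (i.1.2 * i.2.2) := by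
      rw [Bialgebra.comul_mul, hu, hv, Finset.sum_mul_sum, Finset.sum_product]
      simp
    rw [map_mul Φ x y, convMul_eq_sum huv]
    simp only [map_mul, convMul_eq_sum hu, convMul_eq_sum hv, h2, h4, Finset.sum_mul_sum,
      Finset.sum_product]
    calc _ = ∑ i ∈ u, ∑ i' ∈ v, ∑ j ∈ s, ∑ j' ∈ t, ((Φ (m j)).ofConv i.1 * (Φ (m' j')).ofConv i.2)
          * ((Φ (l j)).ofConv i'.1 * (Φ (l' j')).ofConv i'.2) := by
          refine Finset.sum_congr rfl fun i _ => Finset.sum_congr rfl fun i' _ =>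
            Finset.sum_congr rfl fun j _ => Finset.sum_congr rfl fun j' _ => ?_
          ring
      _ = _ := by
          simp only [Finset.sum_comm (s := v) (t := s), Finset.sum_comm (s := v) (t := t),
            Finset.sum_comm (s := u) (t := s), Finset.sum_comm (s := u) (t := t)]

theorem CompatMul.of_generators (hX : ∀ x, CompatMul Φ π' (FreeAlgebra.ι K x)) (x : FreeAlgebra K X') : CompatMul Φ π' x := by
  induction x using FreeAlgebra.induction with
  | grade0 a =>
    refine ⟨Unit, Finset.univ, fun _ => algebraMap K _ a, fun _ => 1, ?_, fun b c => ?_⟩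
    · simp [Algebra.algebraMap_eq_smul_one, Algebra.TensorProduct.one_def,
        TensorProduct.smul_tmul']
    · simp [Algebra.algebraMap_eq_smul_one, mul_left_comm]
  | grade1 x => exact hX x
  | mul a b ha hb => exact ha.mul hb
  | add a b ha hb => exact ha.add hb

theorem apply_one_of_generators
    (h1 : ∀ x, (Φ (FreeAlgebra.ι K x)).ofConv 1 = counit (R := K) (π' (FreeAlgebra.ι K x)))
    (x : FreeAlgebra K X') : (Φ x).ofConv 1 = counit (R := K) (π' x) := by
  induction x using FreeAlgebra.induction with
  | grade0 a => simp [Algebra.algebraMap_eq_smul_one]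
  | grade1 x => exact h1 x
  | mul a b ha hb => simp [Algebra.TensorProduct.one_def, ha, hb]
  | add a b ha hb => simp [ha, hb]

theorem apply_groupLike_eq {y : H} (hy : comul (R := K) y = y ⊗ₜ y) (hy1 : counit (R := K) y = 1)
    (ψ : H' →ₐ[K] K)
    (h : ∀ x, (Φ (FreeAlgebra.ι K x)).ofConv y = ψ (π' (FreeAlgebra.ι K x))) (x : FreeAlgebra K X') :
    (Φ x).ofConv y = ψ (π' x) := by
  induction x using FreeAlgebra.induction with
  | grade0 a => simp [Algebra.algebraMap_eq_smul_one, hy1]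
  | grade1 x => exact h x
  | mul a b ha hb => simp [hy, ha, hb]
  | add a b ha hb => simp [ha, hb]

theorem apply_skewPrimitive_eq {y g : H} (hy : comul (R := K) y = y ⊗ₜ 1 + g ⊗ₜ y)
    (hy0 : counit (R := K) y = 0) (ψ : H' →ₐ[K] K) (δ : H' →ₗ[K] K)
    (hδ : ∀ a b, δ (a * b) = ψ a * δ b + δ a * counit (R := K) b)
    (hg : ∀ x, (Φ x).ofConv g = ψ (π' x)) (h1 : ∀ x, (Φ x).ofConv 1 = counit (R := K) (π' x))
    (h : ∀ x, (Φ (FreeAlgebra.ι K x)).ofConv y = δ (π' (FreeAlgebra.ι K x))) (x : FreeAlgebra K X') :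
    (Φ x).ofConv y = δ (π' x) := by
  induction x using FreeAlgebra.induction with
  | grade0 a =>
    have hδ1 : δ 1 = 0 := by simpa using hδ 1 1
    simp [Algebra.algebraMap_eq_smul_one, hy0, hδ1]
  | grade1 x => exact h x
  | mul a b ha hb => simp [hy, ha, hb, hg, h1, hδ, add_comm]
  | add a b ha hb => simp [ha, hb]

/-- A pairing of a free algebra covering `H'` with `H` which is compatible with the coproducts descends
to a Hopf pairing of `H'` and `H`, provided that the functionals that come from a generating set `S` of
`H` descend. -/
theorem exists_isPairing (hπ : Function.Surjective π')
    (h1 : ∀ x, (Φ (FreeAlgebra.ι K x)).ofConv 1 = counit (R := K) (π' (FreeAlgebra.ι K x)))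
    (hX : ∀ x, CompatMul Φ π' (FreeAlgebra.ι K x)) {S : Set H} (hS : Algebra.adjoin K S = ⊤)
    (hdesc : ∀ y ∈ S, ∃ ψ : H' →ₗ[K] K, ∀ x, (Φ x).ofConv y = ψ (π' x)) :
    ∃ p : H' →ₗ[K] H →ₗ[K] K, IsPairing p ∧ ∀ x b, p (π' x) b = (Φ x).ofConv b := by
  have hone := apply_one_of_generators h1
  have hall : ∀ b : H, ∃ ψ : H' →ₗ[K] K, ∀ x, (Φ x).ofConv b = ψ (π' x) := by
    intro b
    have hb : b ∈ Algebra.adjoin K S := hS ▸ Algebra.mem_top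
    induction hb using Algebra.adjoin_induction with
    | mem y hy => exact hdesc y hy
    | algebraMap a =>
      exact ⟨a • counit, fun x => by simp [Algebra.algebraMap_eq_smul_one, hone]⟩
    | add b c _ _ hb hc =>
      obtain ⟨ψ, hψ⟩ := hb
      obtain ⟨χ, hχ⟩ := hc
      exact ⟨ψ + χ, fun x => by simp [hψ, hχ]⟩
    | mul b c _ _ hb hc =>
      obtain ⟨ψ, hψ⟩ := hb
      obtain ⟨χ, hχ⟩ := hc
      refine ⟨LinearMap.mul' K K ∘ₗ TensorProduct.map χ ψ ∘ₗ comul, fun x => ?_⟩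
      obtain ⟨ι, s, l, m, h2, h3⟩ := CompatMul.of_generators hX x
      simp [h2, h3, hψ, hχ, mul_comm]
  obtain ⟨σ, hσ⟩ := LinearMap.exists_rightInverse_of_surjective π'.toLinearMap
    (LinearMap.range_eq_top.2 hπ)
  have hp : ∀ x b, (Φ (σ (π' x))).ofConv b = (Φ x).ofConv b := by
    intro x b
    obtain ⟨ψ, hψ⟩ := hall b
    rw [hψ, hψ]
    exact congrArg ψ (LinearMap.congr_fun hσ (π' x))
  refine ⟨(WithConv.linearEquiv K (H →ₗ[K] K)).toLinearMap ∘ₗ Φ.toLinearMap ∘ₗ σ, ?_, hp⟩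
  have hp' : ∀ x b, ((WithConv.linearEquiv K (H →ₗ[K] K)).toLinearMap ∘ₗ Φ.toLinearMap ∘ₗ σ)
    (π' x) b = (Φ x).ofConv b := hp
  generalize (WithConv.linearEquiv K (H →ₗ[K] K)).toLinearMap ∘ₗ Φ.toLinearMap ∘ₗ σ = p at hp'
  constructor
  · intro b
    rw [← map_one π', hp', map_one]
    rfl
  · intro b'
    obtain ⟨x, rfl⟩ := hπ b'
    rw [hp', hone]
  · intro b' b c
    obtain ⟨x, rfl⟩ := hπ b'
    obtain ⟨ι, s, l, m, h2, h3⟩ := CompatMul.of_generators hX x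
    simp [h2, h3, hp', mul_comm]
  · intro b' c' b
    obtain ⟨x, rfl⟩ := hπ b'
    obtain ⟨x', rfl⟩ := hπ c'
    obtain ⟨u, hu⟩ := exists_comul_eq_sum (K := K) b
    rw [← map_mul, hp', map_mul, convMul_eq_sum hu, hu]
    simp [hp']

end Exists

end SkewPairing

/-! ### Functionals on the Borel subalgebras -/

namespace SkewPairing

open Coalgebra

section Triangular

variable {K A V : Type*} [Field K] [Ring A] [Algebra K A] [AddCommGroup V] [Module K V]

/-- A subquotient of dimension two on which an algebra acts by upper triangular matrices yields two
characters `α`, `γ` and a skew derivation `β`. -/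
theorem exists_triangular (ρ : A →ₐ[K] Module.End K V) (S : Set A) (W : Submodule K V)
    (x y : V →ₗ[K] K) {v₀ v₁ : V} (h₀ : v₀ ∈ W) (h₁ : v₁ ∈ W) (hx₀ : x v₀ = 1) (hy₀ : y v₀ = 0)
    (hx₁ : x v₁ = 0) (hy₁ : y v₁ = 1)
    (hS : ∀ a ∈ S, ∃ α β γ : K, ∀ g ∈ W, ρ a g ∈ W ∧ y (ρ a g) = γ * y g ∧
      x (ρ a g) = α * x g + β * y g) :
    ∃ (α γ : Algebra.adjoin K S →ₐ[K] K) (β : Algebra.adjoin K S →ₗ[K] K),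
      (∀ a, α a = x (ρ a v₀)) ∧ (∀ a, γ a = y (ρ a v₁)) ∧ (∀ a, β a = x (ρ a v₁)) ∧
      ∀ a b, β (a * b) = α a * β b + β a * γ b := by
  have key : ∀ a ∈ Algebra.adjoin K S, ∀ g ∈ W, ρ a g ∈ W ∧ y (ρ a g) = y (ρ a v₁) * y g ∧
      x (ρ a g) = x (ρ a v₀) * x g + x (ρ a v₁) * y g := by
    intro a ha
    have : ∃ α β γ : K, ∀ g ∈ W, ρ a g ∈ W ∧ y (ρ a g) = γ * y g ∧
        x (ρ a g) = α * x g + β * y g := by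
      induction ha using Algebra.adjoin_induction with
      | mem a ha => exact hS a ha
      | algebraMap c =>
        refine ⟨c, 0, c, fun g hg => ?_⟩
        simpa [Algebra.algebraMap_eq_smul_one] using W.smul_mem c hg
      | add a b _ _ ha hb =>
        obtain ⟨α, β, γ, h⟩ := ha
        obtain ⟨α', β', γ', h'⟩ := hb
        refine ⟨α + α', β + β', γ + γ', fun g hg => ?_⟩
        obtain ⟨h1, h2, h3⟩ := h g hg
        obtain ⟨h4, h5, h6⟩ := h' g hg
        simp only [map_add, LinearMap.add_apply, h2, h3, h5, h6]
        exact ⟨add_mem h1 h4, by ring, by ring⟩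
      | mul a b _ _ ha hb =>
        obtain ⟨α, β, γ, h⟩ := ha
        obtain ⟨α', β', γ', h'⟩ := hb
        refine ⟨α * α', α * β' + β * γ', γ * γ', fun g hg => ?_⟩
        obtain ⟨h4, h5, h6⟩ := h' g hg
        obtain ⟨h1, h2, h3⟩ := h _ h4
        simp only [map_mul, Module.End.mul_apply, h2, h3, h5, h6]
        exact ⟨h1, by ring, by ring⟩
    obtain ⟨α, β, γ, h⟩ := this
    intro g hg
    obtain ⟨h1, h2, h3⟩ := h g hg
    rw [h2, h3, (h _ h₁).2.1, (h _ h₁).2.2, (h _ h₀).2.2, hx₀, hy₀, hx₁, hy₁]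
    exact ⟨h1, by ring, by ring⟩
  refine ⟨AlgHom.ofLinearMap (x ∘ₗ LinearMap.applyₗ v₀ ∘ₗ (ρ.comp (Subalgebra.val _)).toLinearMap)
      (by simpa using hx₀) fun a b => ?_,
    AlgHom.ofLinearMap (y ∘ₗ LinearMap.applyₗ v₁ ∘ₗ (ρ.comp (Subalgebra.val _)).toLinearMap)
      (by simpa using hy₁) fun a b => ?_,
    x ∘ₗ LinearMap.applyₗ v₁ ∘ₗ (ρ.comp (Subalgebra.val _)).toLinearMap,
    fun a => rfl, fun a => rfl, fun a => rfl, fun a b => ?_⟩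
  · have h := (key a a.2 _ (key b b.2 v₀ h₀).1).2.2
    simpa [(key b b.2 v₀ h₀).2.1, hy₀] using h
  · have h := (key a a.2 _ (key b b.2 v₁ h₁).1).2.1
    simpa using h
  · have h := (key a a.2 _ (key b b.2 v₁ h₁).1).2.2
    simpa using h

end Triangular

section Convolution

variable {K H : Type*} [Field K] [Ring H] [Bialgebra K H]

/-- The convolution product of two characters. -/
noncomputable def convChar (φ ψ : H →ₐ[K] K) : H →ₐ[K] K :=
  (Algebra.TensorProduct.lift φ ψ fun _ _ => Commute.all _ _).comp (Bialgebra.comulAlgHom K H)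

/-- The convolution product of two functionals. -/
noncomputable def convFun (φ ψ : H →ₗ[K] K) : H →ₗ[K] K :=
  LinearMap.mul' K K ∘ₗ TensorProduct.map φ ψ ∘ₗ comul

theorem convChar_eq_sum {φ ψ : H →ₐ[K] K} {ι : Type*} {s : Finset ι} {l m : ι → H} {b : H}
    (h : comul (R := K) b = ∑ i ∈ s, l i ⊗ₜ m i) :
    convChar φ ψ b = ∑ i ∈ s, φ (l i) * ψ (m i) := by
  simp [convChar, h]

theorem convFun_eq_sum {φ ψ : H →ₗ[K] K} {ι : Type*} {s : Finset ι} {l m : ι → H} {b : H}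
    (h : comul (R := K) b = ∑ i ∈ s, l i ⊗ₜ m i) :
    convFun φ ψ b = ∑ i ∈ s, φ (l i) * ψ (m i) := by
  simp [convFun, h]

/-- The convolution of a skew derivation and a character is a skew derivation. -/
theorem convFun_mul_left {α γ ψ : H →ₐ[K] K} {β : H →ₗ[K] K}
    (hβ : ∀ a b, β (a * b) = α a * β b + β a * γ b) (a b : H) :
    convFun β ψ.toLinearMap (a * b) = convChar α ψ a * convFun β ψ.toLinearMap b
      + convFun β ψ.toLinearMap a * convChar γ ψ b := by
  obtain ⟨u, hu⟩ := exists_comul_eq_sum (K := K) a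
  obtain ⟨v, hv⟩ := exists_comul_eq_sum (K := K) b
  have huv : comul (R := K) (a * b)
      = ∑ i ∈ u ×ˢ v, (i.1.1 * i.2.1) ⊗ₜ (i.1.2 * i.2.2) := by
    rw [Bialgebra.comul_mul, hu, hv, Finset.sum_mul_sum, Finset.sum_product]
    simp
  rw [convFun_eq_sum huv, convFun_eq_sum hu, convFun_eq_sum hv, convChar_eq_sum hu,
    convChar_eq_sum hv, Finset.sum_mul_sum, Finset.sum_mul_sum, ← Finset.sum_product',
    ← Finset.sum_product', ← Finset.sum_add_distrib]
  refine Finset.sum_congr rfl fun i _ => ?_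
  simp only [hβ, AlgHom.toLinearMap_apply, map_mul]
  ring

theorem convFun_mul_right {α γ ψ : H →ₐ[K] K} {β : H →ₗ[K] K}
    (hβ : ∀ a b, β (a * b) = α a * β b + β a * γ b) (a b : H) :
    convFun ψ.toLinearMap β (a * b) = convChar ψ α a * convFun ψ.toLinearMap β b
      + convFun ψ.toLinearMap β a * convChar ψ γ b := by
  obtain ⟨u, hu⟩ := exists_comul_eq_sum (K := K) a
  obtain ⟨v, hv⟩ := exists_comul_eq_sum (K := K) b
  have huv : comul (R := K) (a * b)
      = ∑ i ∈ u ×ˢ v, (i.1.1 * i.2.1) ⊗ₜ (i.1.2 * i.2.2) := by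
    rw [Bialgebra.comul_mul, hu, hv, Finset.sum_mul_sum, Finset.sum_product]
    simp
  rw [convFun_eq_sum huv, convFun_eq_sum hu, convFun_eq_sum hv, convChar_eq_sum hu,
    convChar_eq_sum hv, Finset.sum_mul_sum, Finset.sum_mul_sum, ← Finset.sum_product',
    ← Finset.sum_product', ← Finset.sum_add_distrib]
  refine Finset.sum_congr rfl fun i _ => ?_
  simp only [hβ, AlgHom.toLinearMap_apply, map_mul]
  ring

end Convolution

end SkewPairing

namespace TwoParam

open SkewPairing

section NaturalRep

variable {K : Type*} [Field K] {n : ℕ}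

/-- The operator that moves the coordinate `j` to the coordinate `i`. -/
def moveCoord (i j : ℕ) (c : K) : Module.End K (ℕ → K) where
  toFun g k := if k = i then c * g j else 0
  map_add' g h := by ext k; simp only [Pi.add_apply]; split_ifs <;> simp [mul_add]
  map_smul' a g := by ext k; simp only [Pi.smul_apply, smul_eq_mul, RingHom.id_apply]; split_ifs <;> ring

/-- The diagonal operator with entries `d`. -/
def diagOp (d : ℕ → K) : Module.End K (ℕ → K) where
  toFun g k := d k * g k
  map_add' g h := by ext k; simp [mul_add]
  map_smul' a g := by ext k; simp [mul_left_comm]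

@[simp] theorem moveCoord_apply (i j : ℕ) (c : K) (g : ℕ → K) (k : ℕ) :
    moveCoord i j c g k = if k = i then c * g j else 0 := rfl

@[simp] theorem diagOp_apply (d g : ℕ → K) (k : ℕ) : diagOp d g k = d k * g k := rfl

/-- The eigenvalue of `ω_i` on the `k`-th coordinate of the natural representation. -/
def wt (r s : Kˣ) (i k : ℕ) : Kˣ := if k = i then r else if k = i + 1 then s else 1

/-- The action of the generators on the natural representation. -/
def natGen (r s : Kˣ) : Gen n → Module.End K (ℕ → K)
  | .e i => moveCoord i (i + 1) 1
  | .f i => moveCoord (i + 1) i 1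
  | .t (.w i) => diagOp fun k => wt r s i k
  | .t (.wInv i) => diagOp fun k => ((wt r s i k)⁻¹ : Kˣ)
  | .t (.w' i) => diagOp fun k => wt s r i k
  | .t (.wInv' i) => diagOp fun k => ((wt s r i k)⁻¹ : Kˣ)

/-- The action of the generators on the dual of the natural representation, in coordinates rescaled so that
the `e_i` have matrix entries `1`. -/
def dualGen (r s : Kˣ) : Gen n → Module.End K (ℕ → K)
  | .e i => moveCoord (i + 1) i 1
  | .f i => moveCoord i (i + 1) ((r⁻¹ * s⁻¹ : Kˣ) : K)
  | .t (.w i) => diagOp fun k => ((wt r s i k)⁻¹ : Kˣ)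
  | .t (.wInv i) => diagOp fun k => wt r s i k
  | .t (.w' i) => diagOp fun k => ((wt s r i k)⁻¹ : Kˣ)
  | .t (.wInv' i) => diagOp fun k => wt s r i k

theorem wt_eq (r s : Kˣ) (i j : ℕ) :
    wt r s i j = r ^ ip i j * s ^ ip (i + 1) j * wt r s i (j + 1) := by
  unfold wt ip
  split_ifs <;> first | omega | simp

theorem wt_succ_eq (r s : Kˣ) (i j : ℕ) :
    wt r s i (j + 1) = r ^ (-ip i j) * s ^ (-ip (i + 1) j) * wt r s i j := by
  rw [wt_eq r s i j, zpow_neg, zpow_neg, ← mul_inv, inv_mul_cancel_left]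

theorem diagOp_mul_moveCoord {d : ℕ → K} {i j : ℕ} {a : K} (h : d i = a * d j) (c : K) :
    diagOp d * moveCoord i j c = a • (moveCoord i j c * diagOp d) := by
  refine LinearMap.ext fun g => funext fun k => ?_
  simp only [Module.End.mul_apply, diagOp_apply, moveCoord_apply, LinearMap.smul_apply,
    Pi.smul_apply, smul_eq_mul]
  split_ifs with hk
  · rw [hk, h]; ring
  · simp

theorem moveCoord_mul_moveCoord (i j k l : ℕ) (c d : K) :
    moveCoord i j c * moveCoord k l d = if j = k then moveCoord i l (c * d) else 0 := by
  refine LinearMap.ext fun g => funext fun m => ?_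
  split_ifs with h <;> simp [h, mul_assoc]

theorem diagOp_mul_diagOp (d d' : ℕ → K) : diagOp d * diagOp d' = diagOp fun k => d k * d' k :=
  LinearMap.ext fun g => funext fun k => by simp [mul_assoc]

theorem diagOp_one : diagOp (fun _ => (1 : K)) = 1 :=
  LinearMap.ext fun g => funext fun k => by simp

theorem wt_sub_wt (r s : Kˣ) (i k : ℕ) : (wt r s i k : K) - wt s r i k
    = if k = i then (r : K) - s else if k = i + 1 then (s : K) - r else 0 := by
  unfold wt
  split_ifs <;> simp

theorem inv_wt_sub_inv_wt (r s : Kˣ) (i k : ℕ) : (((wt r s i k)⁻¹ : Kˣ) : K) - ((wt s r i k)⁻¹ : Kˣ)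
    = if k = i then (r : K)⁻¹ - (s : K)⁻¹ else if k = i + 1 then (s : K)⁻¹ - (r : K)⁻¹ else 0 := by
  unfold wt
  split_ifs <;> simp

theorem moveCoord_commutator (i : ℕ) (c d a : K) (D : ℕ → K)
    (h : ∀ k, a * D k = if k = i then c * d else if k = i + 1 then -(c * d) else 0) :
    moveCoord i i (c * d) - moveCoord (i + 1) (i + 1) (c * d) = a • diagOp D := by
  refine LinearMap.ext fun g => funext fun k => ?_
  simp only [LinearMap.sub_apply, Pi.sub_apply, moveCoord_apply, LinearMap.smul_apply, Pi.smul_apply,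
    diagOp_apply, smul_eq_mul, ← mul_assoc, h k]
  split_ifs with h1 h2 h2 <;> first | omega | simp [h1, h2]

theorem diagOp_sub (d d' : ℕ → K) : diagOp d - diagOp d' = diagOp fun k => d k - d' k :=
  LinearMap.ext fun g => funext fun k => by simp [sub_mul]

theorem natGen_rel (r s : Kˣ) (hrs : r ≠ s) {a b : FreeAlgebra K (Gen n)} (h : Rel n r s a b) :
    FreeAlgebra.lift K (natGen r s) a = FreeAlgebra.lift K (natGen r s) b := by
  have hrs' : (r : K) - s ≠ 0 := sub_ne_zero.2 fun h => hrs (Units.ext h)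
  induction h with
  | torus_comm x y =>
    rcases x with i | i | i | i <;> rcases y with j | j | j | j <;>
      simp only [map_mul, FreeAlgebra.lift_ι_apply, natGen, diagOp_mul_diagOp, mul_comm]
  | w_inv i => simp [natGen, diagOp_mul_diagOp, diagOp_one]
  | w'_inv i => simp [natGen, diagOp_mul_diagOp, diagOp_one]
  | w_e i j =>
    simp only [map_mul, map_smul, FreeAlgebra.lift_ι_apply, natGen]
    refine diagOp_mul_moveCoord ?_ _
    rw [← Units.val_mul, ← wt_eq]
  | w_f i j =>
    simp only [map_mul, map_smul, FreeAlgebra.lift_ι_apply, natGen]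
    refine diagOp_mul_moveCoord ?_ _
    rw [← Units.val_mul, ← wt_succ_eq]
  | w'_e i j =>
    simp only [map_mul, map_smul, FreeAlgebra.lift_ι_apply, natGen]
    refine diagOp_mul_moveCoord ?_ _
    rw [← Units.val_mul, mul_comm (r ^ _), ← wt_eq]
  | w'_f i j =>
    simp only [map_mul, map_smul, FreeAlgebra.lift_ι_apply, natGen]
    refine diagOp_mul_moveCoord ?_ _
    rw [← Units.val_mul, mul_comm (r ^ _), ← wt_succ_eq]
  | e_f i j =>
    simp only [map_mul, map_sub, FreeAlgebra.lift_ι_apply, natGen, moveCoord_mul_moveCoord,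
      Nat.add_right_cancel_iff, Fin.val_inj, mul_one]
    by_cases hij : i = j
    · subst hij
      simp only [if_true, map_smul, map_sub, FreeAlgebra.lift_ι_apply, natGen, diagOp_sub, wt_sub_wt]
      convert moveCoord_commutator (i : ℕ) 1 1 ((r : K) - s)⁻¹ _ fun k => ?_ using 2
      · simp
      · simp
      · split_ifs <;> simp [hrs']
        rw [← neg_sub (r : K) s, mul_neg, inv_mul_cancel₀ hrs']
    · simp [hij, Ne.symm hij]
  | e_comm i j h =>
    simp only [map_mul, map_sub, FreeAlgebra.lift_ι_apply, natGen, moveCoord_mul_moveCoord, map_zero]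
    rw [if_neg (by omega), if_neg (by omega), sub_zero]
  | f_comm i j h =>
    simp only [map_mul, map_sub, FreeAlgebra.lift_ι_apply, natGen, moveCoord_mul_moveCoord, map_zero]
    rw [if_neg (by omega), if_neg (by omega), sub_zero]
  | serre_e₁ i j h | serre_e₂ i j h | serre_f₁ i j h | serre_f₂ i j h =>
    simp [natGen, pow_two, h, moveCoord_mul_moveCoord, mul_assoc]
    omega

theorem dualGen_rel (r s : Kˣ) (hrs : r ≠ s) {a b : FreeAlgebra K (Gen n)} (h : Rel n r s a b) :
    FreeAlgebra.lift K (dualGen r s) a = FreeAlgebra.lift K (dualGen r s) b := by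
  have hrs' : (r : K) - s ≠ 0 := sub_ne_zero.2 fun h => hrs (Units.ext h)
  have hr : (r : K) ≠ 0 := r.ne_zero
  have hs : (s : K) ≠ 0 := s.ne_zero
  induction h with
  | torus_comm x y =>
    rcases x with i | i | i | i <;> rcases y with j | j | j | j <;>
      simp only [map_mul, FreeAlgebra.lift_ι_apply, dualGen, diagOp_mul_diagOp, mul_comm]
  | w_inv i => simp [dualGen, diagOp_mul_diagOp, diagOp_one]
  | w'_inv i => simp [dualGen, diagOp_mul_diagOp, diagOp_one]
  | w_e i j =>
    simp only [map_mul, map_smul, FreeAlgebra.lift_ι_apply, dualGen]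
    refine diagOp_mul_moveCoord ?_ _
    rw [← Units.val_mul, wt_eq r s i j, mul_inv, mul_inv_cancel_left]
  | w_f i j =>
    simp only [map_mul, map_smul, FreeAlgebra.lift_ι_apply, dualGen]
    refine diagOp_mul_moveCoord ?_ _
    rw [← Units.val_mul, wt_succ_eq, mul_inv, mul_inv_cancel_left]
  | w'_e i j =>
    simp only [map_mul, map_smul, FreeAlgebra.lift_ι_apply, dualGen]
    refine diagOp_mul_moveCoord ?_ _
    rw [← Units.val_mul, mul_comm (r ^ _), wt_eq s r i j, mul_inv, mul_inv_cancel_left]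
  | w'_f i j =>
    simp only [map_mul, map_smul, FreeAlgebra.lift_ι_apply, dualGen]
    refine diagOp_mul_moveCoord ?_ _
    rw [← Units.val_mul, mul_comm (r ^ _), wt_succ_eq, mul_inv, mul_inv_cancel_left]
  | e_f i j =>
    simp only [map_mul, map_sub, FreeAlgebra.lift_ι_apply, dualGen, moveCoord_mul_moveCoord,
      Nat.add_right_cancel_iff, Fin.val_inj]
    by_cases hij : i = j
    · subst hij
      simp only [if_true, map_smul, map_sub, FreeAlgebra.lift_ι_apply, dualGen, diagOp_sub,
        inv_wt_sub_inv_wt]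
      rw [mul_comm _ (1 : K), ← neg_sub, neg_eq_iff_eq_neg]
      rw [← neg_smul (((r : K) - s)⁻¹) (diagOp fun k => if k = (i : ℕ) then (r : K)⁻¹ - (s : K)⁻¹
        else if k = i + 1 then (s : K)⁻¹ - (r : K)⁻¹ else 0)]
      refine moveCoord_commutator (i : ℕ) 1 ((r⁻¹ * s⁻¹ : Kˣ) : K) (-((r : K) - s)⁻¹) _ fun k => ?_
      simp only [Units.val_mul, Units.val_inv_eq_inv_val]
      split_ifs
      · field_simp; ring
      · field_simp
      · simp
    · simp [hij, Ne.symm hij]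
  | e_comm i j h =>
    simp only [map_mul, map_sub, FreeAlgebra.lift_ι_apply, dualGen, moveCoord_mul_moveCoord, map_zero]
    rw [if_neg (by omega), if_neg (by omega), sub_zero]
  | f_comm i j h =>
    simp only [map_mul, map_sub, FreeAlgebra.lift_ι_apply, dualGen, moveCoord_mul_moveCoord, map_zero]
    rw [if_neg (by omega), if_neg (by omega), sub_zero]
  | serre_e₁ i j h | serre_e₂ i j h | serre_f₁ i j h | serre_f₂ i j h =>
    simp [dualGen, pow_two, h, moveCoord_mul_moveCoord, mul_assoc]
    omega

/-- The natural representation of `U_{r,s}(sl_n)`, on the space of all sequences: the coordinates from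
`n` on are fixed by the torus and killed by the `e_i` and `f_i`. -/
noncomputable def natRep (r s : Kˣ) (hrs : r ≠ s) : U n r s →ₐ[K] Module.End K (ℕ → K) :=
  lift (natGen r s) fun _ _ h => natGen_rel r s hrs h

/-- The dual of the natural representation. -/
noncomputable def dualRep (r s : Kˣ) (hrs : r ≠ s) : U n r s →ₐ[K] Module.End K (ℕ → K) :=
  lift (dualGen r s) fun _ _ h => dualGen_rel r s hrs h

end NaturalRep

end TwoParam

/-! ### Existence and uniqueness of the Hopf pairing -/

namespace TwoParam

open SkewPairing

section Letters

variable {K : Type*} [Field K] {n : ℕ} (r s : Kˣ)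

/-- `e_i` as an element of `borelPos`. -/
noncomputable def ePos (i : Fin (n - 1)) : borelPos n r s := ⟨e r s i, e_mem i⟩
/-- `ω_i` as an element of `borelPos`. -/
noncomputable def wPos (i : Fin (n - 1)) : borelPos n r s := ⟨w r s i, w_mem i⟩
/-- `ω_i⁻¹` as an element of `borelPos`. -/
noncomputable def wInvPos (i : Fin (n - 1)) : borelPos n r s := ⟨tor r s (.wInv i), wInv_mem i⟩
/-- `f_i` as an element of `borelNeg`. -/
noncomputable def fNeg (i : Fin (n - 1)) : borelNeg n r s := ⟨f r s i, f_mem i⟩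
/-- `ω'_i` as an element of `borelNeg`. -/
noncomputable def wNeg (i : Fin (n - 1)) : borelNeg n r s := ⟨w' r s i, w'_mem i⟩
/-- `(ω'_i)⁻¹` as an element of `borelNeg`. -/
noncomputable def wInvNeg (i : Fin (n - 1)) : borelNeg n r s := ⟨tor r s (.wInv' i), wInv'_mem i⟩

/-- The scalar `(ω'_i | ω_j)`. -/
def pairScalar (i j : ℕ) : Kˣ := r ^ ip j i * s ^ ip (j + 1) i

variable {r s}

theorem comul_ePos (i : Fin (n - 1)) : Coalgebra.comul (R := K) (ePos r s i)
    = ePos r s i ⊗ₜ 1 + wPos r s i ⊗ₜ ePos r s i := comul_borelPos_eq (comul_e r s i).symm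

theorem comul_wPos (i : Fin (n - 1)) : Coalgebra.comul (R := K) (wPos r s i)
    = wPos r s i ⊗ₜ wPos r s i := comul_borelPos_eq (comul_tor r s _).symm

theorem comul_wInvPos (i : Fin (n - 1)) : Coalgebra.comul (R := K) (wInvPos r s i)
    = wInvPos r s i ⊗ₜ wInvPos r s i := comul_borelPos_eq (comul_tor r s _).symm

theorem comul_fNeg (i : Fin (n - 1)) : Coalgebra.comul (R := K) (fNeg r s i)
    = 1 ⊗ₜ fNeg r s i + fNeg r s i ⊗ₜ wNeg r s i := comul_borelNeg_eq (comul_f r s i).symm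

theorem comul_wNeg (i : Fin (n - 1)) : Coalgebra.comul (R := K) (wNeg r s i)
    = wNeg r s i ⊗ₜ wNeg r s i := comul_borelNeg_eq (comul_tor r s _).symm

theorem comul_wInvNeg (i : Fin (n - 1)) : Coalgebra.comul (R := K) (wInvNeg r s i)
    = wInvNeg r s i ⊗ₜ wInvNeg r s i := comul_borelNeg_eq (comul_tor r s _).symm

theorem counit_ePos (i : Fin (n - 1)) : Coalgebra.counit (R := K) (ePos r s i) = 0 := counit_e r s i
theorem counit_wPos (i : Fin (n - 1)) : Coalgebra.counit (R := K) (wPos r s i) = 1 :=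
  counit_tor r s _
theorem counit_wInvPos (i : Fin (n - 1)) : Coalgebra.counit (R := K) (wInvPos r s i) = 1 :=
  counit_tor r s _
theorem counit_fNeg (i : Fin (n - 1)) : Coalgebra.counit (R := K) (fNeg r s i) = 0 := counit_f r s i
theorem counit_wNeg (i : Fin (n - 1)) : Coalgebra.counit (R := K) (wNeg r s i) = 1 :=
  counit_tor r s _
theorem counit_wInvNeg (i : Fin (n - 1)) : Coalgebra.counit (R := K) (wInvNeg r s i) = 1 :=
  counit_tor r s _

theorem adjoin_letters_pos : Algebra.adjoin K (Set.range (ePos (n := n) r s) ∪ Set.range (wPos r s)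
    ∪ Set.range (wInvPos r s)) = ⊤ := by
  refine Eq.trans ?_ (Algebra.adjoin_adjoin_coe_preimage (R := K) (s := Set.range (e (n := n) r s) ∪ Set.range (w r s)
    ∪ Set.range fun i => tor r s (.wInv i)))
  congr 1
  ext x
  simp [ePos, wPos, wInvPos, Subtype.ext_iff]
  rfl

theorem adjoin_letters_neg : Algebra.adjoin K (Set.range (fNeg (n := n) r s) ∪ Set.range (wNeg r s)
    ∪ Set.range (wInvNeg r s)) = ⊤ := by
  refine Eq.trans ?_ (Algebra.adjoin_adjoin_coe_preimage (R := K) (s := Set.range (f (n := n) r s) ∪ Set.range (w' r s)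
    ∪ Set.range fun i => tor r s (.wInv' i)))
  congr 1
  ext x
  simp [fNeg, wNeg, wInvNeg, Subtype.ext_iff]
  rfl

end Letters

/-- A character `χ`, its convolution inverse `χ'` and a `(χ, ε)`-derivation `δ` of a bialgebra `H`,
with prescribed values on the letters `x`, `g`, `g'`. -/
structure SkewDerivation {K H I : Type*} [Field K] [Ring H] [Bialgebra K H] [DecidableEq I]
    (x g g' : I → H) (q : I → Kˣ) (i : I) where
  χ : H →ₐ[K] K
  χ' : H →ₐ[K] K
  δ : H →ₗ[K] K
  χ_x : ∀ j, χ (x j) = 0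
  χ_g : ∀ j, χ (g j) = q j
  χ_g' : ∀ j, χ (g' j) = ((q j)⁻¹ : Kˣ)
  χ'_x : ∀ j, χ' (x j) = 0
  χ'_g : ∀ j, χ' (g j) = ((q j)⁻¹ : Kˣ)
  χ'_g' : ∀ j, χ' (g' j) = q j
  δ_x : ∀ j, δ (x j) = if i = j then 1 else 0
  δ_g : ∀ j, δ (g j) = 0
  δ_g' : ∀ j, δ (g' j) = 0
  δ_mul : ∀ a b, δ (a * b) = χ a * δ b + δ a * Coalgebra.counit (R := K) b

section Functionals

variable {K : Type*} [Field K] {n : ℕ} {r s : Kˣ}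

theorem wt_div (i j : ℕ) : wt r s j i * (wt r s j (i + 1))⁻¹ = pairScalar r s i j := by
  rw [wt_eq, mul_inv_cancel_right, pairScalar]

theorem wt_div' (i j : ℕ) : (wt s r i j)⁻¹ * wt s r i (j + 1) = pairScalar r s i j := by
  unfold wt pairScalar ip
  split_ifs <;> first | omega | simp [mul_comm]

theorem natRep_e (hrs : r ≠ s) (i : Fin (n - 1)) :
    natRep r s hrs (e r s i) = moveCoord i (i + 1) 1 := lift_proj _ _ _
theorem natRep_f (hrs : r ≠ s) (i : Fin (n - 1)) :
    natRep r s hrs (f r s i) = moveCoord (i + 1) i 1 := lift_proj _ _ _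
theorem natRep_tor (hrs : r ≠ s) (x : TorusGen n) :
    natRep r s hrs (tor r s x) = natGen r s (.t x) := lift_proj _ _ _
theorem dualRep_e (hrs : r ≠ s) (i : Fin (n - 1)) :
    dualRep r s hrs (e r s i) = moveCoord (i + 1) i 1 := lift_proj _ _ _
theorem dualRep_f (hrs : r ≠ s) (i : Fin (n - 1)) :
    dualRep r s hrs (f r s i) = moveCoord i (i + 1) ((r⁻¹ * s⁻¹ : Kˣ) : K) := lift_proj _ _ _
theorem dualRep_tor (hrs : r ≠ s) (x : TorusGen n) :
    dualRep r s hrs (tor r s x) = dualGen r s (.t x) := lift_proj _ _ _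

/-- Sequences supported in degrees at most `m`. -/
def suppLE (K : Type*) [Field K] (m : ℕ) : Submodule K (ℕ → K) where
  carrier := {g | ∀ k, m < k → g k = 0}
  add_mem' hg hh k hk := by simp [hg k hk, hh k hk]
  zero_mem' k _ := rfl
  smul_mem' c g hg k hk := by simp [hg k hk]

/-- Sequences supported in degrees at least `m`. -/
def suppGE (K : Type*) [Field K] (m : ℕ) : Submodule K (ℕ → K) where
  carrier := {g | ∀ k, k < m → g k = 0}
  add_mem' hg hh k hk := by simp [hg k hk, hh k hk]
  zero_mem' k _ := rfl
  smul_mem' c g hg k hk := by simp [hg k hk]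

theorem triangular_diagOp_LE (d : ℕ → K) (i : ℕ) : ∃ α β γ : K, ∀ g ∈ suppLE K (i + 1),
    diagOp d g ∈ suppLE K (i + 1) ∧ diagOp d g (i + 1) = γ * g (i + 1) ∧
      diagOp d g i = α * g i + β * g (i + 1) :=
  ⟨d i, 0, d (i + 1), fun g hg => ⟨fun k hk => by simp [hg k hk], rfl, by simp⟩⟩

theorem triangular_diagOp_GE (d : ℕ → K) (i : ℕ) : ∃ α β γ : K, ∀ g ∈ suppGE K i,
    diagOp d g ∈ suppGE K i ∧ diagOp d g i = γ * g i ∧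
      diagOp d g (i + 1) = α * g (i + 1) + β * g i :=
  ⟨d (i + 1), 0, d i, fun g hg => ⟨fun k hk => by simp [hg k hk], rfl, by simp⟩⟩

theorem triangular_move_LE (c : K) (i j : ℕ) : ∃ α β γ : K, ∀ g ∈ suppLE K (i + 1),
    moveCoord j (j + 1) c g ∈ suppLE K (i + 1) ∧ moveCoord j (j + 1) c g (i + 1) = γ * g (i + 1) ∧
      moveCoord j (j + 1) c g i = α * g i + β * g (i + 1) := by
  refine ⟨0, if i = j then c else 0, 0, fun g hg => ⟨fun k hk => ?_, ?_, ?_⟩⟩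
  · simp only [moveCoord_apply]
    split_ifs with h
    · rw [hg _ (by omega), mul_zero]
    · rfl
  · simp only [moveCoord_apply]
    split_ifs with h
    · rw [hg _ (by omega), mul_zero, zero_mul]
    · simp
  · simp only [moveCoord_apply]
    split_ifs with h <;> simp [h]

theorem triangular_move_GE (c : K) (i j : ℕ) : ∃ α β γ : K, ∀ g ∈ suppGE K i,
    moveCoord (j + 1) j c g ∈ suppGE K i ∧ moveCoord (j + 1) j c g i = γ * g i ∧
      moveCoord (j + 1) j c g (i + 1) = α * g (i + 1) + β * g i := by
  refine ⟨0, if i = j then c else 0, 0, fun g hg => ⟨fun k hk => ?_, ?_, ?_⟩⟩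
  · simp only [moveCoord_apply]
    split_ifs with h
    · rw [hg _ (by omega), mul_zero]
    · rfl
  · simp only [moveCoord_apply]
    split_ifs with h
    · rw [hg _ (by omega), mul_zero, zero_mul]
    · simp
  · simp only [moveCoord_apply, Nat.add_right_cancel_iff]
    split_ifs with h <;> simp [h]

theorem single_mem_suppLE {i m : ℕ} (h : i ≤ m) : (Pi.single i 1 : ℕ → K) ∈ suppLE K m :=
  fun _ _ => Pi.single_eq_of_ne (by omega) 1

theorem single_mem_suppGE {i m : ℕ} (h : m ≤ i) : (Pi.single i 1 : ℕ → K) ∈ suppGE K m :=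
  fun _ _ => Pi.single_eq_of_ne (by omega) 1

/-- On the natural representation `borelPos` acts by upper triangular matrices, so the coordinates `i` and
`i + 1` give two characters and a skew derivation. Convolution with the characters given by the dual
representation turns the second character into the counit. -/
theorem exists_skewDerivation_pos (hrs : r ≠ s) (i : Fin (n - 1)) :
    Nonempty (SkewDerivation (ePos r s) (wPos r s) (wInvPos r s)
      (fun j => pairScalar r s i j) i) := by
  obtain ⟨α, γ, β, hα, hγ, hβ, hmul⟩ := exists_triangular (natRep r s hrs)
    (Set.range (e (n := n) r s) ∪ Set.range (w r s) ∪ Set.range fun i => tor r s (.wInv i))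
    (suppLE K (i + 1)) (LinearMap.proj (i : ℕ)) (LinearMap.proj ((i : ℕ) + 1))
    (v₀ := Pi.single (i : ℕ) 1) (v₁ := Pi.single ((i : ℕ) + 1) 1)
    (single_mem_suppLE (by omega)) (single_mem_suppLE le_rfl) (by simp) (by simp) (by simp) (by simp)
    (by
      rintro _ ((⟨j, rfl⟩ | ⟨j, rfl⟩) | ⟨j, rfl⟩)
      · rw [natRep_e]; exact triangular_move_LE _ _ _
      · rw [natRep_tor]; exact triangular_diagOp_LE _ _
      · simp only [natRep_tor]; exact triangular_diagOp_LE _ _)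
  obtain ⟨α', γ', -, hα', hγ', -, -⟩ := exists_triangular (dualRep r s hrs)
    (Set.range (e (n := n) r s) ∪ Set.range (w r s) ∪ Set.range fun i => tor r s (.wInv i))
    (suppGE K i) (LinearMap.proj ((i : ℕ) + 1)) (LinearMap.proj (i : ℕ))
    (v₀ := Pi.single ((i : ℕ) + 1) 1) (v₁ := Pi.single (i : ℕ) 1)
    (single_mem_suppGE (by omega)) (single_mem_suppGE le_rfl) (by simp) (by simp) (by simp) (by simp)
    (by
      rintro _ ((⟨j, rfl⟩ | ⟨j, rfl⟩) | ⟨j, rfl⟩)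
      · rw [dualRep_e]; exact triangular_move_GE _ _ _
      · rw [dualRep_tor]; exact triangular_diagOp_GE _ _
      · simp only [dualRep_tor]; exact triangular_diagOp_GE _ _)
  change borelPos n r s →ₐ[K] K at α γ α' γ'
  change borelPos n r s →ₗ[K] K at β
  change ∀ a : borelPos n r s, α a = _ at hα
  change ∀ a : borelPos n r s, γ a = _ at hγ
  change ∀ a : borelPos n r s, β a = _ at hβ
  change ∀ a : borelPos n r s, α' a = _ at hα'
  change ∀ a : borelPos n r s, γ' a = _ at hγ'
  change ∀ a b : borelPos n r s, β (a * b) = _ at hmul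
  have he : ∀ j, α (ePos r s j) = 0 ∧ γ (ePos r s j) = 0 ∧ α' (ePos r s j) = 0 ∧
      γ' (ePos r s j) = 0 ∧ β (ePos r s j) = if i = j then 1 else 0 := by
    intro j
    simp [hα, hβ, hγ, hα', hγ', ePos, natRep_e, dualRep_e, Fin.ext_iff, Pi.single_apply]
    grind
  have hw : ∀ j, α (wPos r s j) = wt r s j i ∧ γ (wPos r s j) = wt r s j (i + 1) ∧
      α' (wPos r s j) = ((wt r s j (i + 1))⁻¹ : Kˣ) ∧
      γ' (wPos r s j) = ((wt r s j i)⁻¹ : Kˣ) ∧ β (wPos r s j) = 0 := by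
    intro j
    simp [hα, hβ, hγ, hα', hγ', wPos, natRep_tor, dualRep_tor, natGen, dualGen]
  have hwi : ∀ j, α (wInvPos r s j) = ((wt r s j i)⁻¹ : Kˣ) ∧
      γ (wInvPos r s j) = ((wt r s j (i + 1))⁻¹ : Kˣ) ∧
      α' (wInvPos r s j) = wt r s j (i + 1) ∧
      γ' (wInvPos r s j) = wt r s j i ∧ β (wInvPos r s j) = 0 := by
    intro j
    simp [hα, hβ, hγ, hα', hγ', wInvPos, natRep_tor, dualRep_tor, natGen, dualGen]
  have hε : convChar γ α' = Bialgebra.counitAlgHom K (borelPos n r s) := by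
    refine AlgHom.ext_of_adjoin_eq_top adjoin_letters_pos ?_
    rintro _ ((⟨j, rfl⟩ | ⟨j, rfl⟩) | ⟨j, rfl⟩)
    · simp [convChar, comul_ePos, counit_ePos, he]
    · simp [convChar, comul_wPos, counit_wPos, hw]
    · simp [convChar, comul_wInvPos, counit_wInvPos, hwi]
  have hinv : ∀ j, wt r s j (i + 1) * (wt r s j i)⁻¹ = (pairScalar r s i j)⁻¹ := fun j => by
    rw [← wt_div, mul_inv, inv_inv, mul_comm]
  refine ⟨⟨convChar α α', convChar γ γ', convFun β α'.toLinearMap, fun j => ?_, fun j => ?_,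
    fun j => ?_, fun j => ?_, fun j => ?_, fun j => ?_, fun j => ?_, fun j => ?_, fun j => ?_,
    fun a b => ?_⟩⟩
  · simp [convChar, comul_ePos, he]
  · rw [← wt_div]; simp [convChar, comul_wPos, hw]
  · rw [← hinv]; simp [convChar, comul_wInvPos, hwi, mul_comm]
  · simp [convChar, comul_ePos, he]
  · rw [← hinv]; simp [convChar, comul_wPos, hw]
  · rw [← wt_div]; simp [convChar, comul_wInvPos, hwi, mul_comm]
  · simp [convFun, comul_ePos, he]
  · simp [convFun, comul_wPos, hw]
  · simp [convFun, comul_wInvPos, hwi]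
  · rw [convFun_mul_left hmul, hε]; rfl

/-- As `exists_skewDerivation_pos`, with lower triangular matrices and the convolution taken in the other
order. -/
theorem exists_skewDerivation_neg (hrs : r ≠ s) (i : Fin (n - 1)) :
    Nonempty (SkewDerivation (fNeg r s) (wNeg r s) (wInvNeg r s)
      (fun j => pairScalar r s j i) i) := by
  obtain ⟨α', γ', -, hα', hγ', -, -⟩ := exists_triangular (dualRep r s hrs)
    (Set.range (f (n := n) r s) ∪ Set.range (w' r s) ∪ Set.range fun i => tor r s (.wInv' i))
    (suppLE K (i + 1)) (LinearMap.proj (i : ℕ)) (LinearMap.proj ((i : ℕ) + 1))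
    (v₀ := Pi.single (i : ℕ) 1) (v₁ := Pi.single ((i : ℕ) + 1) 1)
    (single_mem_suppLE (by omega)) (single_mem_suppLE le_rfl) (by simp) (by simp) (by simp) (by simp)
    (by
      rintro _ ((⟨j, rfl⟩ | ⟨j, rfl⟩) | ⟨j, rfl⟩)
      · rw [dualRep_f]; exact triangular_move_LE _ _ _
      · rw [dualRep_tor]; exact triangular_diagOp_LE _ _
      · simp only [dualRep_tor]; exact triangular_diagOp_LE _ _)
  obtain ⟨α, γ, β, hα, hγ, hβ, hmul⟩ := exists_triangular (natRep r s hrs)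
    (Set.range (f (n := n) r s) ∪ Set.range (w' r s) ∪ Set.range fun i => tor r s (.wInv' i))
    (suppGE K i) (LinearMap.proj ((i : ℕ) + 1)) (LinearMap.proj (i : ℕ))
    (v₀ := Pi.single ((i : ℕ) + 1) 1) (v₁ := Pi.single (i : ℕ) 1)
    (single_mem_suppGE (by omega)) (single_mem_suppGE le_rfl) (by simp) (by simp) (by simp) (by simp)
    (by
      rintro _ ((⟨j, rfl⟩ | ⟨j, rfl⟩) | ⟨j, rfl⟩)
      · rw [natRep_f]; exact triangular_move_GE _ _ _
      · rw [natRep_tor]; exact triangular_diagOp_GE _ _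
      · simp only [natRep_tor]; exact triangular_diagOp_GE _ _)
  change borelNeg n r s →ₐ[K] K at α γ α' γ'
  change borelNeg n r s →ₗ[K] K at β
  change ∀ a : borelNeg n r s, α a = _ at hα
  change ∀ a : borelNeg n r s, γ a = _ at hγ
  change ∀ a : borelNeg n r s, β a = _ at hβ
  change ∀ a : borelNeg n r s, α' a = _ at hα'
  change ∀ a : borelNeg n r s, γ' a = _ at hγ'
  change ∀ a b : borelNeg n r s, β (a * b) = _ at hmul
  have he : ∀ j, α (fNeg r s j) = 0 ∧ γ (fNeg r s j) = 0 ∧ α' (fNeg r s j) = 0 ∧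
      γ' (fNeg r s j) = 0 ∧ β (fNeg r s j) = if i = j then 1 else 0 := by
    intro j
    simp [hα, hβ, hγ, hα', hγ', fNeg, natRep_f, dualRep_f, Fin.ext_iff, Pi.single_apply]
    grind
  have hw : ∀ j, α (wNeg r s j) = wt s r j (i + 1) ∧ γ (wNeg r s j) = wt s r j i ∧
      α' (wNeg r s j) = ((wt s r j i)⁻¹ : Kˣ) ∧
      γ' (wNeg r s j) = ((wt s r j (i + 1))⁻¹ : Kˣ) ∧ β (wNeg r s j) = 0 := by
    intro j
    simp [hα, hβ, hγ, hα', hγ', wNeg, natRep_tor, dualRep_tor, natGen, dualGen]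
  have hwi : ∀ j, α (wInvNeg r s j) = ((wt s r j (i + 1))⁻¹ : Kˣ) ∧
      γ (wInvNeg r s j) = ((wt s r j i)⁻¹ : Kˣ) ∧
      α' (wInvNeg r s j) = wt s r j i ∧
      γ' (wInvNeg r s j) = wt s r j (i + 1) ∧ β (wInvNeg r s j) = 0 := by
    intro j
    simp [hα, hβ, hγ, hα', hγ', wInvNeg, natRep_tor, dualRep_tor, natGen, dualGen]
  have hε : convChar α' γ = Bialgebra.counitAlgHom K (borelNeg n r s) := by
    refine AlgHom.ext_of_adjoin_eq_top adjoin_letters_neg ?_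
    rintro _ ((⟨j, rfl⟩ | ⟨j, rfl⟩) | ⟨j, rfl⟩)
    · simp [convChar, comul_fNeg, counit_fNeg, he]
    · simp [convChar, comul_wNeg, counit_wNeg, hw]
    · simp [convChar, comul_wInvNeg, counit_wInvNeg, hwi]
  have hinv : ∀ j, (wt s r j (i + 1))⁻¹ * wt s r j i = (pairScalar r s j i)⁻¹ := fun j => by
    rw [← wt_div', mul_inv, inv_inv, mul_comm]
  refine ⟨⟨convChar α' α, convChar γ' γ, convFun α'.toLinearMap β, fun j => ?_, fun j => ?_,
    fun j => ?_, fun j => ?_, fun j => ?_, fun j => ?_, fun j => ?_, fun j => ?_, fun j => ?_,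
    fun a b => ?_⟩⟩
  · simp [convChar, comul_fNeg, he]
  · rw [← wt_div']; simp [convChar, comul_wNeg, hw]
  · rw [← hinv]; simp [convChar, comul_wInvNeg, hwi, mul_comm]
  · simp [convChar, comul_fNeg, he]
  · rw [← hinv]; simp [convChar, comul_wNeg, hw]
  · rw [← wt_div']; simp [convChar, comul_wInvNeg, hwi, mul_comm]
  · simp [convFun, comul_fNeg, he]
  · simp [convFun, comul_wNeg, hw]
  · simp [convFun, comul_wInvNeg, hwi]
  · rw [convFun_mul_right hmul, hε]; rfl

end Functionals

end TwoParam

namespace TwoParam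

open SkewPairing Coalgebra

section HopfPairing

variable {K : Type*} [Field K] {n : ℕ} {r s : Kˣ}

theorem IsHopfPairing.isPairing {p : borelNeg n r s →ₗ[K] borelPos n r s →ₗ[K] K}
    (hp : IsHopfPairing p) : IsPairing p where
  one_left := hp.one_left
  one_right := hp.one_right
  mul_right b' b c := hp.mul_right b' b c _ (map_comul_borelNeg b')
  mul_left b' c' b := hp.mul_left b' c' b _ (map_comul_borelPos b)

theorem isHopfPairing_of_isPairing {p : borelNeg n r s →ₗ[K] borelPos n r s →ₗ[K] K}
    (hp : IsPairing p) (h1 : ∀ i j, p (fNeg r s i) (ePos r s j) = if i = j then ((s : K) - r)⁻¹ else 0)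
    (h2 : ∀ i j : Fin (n - 1), p (wNeg r s i) (wPos r s j) = pairScalar r s i j)
    (h3 : ∀ i j, p (fNeg r s i) (wPos r s j) = 0)
    (h4 : ∀ i j, p (wNeg r s i) (ePos r s j) = 0) : IsHopfPairing p where
  f_e := h1
  w'_w := h2
  f_w := h3
  w'_e := h4
  one_left := hp.one_left
  one_right := hp.one_right
  mul_right b' b c t ht := by rw [hp.mul_right, comul_borelNeg_eq (t := t) ht]
  mul_left b' c' b t ht := by rw [hp.mul_left, comul_borelPos_eq (t := t) ht]

/-- The letters `f_i`, `ω'_i`, `(ω'_i)⁻¹`. -/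
inductive NegLetter (n : ℕ) : Type
  | f (i : Fin (n - 1))
  | w (i : Fin (n - 1))
  | wInv (i : Fin (n - 1))

/-- The element of `borelNeg` given by a letter. -/
noncomputable def negLetter (r s : Kˣ) : NegLetter n → borelNeg n r s
  | .f i => fNeg r s i
  | .w i => wNeg r s i
  | .wInv i => wInvNeg r s i

theorem lift_negLetter_surjective :
    Function.Surjective (FreeAlgebra.lift K (negLetter (n := n) r s)) := by
  rw [← AlgHom.range_eq_top, eq_top_iff, ← adjoin_letters_neg, Algebra.adjoin_le_iff]
  rintro _ ((⟨j, rfl⟩ | ⟨j, rfl⟩) | ⟨j, rfl⟩)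
  · exact ⟨FreeAlgebra.ι K (.f j), FreeAlgebra.lift_ι_apply _ _⟩
  · exact ⟨FreeAlgebra.ι K (.w j), FreeAlgebra.lift_ι_apply _ _⟩
  · exact ⟨FreeAlgebra.ι K (.wInv j), FreeAlgebra.lift_ι_apply _ _⟩

/-- The functional on `borelPos` that pairs with a letter. -/
noncomputable def negFunctional (D : ∀ i : Fin (n - 1), SkewDerivation (ePos r s) (wPos r s)
    (wInvPos r s) (fun j => pairScalar r s i j) i) : NegLetter n → WithConv (borelPos n r s →ₗ[K] K)
  | .f i => WithConv.toConv (((s : K) - r)⁻¹ • (D i).δ)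
  | .w i => WithConv.toConv (D i).χ.toLinearMap
  | .wInv i => WithConv.toConv (D i).χ'.toLinearMap

section NegFunctional

variable (D : ∀ i : Fin (n - 1), SkewDerivation (ePos r s) (wPos r s)
    (wInvPos r s) (fun j => pairScalar r s i j) i)
  (D' : ∀ i : Fin (n - 1), SkewDerivation (fNeg r s) (wNeg r s)
    (wInvNeg r s) (fun j => pairScalar r s j i) i)

theorem negFunctional_one (x : NegLetter n) :
    (FreeAlgebra.lift K (negFunctional D) (FreeAlgebra.ι K x)).ofConv 1
      = Coalgebra.counit (R := K) (FreeAlgebra.lift K (negLetter r s) (FreeAlgebra.ι K x)) := by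
  rw [FreeAlgebra.lift_ι_apply, FreeAlgebra.lift_ι_apply]
  cases x with
  | f i =>
    have : (D i).δ 1 = 0 := by simpa using (D i).δ_mul 1 1
    simp [negFunctional, negLetter, counit_fNeg, this]
  | w i => simp [negFunctional, negLetter, counit_wNeg]
  | wInv i => simp [negFunctional, negLetter, counit_wInvNeg]

theorem compatMul_negFunctional (x : NegLetter n) :
    CompatMul (FreeAlgebra.lift K (negFunctional D)) (FreeAlgebra.lift K (negLetter r s))
      (FreeAlgebra.ι K x) := by
  cases x with
  | f i =>
    refine ⟨Bool, Finset.univ, fun t => bif t then FreeAlgebra.ι K (.f i) else 1,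
      fun t => bif t then FreeAlgebra.ι K (.w i) else FreeAlgebra.ι K (.f i), ?_, fun b c => ?_⟩
    · simp [negLetter, comul_fNeg, add_comm]
    · simp [negFunctional, (D i).δ_mul]; ring
  | w i =>
    refine ⟨Unit, Finset.univ, fun _ => FreeAlgebra.ι K (.w i), fun _ => FreeAlgebra.ι K (.w i), ?_,
      fun b c => ?_⟩
    · simp [negLetter, comul_wNeg]
    · simp [negFunctional]
  | wInv i =>
    refine ⟨Unit, Finset.univ, fun _ => FreeAlgebra.ι K (.wInv i),
      fun _ => FreeAlgebra.ι K (.wInv i), ?_, fun b c => ?_⟩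
    · simp [negLetter, comul_wInvNeg]
    · simp [negFunctional]

theorem negFunctional_wPos (j : Fin (n - 1)) (x : FreeAlgebra K (NegLetter n)) :
    (FreeAlgebra.lift K (negFunctional D) x).ofConv (wPos r s j)
      = (D' j).χ (FreeAlgebra.lift K (negLetter r s) x) := by
  have h := comul_wPos (K := K) (r := r) (s := s) j
  refine apply_groupLike_eq h (counit_wPos j) _ (fun x => ?_) x
  rw [FreeAlgebra.lift_ι_apply, FreeAlgebra.lift_ι_apply]
  cases x with
  | f i => simp [negFunctional, negLetter, (D i).δ_g, (D' j).χ_x]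
  | w i => simp [negFunctional, negLetter, (D i).χ_g, (D' j).χ_g]
  | wInv i => simp [negFunctional, negLetter, (D i).χ'_g, (D' j).χ_g']

theorem negFunctional_wInvPos (j : Fin (n - 1)) (x : FreeAlgebra K (NegLetter n)) :
    (FreeAlgebra.lift K (negFunctional D) x).ofConv (wInvPos r s j)
      = (D' j).χ' (FreeAlgebra.lift K (negLetter r s) x) := by
  have h := comul_wInvPos (K := K) (r := r) (s := s) j
  refine apply_groupLike_eq h (counit_wInvPos j) _ (fun x => ?_) x
  rw [FreeAlgebra.lift_ι_apply, FreeAlgebra.lift_ι_apply]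
  cases x with
  | f i => simp [negFunctional, negLetter, (D i).δ_g', (D' j).χ'_x]
  | w i => simp [negFunctional, negLetter, (D i).χ_g', (D' j).χ'_g]
  | wInv i => simp [negFunctional, negLetter, (D i).χ'_g', (D' j).χ'_g']

theorem negFunctional_ePos (j : Fin (n - 1)) (x : FreeAlgebra K (NegLetter n)) :
    (FreeAlgebra.lift K (negFunctional D) x).ofConv (ePos r s j)
      = (((s : K) - r)⁻¹ • (D' j).δ) (FreeAlgebra.lift K (negLetter r s) x) := by
  have h1 := apply_one_of_generators (negFunctional_one D)
  have h2 := negFunctional_wPos D D' j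
  have h3 := comul_ePos (K := K) (r := r) (s := s) j
  refine apply_skewPrimitive_eq h3 (counit_ePos j) (D' j).χ (((s : K) - r)⁻¹ • (D' j).δ)
    (fun a b => ?_) h2 h1 (fun x => ?_) x
  · rw [LinearMap.smul_apply, LinearMap.smul_apply, LinearMap.smul_apply, (D' j).δ_mul, smul_add,
      smul_eq_mul, smul_eq_mul, smul_eq_mul, smul_eq_mul]
    ring
  · rw [FreeAlgebra.lift_ι_apply, FreeAlgebra.lift_ι_apply]
    cases x with
    | f i =>
      exact congrArg (((s : K) - r)⁻¹ • ·)
        (((D i).δ_x j).trans ((if_congr eq_comm rfl rfl).trans ((D' j).δ_x i).symm))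
    | w i =>
      exact ((D i).χ_x j).trans
        ((congrArg (((s : K) - r)⁻¹ • ·) ((D' j).δ_g i)).trans (smul_zero _)).symm
    | wInv i =>
      exact ((D i).χ'_x j).trans
        ((congrArg (((s : K) - r)⁻¹ • ·) ((D' j).δ_g' i)).trans (smul_zero _)).symm

end NegFunctional

theorem exists_isHopfPairing (hrs : r ≠ s) :
    ∃ p : borelNeg n r s →ₗ[K] borelPos n r s →ₗ[K] K, IsHopfPairing p := by
  obtain ⟨D⟩ : Nonempty (∀ i : Fin (n - 1), SkewDerivation (ePos r s) (wPos r s)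
      (wInvPos r s) (fun j => pairScalar r s i j) i) := ⟨fun i => (exists_skewDerivation_pos hrs i).some⟩
  obtain ⟨D'⟩ : Nonempty (∀ i : Fin (n - 1), SkewDerivation (fNeg r s) (wNeg r s)
      (wInvNeg r s) (fun j => pairScalar r s j i) i) := ⟨fun i => (exists_skewDerivation_neg hrs i).some⟩
  have hdesc : ∀ y ∈ Set.range (ePos (n := n) r s) ∪ Set.range (wPos r s) ∪ Set.range (wInvPos r s),
      ∃ ψ : borelNeg n r s →ₗ[K] K, ∀ x, (FreeAlgebra.lift K (negFunctional D) x).ofConv y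
        = ψ (FreeAlgebra.lift K (negLetter r s) x) := by
    rintro _ ((⟨j, rfl⟩ | ⟨j, rfl⟩) | ⟨j, rfl⟩)
    · exact ⟨_, negFunctional_ePos D D' j⟩
    · exact ⟨(D' j).χ.toLinearMap, negFunctional_wPos D D' j⟩
    · exact ⟨(D' j).χ'.toLinearMap, negFunctional_wInvPos D D' j⟩
  obtain ⟨p, hp, hpΦ⟩ := exists_isPairing (Φ := FreeAlgebra.lift K (negFunctional D))
    (π' := FreeAlgebra.lift K (negLetter r s)) lift_negLetter_surjective (negFunctional_one D)
    (compatMul_negFunctional D) adjoin_letters_pos hdesc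
  have hp' : ∀ x b, p (negLetter r s x) b = (negFunctional D x).ofConv b := fun x b => by
    rw [← FreeAlgebra.lift_ι_apply (R := K) (negLetter r s), hpΦ, FreeAlgebra.lift_ι_apply]
  refine ⟨p, isHopfPairing_of_isPairing hp (fun i j => ?_) (fun i j => ?_) (fun i j => ?_)
    fun i j => ?_⟩
  · refine (hp' (.f i) _).trans ?_
    simp [negFunctional, (D i).δ_x]
  · exact (hp' (.w i) _).trans ((D i).χ_g j)
  · refine (hp' (.f i) _).trans ?_
    simp [negFunctional, (D i).δ_g]
  · exact (hp' (.w i) _).trans ((D i).χ_x j)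

namespace IsHopfPairing

variable {p : borelNeg n r s →ₗ[K] borelPos n r s →ₗ[K] K} (hp : IsHopfPairing p)
include hp

theorem apply_wNeg_wPos (i j : Fin (n - 1)) :
    p (wNeg r s i) (wPos r s j) = (pairScalar r s i j : Kˣ) := hp.w'_w i j

omit hp in
theorem wPos_mul_wInvPos (i : Fin (n - 1)) : wPos r s i * wInvPos r s i = 1 :=
  Subtype.ext (by simpa [tor, wPos, wInvPos, wNeg, wInvNeg] using proj_rel (Rel.w_inv (r := r) (s := s) i))

omit hp in
theorem wNeg_mul_wInvNeg (i : Fin (n - 1)) : wNeg r s i * wInvNeg r s i = 1 :=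
  Subtype.ext (by simpa [tor, wPos, wInvPos, wNeg, wInvNeg] using proj_rel (Rel.w'_inv (r := r) (s := s) i))

theorem apply_wNeg_wInvPos (i j : Fin (n - 1)) :
    p (wNeg r s i) (wInvPos r s j) = ((pairScalar r s i j)⁻¹ : Kˣ) := by
  have h := hp.isPairing.mul_right (wNeg r s i) (wPos r s j) (wInvPos r s j)
  rw [wPos_mul_wInvPos, hp.isPairing.one_right, counit_wNeg, comul_wNeg] at h
  simp only [TensorProduct.map_tmul, LinearMap.mul'_apply, LinearMap.flip_apply,
    hp.apply_wNeg_wPos] at h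
  rw [Units.val_inv_eq_inv_val, eq_inv_of_mul_eq_one_left h.symm]

theorem apply_fNeg_wInvPos (i j : Fin (n - 1)) : p (fNeg r s i) (wInvPos r s j) = 0 := by
  have h := hp.isPairing.mul_right (fNeg r s i) (wPos r s j) (wInvPos r s j)
  have h0 : p (fNeg r s i) (wPos r s j) = 0 := hp.f_w i j
  rw [wPos_mul_wInvPos, hp.isPairing.one_right, counit_fNeg, comul_fNeg] at h
  simpa [h0, hp.apply_wNeg_wPos] using h

theorem apply_wInvNeg_wPos (i j : Fin (n - 1)) :
    p (wInvNeg r s i) (wPos r s j) = ((pairScalar r s i j)⁻¹ : Kˣ) := by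
  have h := hp.isPairing.mul_left (wNeg r s i) (wInvNeg r s i) (wPos r s j)
  rw [wNeg_mul_wInvNeg, hp.isPairing.one_left, counit_wPos, comul_wPos] at h
  simp only [TensorProduct.map_tmul, LinearMap.mul'_apply,
    hp.apply_wNeg_wPos] at h
  rw [Units.val_inv_eq_inv_val, eq_inv_of_mul_eq_one_right h.symm]

theorem apply_wInvNeg_wInvPos (i j : Fin (n - 1)) :
    p (wInvNeg r s i) (wInvPos r s j) = (pairScalar r s i j : Kˣ) := by
  have h := hp.isPairing.mul_left (wNeg r s i) (wInvNeg r s i) (wInvPos r s j)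
  rw [wNeg_mul_wInvNeg, hp.isPairing.one_left, counit_wInvPos, comul_wInvPos] at h
  simp only [TensorProduct.map_tmul, LinearMap.mul'_apply, hp.apply_wNeg_wInvPos] at h
  rw [eq_inv_of_mul_eq_one_right h.symm]
  simp

theorem apply_wInvNeg_ePos (i j : Fin (n - 1)) : p (wInvNeg r s i) (ePos r s j) = 0 := by
  have h := hp.isPairing.mul_left (wNeg r s i) (wInvNeg r s i) (ePos r s j)
  have h0 : p (wNeg r s i) (ePos r s j) = 0 := hp.w'_e i j
  rw [wNeg_mul_wInvNeg, hp.isPairing.one_left, counit_ePos, comul_ePos] at h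
  simpa [h0, hp.apply_wNeg_wPos] using h

/-- A Hopf pairing of the Borel subalgebras is determined by its values on generators. -/
theorem unique {p₂ : borelNeg n r s →ₗ[K] borelPos n r s →ₗ[K] K} (hp₂ : IsHopfPairing p₂) :
    p = p₂ := by
  have hw : ∀ j v, p v (wPos r s j) = p₂ v (wPos r s j) := by
    intro j v
    have hv : v ∈ Algebra.adjoin K _ := adjoin_letters_neg (r := r) (s := s) ▸ Algebra.mem_top
    induction hv using Algebra.adjoin_induction with
    | mem x hx =>
      rcases hx with (⟨i, rfl⟩ | ⟨i, rfl⟩) | ⟨i, rfl⟩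
      · exact (hp.f_w i j).trans (hp₂.f_w i j).symm
      · rw [hp.apply_wNeg_wPos, hp₂.apply_wNeg_wPos]
      · rw [hp.apply_wInvNeg_wPos, hp₂.apply_wInvNeg_wPos]
    | algebraMap c =>
      simp [Algebra.algebraMap_eq_smul_one, hp.isPairing.one_left, hp₂.isPairing.one_left]
    | add a b _ _ ha hb => simp [ha, hb]
    | mul a b _ _ ha hb =>
      simp [hp.isPairing.mul_left, hp₂.isPairing.mul_left, comul_wPos, ha, hb]
  have key : ∀ b v, p v b = p₂ v b := by
    intro b
    have hb : b ∈ Algebra.adjoin K _ := adjoin_letters_pos (r := r) (s := s) ▸ Algebra.mem_top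
    induction hb using Algebra.adjoin_induction with
    | mem x hx =>
      intro v
      have hv : v ∈ Algebra.adjoin K _ := adjoin_letters_neg (r := r) (s := s) ▸ Algebra.mem_top
      rcases hx with (⟨j, rfl⟩ | ⟨j, rfl⟩) | ⟨j, rfl⟩
      · induction hv using Algebra.adjoin_induction with
        | mem x hx =>
          rcases hx with (⟨i, rfl⟩ | ⟨i, rfl⟩) | ⟨i, rfl⟩
          · exact (hp.f_e i j).trans (hp₂.f_e i j).symm
          · exact (hp.w'_e i j).trans (hp₂.w'_e i j).symm
          · rw [hp.apply_wInvNeg_ePos, hp₂.apply_wInvNeg_ePos]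
        | algebraMap c =>
          simp [Algebra.algebraMap_eq_smul_one, hp.isPairing.one_left, hp₂.isPairing.one_left]
        | add a b _ _ ha hb => simp [ha, hb]
        | mul a b _ _ ha hb =>
          simp [hp.isPairing.mul_left, hp₂.isPairing.mul_left, comul_ePos, ha, hb, hw,
            hp.isPairing.one_right, hp₂.isPairing.one_right]
      · exact hw j v
      · induction hv using Algebra.adjoin_induction with
        | mem x hx =>
          rcases hx with (⟨i, rfl⟩ | ⟨i, rfl⟩) | ⟨i, rfl⟩
          · rw [hp.apply_fNeg_wInvPos, hp₂.apply_fNeg_wInvPos]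
          · rw [hp.apply_wNeg_wInvPos, hp₂.apply_wNeg_wInvPos]
          · rw [hp.apply_wInvNeg_wInvPos, hp₂.apply_wInvNeg_wInvPos]
        | algebraMap c =>
          simp [Algebra.algebraMap_eq_smul_one, hp.isPairing.one_left, hp₂.isPairing.one_left]
        | add a b _ _ ha hb => simp [ha, hb]
        | mul a b _ _ ha hb =>
          simp [hp.isPairing.mul_left, hp₂.isPairing.mul_left, comul_wInvPos, ha, hb]
    | algebraMap c =>
      intro v
      simp [Algebra.algebraMap_eq_smul_one, hp.isPairing.one_right, hp₂.isPairing.one_right]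
    | add a b _ _ ha hb => intro v; simp [ha, hb]
    | mul a b _ _ ha hb =>
      intro v
      have h1 : p.flip a = p₂.flip a := LinearMap.ext ha
      have h2 : p.flip b = p₂.flip b := LinearMap.ext hb
      rw [hp.isPairing.mul_right, hp₂.isPairing.mul_right, h1, h2]
  exact LinearMap.ext fun v => LinearMap.ext fun b => key b v

end IsHopfPairing

end HopfPairing

end TwoParam

/-! ### The generators, indexed by the natural numbers -/

namespace TwoParam

open SkewPairing Coalgebra SerreTypeA

section Indexed

variable {K : Type*} [Field K] (n : ℕ) (r s : Kˣ)

/-- `e_i` as an element of `borelPos`, and zero out of range. -/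
noncomputable def xPos (i : ℕ) : borelPos n r s := ⟨eN n r s i, eN_mem i⟩
/-- `f_i` as an element of `borelNeg`, and zero out of range. -/
noncomputable def yNeg (i : ℕ) : borelNeg n r s := ⟨fN n r s i, fN_mem i⟩
/-- `ω_i` as an element of `borelPos`, and `1` out of range. -/
noncomputable def gPos (i : ℕ) : borelPos n r s := if h : i < n - 1 then wPos r s ⟨i, h⟩ else 1
/-- `ω'_i` as an element of `borelNeg`, and `1` out of range. -/
noncomputable def gNeg (i : ℕ) : borelNeg n r s := if h : i < n - 1 then wNeg r s ⟨i, h⟩ else 1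

variable {n r s}

theorem xPos_of_lt {i : ℕ} (h : i < n - 1) : xPos n r s i = ePos r s ⟨i, h⟩ :=
  Subtype.ext (by simp [xPos, eN, h, ePos])
theorem xPos_of_le {i : ℕ} (h : n - 1 ≤ i) : xPos n r s i = 0 :=
  Subtype.ext (by simp [xPos, eN, h.not_gt])
theorem yNeg_of_lt {i : ℕ} (h : i < n - 1) : yNeg n r s i = fNeg r s ⟨i, h⟩ :=
  Subtype.ext (by simp [yNeg, fN, h, fNeg])
theorem yNeg_of_le {i : ℕ} (h : n - 1 ≤ i) : yNeg n r s i = 0 :=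
  Subtype.ext (by simp [yNeg, fN, h.not_gt])
theorem gPos_of_lt {i : ℕ} (h : i < n - 1) : gPos n r s i = wPos r s ⟨i, h⟩ := dif_pos h
theorem gNeg_of_lt {i : ℕ} (h : i < n - 1) : gNeg n r s i = wNeg r s ⟨i, h⟩ := dif_pos h

theorem wPos_mul_ePos (i j : Fin (n - 1)) : wPos r s i * ePos r s j
    = ((r ^ ip i j * s ^ ip (i + 1) j : Kˣ) : K) • (ePos r s j * wPos r s i) :=
  Subtype.ext (w_e_rel r s i j)

theorem wNeg_mul_fNeg (i j : Fin (n - 1)) : wNeg r s i * fNeg r s j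
    = ((r ^ (-ip (i + 1) j) * s ^ (-ip i j) : Kˣ) : K) • (fNeg r s j * wNeg r s i) :=
  Subtype.ext (w'_f_rel r s i j)

theorem skewRel_pos : SkewRel ((r : K)⁻¹) (s : K) (n - 1) (xPos n r s) (gPos n r s) where
  comm_x i j h hj := by
    rw [xPos_of_lt (show i < n - 1 by omega), xPos_of_lt hj]
    exact Subtype.ext (e_comm_rel r s _ _ h)
  comm_w i j hi hj := by
    rw [gPos_of_lt hi, gPos_of_lt hj]
    exact Subtype.ext (tor_comm r s _ _)
  far i j hi hj h := by
    rw [xPos_of_lt hj, gPos_of_lt hi]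
    have h1 : ip i j = 0 := by unfold ip; grind
    have h2 : ip (i + 1) j = 0 := by unfold ip; grind
    change _ = _
    simpa [h1, h2] using wPos_mul_ePos (r := r) (s := s) ⟨i, hi⟩ ⟨j, hj⟩
  next i hi := by
    rw [xPos_of_lt hi, gPos_of_lt (show i < n - 1 by omega), wPos_mul_ePos]
    simp [ip, show i ≠ i + 1 + 1 by omega]
  prev i hi := by
    rw [xPos_of_lt (show i < n - 1 by omega), gPos_of_lt hi, wPos_mul_ePos]
    simp [ip, add_assoc]

theorem skewRel_neg : SkewRel (s : K) ((r : K)⁻¹) (n - 1) (yNeg n r s) (gNeg n r s) where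
  comm_x i j h hj := by
    rw [yNeg_of_lt (show i < n - 1 by omega), yNeg_of_lt hj]
    exact Subtype.ext (f_comm_rel r s _ _ h)
  comm_w i j hi hj := by
    rw [gNeg_of_lt hi, gNeg_of_lt hj]
    exact Subtype.ext (tor_comm r s _ _)
  far i j hi hj h := by
    rw [yNeg_of_lt hj, gNeg_of_lt hi]
    have h1 : ip i j = 0 := by unfold ip; grind
    have h2 : ip (i + 1) j = 0 := by unfold ip; grind
    change _ = _
    simpa [h1, h2] using wNeg_mul_fNeg (r := r) (s := s) ⟨i, hi⟩ ⟨j, hj⟩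
  next i hi := by
    rw [yNeg_of_lt hi, gNeg_of_lt (show i < n - 1 by omega), wNeg_mul_fNeg]
    simp [ip, show i ≠ i + 1 + 1 by omega]
  prev i hi := by
    rw [yNeg_of_lt (show i < n - 1 by omega), gNeg_of_lt hi, wNeg_mul_fNeg]
    simp [ip, add_assoc]

theorem IsHopfPairing.borelPairing {p : borelNeg n r s →ₗ[K] borelPos n r s →ₗ[K] K}
    (hp : IsHopfPairing p) : BorelPairing p ((r : K)⁻¹) (s : K) (r * (s : K)⁻¹) ((s - r : K)⁻¹) (n - 1)
      (xPos n r s) (gPos n r s) (yNeg n r s) (gNeg n r s) where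
  pairing := hp.isPairing
  skew := skewRel_pos
  skew' := skewRel_neg
  self i hi := by
    rw [yNeg_of_lt hi, gNeg_of_lt hi, wNeg_mul_fNeg]
    simp [ip]
  cdq := by field_simp
  comul_x i hi := by rw [xPos_of_lt hi, gPos_of_lt hi, comul_ePos]
  comul_w i hi := by rw [gPos_of_lt hi, comul_wPos]
  comul_y i hi := by rw [yNeg_of_lt hi, gNeg_of_lt hi, comul_fNeg]
  comul_w' i hi := by rw [gNeg_of_lt hi, comul_wNeg]
  counit_x i hi := by rw [xPos_of_lt hi, counit_ePos]
  counit_w i hi := by rw [gPos_of_lt hi, counit_wPos]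
  counit_y i hi := by rw [yNeg_of_lt hi, counit_fNeg]
  counit_w' i hi := by rw [gNeg_of_lt hi, counit_wNeg]
  y_x i j hi hj := by
    rw [yNeg_of_lt hi, xPos_of_lt hj]
    refine (hp.f_e _ _).trans ?_
    simp [Fin.ext_iff]
  y_w i j hi hj := by
    rw [yNeg_of_lt hi, gPos_of_lt hj]
    exact hp.f_w _ _
  w'_x i j hi hj := by
    rw [gNeg_of_lt hi, xPos_of_lt hj]
    exact hp.w'_e _ _

theorem serreRel_pos : SerreRel (r : K) (s : K) (xPos n r s) where
  p_ne := r.ne_zero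
  q_ne := s.ne_zero
  comm i j h := by
    by_cases hj : j < n - 1
    · exact skewRel_pos.comm_x i j h hj
    · rw [xPos_of_le (not_lt.1 hj)]
      exact Commute.zero_right _
  serre₁ i := by
    by_cases hi : i + 1 < n - 1
    · rw [xPos_of_lt hi, xPos_of_lt (show i < n - 1 by omega)]
      refine Subtype.ext ?_
      simpa [e, ePos] using proj_rel (Rel.serre_e₁ (r := r) (s := s) ⟨i, by omega⟩ ⟨i + 1, hi⟩ rfl)
    · simp [xPos_of_le (not_lt.1 hi)]
  serre₂ i := by
    by_cases hi : i + 1 < n - 1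
    · rw [xPos_of_lt hi, xPos_of_lt (show i < n - 1 by omega)]
      refine Subtype.ext ?_
      simpa [e, ePos] using proj_rel (Rel.serre_e₂ (r := r) (s := s) ⟨i, by omega⟩ ⟨i + 1, hi⟩ rfl)
    · simp [xPos_of_le (not_lt.1 hi)]

theorem serreRel_neg : SerreRel ((s : K)⁻¹) ((r : K)⁻¹) (yNeg n r s) where
  p_ne := inv_ne_zero s.ne_zero
  q_ne := inv_ne_zero r.ne_zero
  comm i j h := by
    by_cases hj : j < n - 1
    · exact skewRel_neg.comm_x i j h hj
    · rw [yNeg_of_le (not_lt.1 hj)]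
      exact Commute.zero_right _
  serre₁ i := by
    by_cases hi : i + 1 < n - 1
    · rw [yNeg_of_lt hi, yNeg_of_lt (show i < n - 1 by omega), add_comm (s : K)⁻¹, mul_comm (s : K)⁻¹]
      refine Subtype.ext ?_
      simpa [f, fNeg] using proj_rel (Rel.serre_f₁ (r := r) (s := s) ⟨i, by omega⟩ ⟨i + 1, hi⟩ rfl)
    · simp [yNeg_of_le (not_lt.1 hi)]
  serre₂ i := by
    by_cases hi : i + 1 < n - 1
    · rw [yNeg_of_lt hi, yNeg_of_lt (show i < n - 1 by omega), add_comm (s : K)⁻¹, mul_comm (s : K)⁻¹]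
      refine Subtype.ext ?_
      simpa [f, fNeg] using proj_rel (Rel.serre_f₂ (r := r) (s := s) ⟨i, by omega⟩ ⟨i + 1, hi⟩ rfl)
    · simp [yNeg_of_le (not_lt.1 hi)]

/-- For `n ≤ 3` there are no chains of three nodes, and the root vector vanishes. -/
theorem commute_middle_pos (h : n ≤ 3 ∨ (r : K) + s ≠ 0) (j : ℕ) :
    Commute (xPos n r s (j + 1)) (rootVec ((r : K)⁻¹) (xPos n r s) j 2) := by
  rcases h with h | h
  · have : rootVec ((r : K)⁻¹) (xPos n r s) j 2 = 0 := by
      rw [rootVec, xPos_of_le (show n - 1 ≤ j + 1 + 1 by omega)]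
      simp
    rw [this]
    exact Commute.zero_right _
  · exact serreRel_pos.commute_middle h j

theorem commute_middle_neg (h : n ≤ 3 ∨ (r : K) + s ≠ 0) (j : ℕ) :
    Commute (yNeg n r s (j + 1)) (rootVec (s : K) (yNeg n r s) j 2) := by
  rcases h with h | h
  · have : rootVec (s : K) (yNeg n r s) j 2 = 0 := by
      rw [rootVec, yNeg_of_le (show n - 1 ≤ j + 1 + 1 by omega)]
      simp
    rw [this]
    exact Commute.zero_right _
  · have h' : (s : K)⁻¹ + (r : K)⁻¹ ≠ 0 := by
      rw [inv_add_inv s.ne_zero r.ne_zero, add_comm]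
      exact div_ne_zero h (mul_ne_zero s.ne_zero r.ne_zero)
    have := serreRel_neg.commute_middle h' j (x := yNeg n r s)
    rwa [inv_inv] at this

section Double

variable {p : borelNeg n r s →ₗ[K] borelPos n r s →ₗ[K] K} (hp : IsHopfPairing p)
include hp

omit hp in
theorem pairScalar_inv (i j : ℕ) :
    (pairScalar r s i j)⁻¹ = r ^ ip (i + 1) j * s ^ ip i j := by
  have h1 : ip j i = -ip (i + 1) j := by unfold ip; grind
  have h2 : ip (j + 1) i = -ip i j := by unfold ip; grind
  rw [pairScalar, h1, h2, mul_inv, zpow_neg, zpow_neg, inv_inv, inv_inv]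

omit hp in
theorem w'_mul_e (i j : Fin (n - 1)) : w' r s i * e r s j
    = ((pairScalar r s i j)⁻¹ : Kˣ) • (e r s j * w' r s i) := by
  rw [w'_e_rel, pairScalar_inv]
  rfl

omit hp in
theorem e_mul_wInv' (i j : Fin (n - 1)) : e r s j * tor r s (.wInv' i)
    = ((pairScalar r s i j)⁻¹ : Kˣ) • (tor r s (.wInv' i) * e r s j) := by
  have h1 : w' r s i * tor r s (.wInv' i) = 1 := congrArg Subtype.val (IsHopfPairing.wNeg_mul_wInvNeg i)
  have h2 : tor r s (.wInv' i) * w' r s i = 1 := (tor_comm r s _ _).trans h1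
  have h3 := congrArg (fun z => tor r s (.wInv' i) * z * tor r s (.wInv' i)) (w'_mul_e i j)
  simp only [← mul_assoc, h2, one_mul, mul_smul_comm, smul_mul_assoc] at h3
  rwa [mul_assoc _ (w' r s i), h1, mul_one] at h3

theorem IsHopfPairing.actL_wPos_fNeg (i j : Fin (n - 1)) :
    actL p (wPos r s j) (fNeg r s i) = fNeg r s i := by
  have h1 : p (fNeg r s i) (wPos r s j) = 0 := hp.f_w i j
  simp [actL_apply, comul_fNeg, h1, hp.isPairing.one_left, counit_wPos]

theorem IsHopfPairing.actR_wPos_fNeg (i j : Fin (n - 1)) :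
    actR p (wPos r s j) (fNeg r s i) = (pairScalar r s i j : K) • fNeg r s i := by
  have h1 : p (fNeg r s i) (wPos r s j) = 0 := hp.f_w i j
  simp [actR_apply, comul_fNeg, h1, hp.apply_wNeg_wPos]

theorem IsHopfPairing.actL_ePos_fNeg (i j : Fin (n - 1)) :
    actL p (ePos r s j) (fNeg r s i) = if i = j then ((s : K) - r)⁻¹ • wNeg r s i else 0 := by
  have h2 : p (fNeg r s i) (ePos r s j) = _ := hp.f_e i j
  simp [actL_apply, comul_fNeg, h2, hp.isPairing.one_left, counit_ePos]

theorem IsHopfPairing.actR_ePos_fNeg (i j : Fin (n - 1)) :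
    actR p (ePos r s j) (fNeg r s i) = if i = j then ((s : K) - r)⁻¹ • 1 else 0 := by
  have h2 : p (fNeg r s i) (ePos r s j) = _ := hp.f_e i j
  have h3 : p (wNeg r s i) (ePos r s j) = 0 := hp.w'_e i j
  simp [actR_apply, comul_fNeg, h2, h3]

omit hp in
theorem actL_groupLike {g : borelNeg n r s} (hg : Coalgebra.comul (R := K) g = g ⊗ₜ g)
    (b : borelPos n r s) : actL p b g = p g b • g := by
  simp [actL_apply, hg]

omit hp in
theorem actR_groupLike {g : borelNeg n r s} (hg : Coalgebra.comul (R := K) g = g ⊗ₜ g)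
    (b : borelPos n r s) : actR p b g = p g b • g := by
  simp [actR_apply, hg]

/-- The relation of the quantum double for `b = ω_j`. -/
theorem IsHopfPairing.actL_wPos (j : Fin (n - 1)) (v : borelNeg n r s) :
    (actL p (wPos r s j) v : U n r s) * w r s j = w r s j * actR p (wPos r s j) v := by
  have P := hp.isPairing
  have hv : v ∈ Algebra.adjoin K _ := adjoin_letters_neg (r := r) (s := s) ▸ Algebra.mem_top
  induction hv using Algebra.adjoin_induction with
  | mem v hv =>
    rcases hv with (⟨i, rfl⟩ | ⟨i, rfl⟩) | ⟨i, rfl⟩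
    · have h1 : pairScalar r s i j * (r ^ (-ip j i) * s ^ (-ip (j + 1) i)) = 1 := by
        rw [pairScalar, mul_mul_mul_comm, ← zpow_add, ← zpow_add]
        simp
      rw [hp.actL_wPos_fNeg, hp.actR_wPos_fNeg]
      simp only [Subalgebra.coe_smul, mul_smul_comm]
      change f r s i * w r s j = (pairScalar r s i j : K) • (w r s j * f r s i)
      rw [w_f_rel, smul_smul, ← Units.val_mul, h1, Units.val_one, one_smul]
    · rw [actL_groupLike (comul_wNeg i), actR_groupLike (comul_wNeg i)]
      simp only [Subalgebra.coe_smul, mul_smul_comm, smul_mul_assoc]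
      exact congrArg _ (tor_comm r s _ _)
    · rw [actL_groupLike (comul_wInvNeg i), actR_groupLike (comul_wInvNeg i)]
      simp only [Subalgebra.coe_smul, mul_smul_comm, smul_mul_assoc]
      exact congrArg _ (tor_comm r s _ _)
  | algebraMap c => simp [Algebra.algebraMap_eq_smul_one, P.actL_one_right, P.actR_one_right]
  | add a b _ _ ha hb => simp [add_mul, mul_add, ha, hb]
  | mul a b _ _ ha hb =>
    have h1 := P.actL_mul_right (s := {()}) (l := fun _ => wPos r s j) (m := fun _ => wPos r s j)
      (x := wPos r s j) (by simp [comul_wPos]) a b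
    have h2 := P.actR_mul_right (s := {()}) (l := fun _ => wPos r s j) (m := fun _ => wPos r s j)
      (x := wPos r s j) (by simp [comul_wPos]) a b
    rw [Finset.sum_singleton] at h1 h2
    rw [h1, h2, Subalgebra.coe_mul, Subalgebra.coe_mul, mul_assoc, hb, ← mul_assoc, ha, mul_assoc]

/-- The relation of the quantum double for `b = e_j`. -/
theorem IsHopfPairing.actL_ePos (j : Fin (n - 1)) (v : borelNeg n r s) :
    (actL p (ePos r s j) v : U n r s) + actL p (wPos r s j) v * e r s j
      = e r s j * v + w r s j * actR p (ePos r s j) v := by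
  have P := hp.isPairing
  have hv : v ∈ Algebra.adjoin K _ := adjoin_letters_neg (r := r) (s := s) ▸ Algebra.mem_top
  induction hv using Algebra.adjoin_induction with
  | mem v hv =>
    rcases hv with (⟨i, rfl⟩ | ⟨i, rfl⟩) | ⟨i, rfl⟩
    · rw [hp.actL_wPos_fNeg, hp.actL_ePos_fNeg, hp.actR_ePos_fNeg]
      have h := e_f_rel r s j i
      by_cases hij : i = j
      · subst hij
        rw [if_pos rfl] at h
        simp only [if_true, Subalgebra.coe_smul, mul_smul_comm, Subalgebra.coe_one, mul_one]
        change ((s : K) - r)⁻¹ • w' r s i + f r s i * e r s i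
          = e r s i * f r s i + ((s : K) - r)⁻¹ • w r s i
        rw [h, ← neg_sub (r : K) s, inv_neg]
        module
      · rw [if_neg (Ne.symm hij)] at h
        simp only [hij, if_false, Subalgebra.coe_zero, zero_add, mul_zero, add_zero]
        exact (h.trans (add_zero _)).symm
    · have h3 : p (wNeg r s i) (ePos r s j) = 0 := hp.w'_e i j
      rw [actL_groupLike (comul_wNeg i), actL_groupLike (comul_wNeg i), actR_groupLike (comul_wNeg i),
        h3, hp.apply_wNeg_wPos, zero_smul]
      simp only [Subalgebra.coe_smul, smul_mul_assoc, Subalgebra.coe_zero, zero_add, mul_zero, add_zero]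
      change pairScalar r s i j • (w' r s i * e r s j) = e r s j * w' r s i
      rw [w'_mul_e, smul_inv_smul]
    · rw [actL_groupLike (comul_wInvNeg i), actL_groupLike (comul_wInvNeg i),
        actR_groupLike (comul_wInvNeg i), hp.apply_wInvNeg_ePos, hp.apply_wInvNeg_wPos, zero_smul]
      simp only [Subalgebra.coe_smul, smul_mul_assoc, Subalgebra.coe_zero, zero_add, mul_zero, add_zero]
      exact (e_mul_wInv' i j).symm
  | algebraMap c =>
    simp [Algebra.algebraMap_eq_smul_one, P.actL_one_right, P.actR_one_right, counit_ePos, counit_wPos]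
  | add a b _ _ ha hb =>
    simp only [map_add, Subalgebra.coe_add, add_mul, mul_add]
    rw [add_add_add_comm, ha, hb, add_add_add_comm]
  | mul a b _ _ ha hb =>
    have h1 := P.actL_mul_right (s := {()}) (l := fun _ => wPos r s j) (m := fun _ => wPos r s j)
      (x := wPos r s j) (by simp [comul_wPos]) a b
    have h2 := P.actL_mul_right (s := Finset.univ) (l := fun t => bif t then ePos r s j else wPos r s j)
      (m := fun t => bif t then 1 else ePos r s j)
      (x := ePos r s j) (by simp [comul_ePos]) a b
    have h3 := P.actR_mul_right (s := Finset.univ) (l := fun t => bif t then ePos r s j else wPos r s j)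
      (m := fun t => bif t then 1 else ePos r s j)
      (x := ePos r s j) (by simp [comul_ePos]) a b
    rw [Finset.sum_singleton] at h1
    simp only [Fintype.sum_bool, cond_true, cond_false, P.actL_one, P.actR_one] at h2 h3
    rw [h1, h2, h3]
    simp only [Subalgebra.coe_mul, Subalgebra.coe_add]
    have h4 := hp.actL_wPos j a
    generalize (actL p (ePos r s j) a : U n r s) = La at *
    generalize (actL p (wPos r s j) a : U n r s) = Wa at *
    generalize (actR p (ePos r s j) a : U n r s) = Ra at *
    generalize (actR p (wPos r s j) a : U n r s) = Va at *
    calc _ = La * b + Wa * ((actL p (ePos r s j) b : U n r s)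
          + (actL p (wPos r s j) b : U n r s) * e r s j) := by noncomm_ring
      _ = (La + Wa * e r s j) * b + Wa * w r s j * (actR p (ePos r s j) b : U n r s) := by
        rw [hb]; noncomm_ring
      _ = _ := by rw [ha, h4]; noncomm_ring

/-- The double relation holds for the elements of the positive part. -/
theorem IsHopfPairing.doubleRel {b : borelPos n r s}
    (hb : b ∈ Algebra.adjoin K (xPos n r s '' Set.Iio (n - 1))) :
    DoubleRel (borelNeg n r s).val (borelPos n r s).val p b := by
  have P := hp.isPairing
  refine DoubleRel.of_adjoin P ?_ hb
  rintro _ ⟨j, hj, rfl⟩ v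
  rw [xPos_of_lt hj]
  simp only [comul_ePos, map_add, TensorProduct.map_tmul, LinearMap.mul'_apply, LinearMap.comp_apply,
    LinearMap.flip_apply, P.actR_one, map_one, AlgHom.toLinearMap_apply, mul_one]
  exact hp.actL_ePos ⟨j, hj⟩ v

end Double

end Indexed

end TwoParam

/-! ### Orthogonality of the PBW monomials and dual bases -/

namespace SerreTypeA

section OrderedProd

variable {A : Type*} [Monoid A] {m : ℕ}

/-- An array of exponents, extended by zero. -/
def extendExp (a : Fin m → Fin m → ℕ) (i j : ℕ) : ℕ :=
  if h : i < m ∧ j < m then a ⟨i, h.1⟩ ⟨j, h.2⟩ else 0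

theorem extendExp_coe (a : Fin m → Fin m → ℕ) (i j : Fin m) : extendExp a i j = a i j := by
  simp [extendExp]

theorem row_eq_prod (g : ℕ → A) (a : ℕ → ℕ) (j : ℕ) :
    row g a j = ((List.range j).map fun i => g i ^ a i).prod := by
  induction j with
  | zero => rfl
  | succ j ih => simp [row, ih, List.range_succ]

theorem ordMon_eq_prod (G : ℕ → ℕ → A) (a : ℕ → ℕ → ℕ) (m : ℕ) :
    ordMon G a m = ((List.range m).map fun i => row (G i) (a i) (i + 1)).prod := by
  induction m with
  | zero => rfl
  | succ j ih => simp [ordMon, ih, List.range_succ]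

theorem filter_range_le {i m : ℕ} (h : i < m) :
    (List.range m).filter (fun j => j ≤ i) = List.range (i + 1) := by
  obtain ⟨k, rfl⟩ := Nat.exists_eq_add_of_lt h
  rw [show i + k + 1 = i + 1 + k by ring, List.range_add, List.filter_append,
    List.filter_eq_self.2, List.filter_eq_nil_iff.2, List.append_nil]
  · intro x hx
    obtain ⟨y, -, rfl⟩ := List.mem_map.1 hx
    simp
    omega
  · intro x hx
    have := List.mem_range.1 hx
    simp
    omega

theorem orderedProd_eq_ordMon (G : ℕ → ℕ → A) (a : Fin m → Fin m → ℕ) :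
    TwoParam.orderedProd (fun i j => G i j) a = ordMon G (extendExp a) m := by
  rw [TwoParam.orderedProd, ordMon_eq_prod, ← List.map_coe_finRange_eq_range, List.map_map]
  congr 1
  refine List.map_congr_left fun i _ => ?_
  simp only [Function.comp_apply, row_eq_prod]
  rw [← filter_range_le i.2, ← List.map_coe_finRange_eq_range, List.filter_map, List.map_map]
  congr 1
  refine List.map_congr_left fun j _ => ?_
  simp [extendExp_coe]

end OrderedProd

theorem map_row {M N : Type*} [Monoid M] [Monoid N] (φ : M →* N) (g : ℕ → M) (a : ℕ → ℕ) (j : ℕ) :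
    φ (row g a j) = row (fun i => φ (g i)) a j := by
  induction j with
  | zero => exact map_one φ
  | succ j ih => rw [row, row, map_mul, map_pow, ih]

theorem map_ordMon {M N : Type*} [Monoid M] [Monoid N] (φ : M →* N) (G : ℕ → ℕ → M)
    (a : ℕ → ℕ → ℕ) (m : ℕ) : φ (ordMon G a m) = ordMon (fun i j => φ (G i j)) a m := by
  induction m with
  | zero => exact map_one φ
  | succ m ih => rw [ordMon, ordMon, map_mul, ih, map_row]

section QFactorial

variable {K : Type*} [Field K] {q : K} {ℓ : ℕ}

theorem qFactorial_ne_zero (hq : IsPrimitiveRoot q ℓ) {a : ℕ} (ha : a < ℓ) : qFactorial q a ≠ 0 := by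
  refine Finset.prod_ne_zero_iff.2 fun i hi h0 => ?_
  have hi := Finset.mem_range.1 hi
  have h1 := geom_sum_mul q (i + 1)
  rw [h0, zero_mul] at h1
  exact hq.pow_ne_one_of_pos_of_lt (Nat.succ_ne_zero i) (by omega) (sub_eq_zero.1 h1.symm)

theorem qFactorial_eq_zero (hq : IsPrimitiveRoot q ℓ) (hℓ : 1 < ℓ) {a : ℕ} (ha : ℓ ≤ a) :
    qFactorial q a = 0 := by
  refine Finset.prod_eq_zero (Finset.mem_range.2 (show ℓ - 1 < a by omega)) ?_
  rw [Nat.sub_add_cancel hℓ.le]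
  exact hq.geom_sum_eq_zero hℓ

end QFactorial

section DualBases

variable {K B B' V V' ι : Type*} [Field K] [AddCommGroup B] [Module K B] [AddCommGroup B'] [Module K B']
  [AddCommGroup V] [Module K V] [AddCommGroup V'] [Module K V']

theorem linearIndependent_of_orthogonal [DecidableEq ι] (p : B' →ₗ[K] B →ₗ[K] K) {E : ι → B}
    {F : ι → B'} {N : ι → K} (hN : ∀ a, N a ≠ 0)
    (h : ∀ a b, p (F a) (E b) = if a = b then N a else 0) : LinearIndependent K E := by
  rw [linearIndependent_iff']
  intro s g hg a ha
  have h1 := congrArg (p (F a)) hg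
  simpa [h, ha, hN a] using h1

/-- Orthogonal families that span two spaces can be rescaled to dual bases. -/
theorem exists_dual_bases [Finite ι] [DecidableEq ι] (p : B' →ₗ[K] B →ₗ[K] K) {E : ι → B} {F : ι → B'}
    {N : ι → K} (hN : ∀ a, N a ≠ 0) (h : ∀ a b, p (F a) (E b) = if a = b then N a else 0)
    (j : B →ₗ[K] V) (j' : B' →ₗ[K] V') (hj : Function.Injective j) (hj' : Function.Injective j')
    {S : Submodule K V} {S' : Submodule K V'} (hS : S = Submodule.span K (Set.range (j ∘ E)))
    (hS' : S' = Submodule.span K (Set.range (j' ∘ F))) :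
    ∃ (u : Module.Basis (Fin (Module.finrank K S)) K S)
      (v : Module.Basis (Fin (Module.finrank K S)) K S'),
      ∀ k l x y, j' y = v k → j x = u l → p y x = if k = l then 1 else 0 := by
  have := Fintype.ofFinite ι
  let F' : ι → B' := fun a => (N a)⁻¹ • F a
  have hF' : ∀ a b, p (F' a) (E b) = if a = b then 1 else 0 := by
    intro a b
    simp only [F', map_smul, LinearMap.smul_apply, h]
    split_ifs <;> simp [hN a]
  have hE : LinearIndependent K (j ∘ E) :=
    (linearIndependent_of_orthogonal p (fun _ => one_ne_zero) hF').map' j (LinearMap.ker_eq_bot.2 hj)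
  have hF : LinearIndependent K (j' ∘ F') :=
    (linearIndependent_of_orthogonal p.flip (fun _ => one_ne_zero) fun a b => by
      rw [LinearMap.flip_apply, hF', if_congr eq_comm rfl rfl]).map' j' (LinearMap.ker_eq_bot.2 hj')
  have hS2 : S' = Submodule.span K (Set.range (j' ∘ F')) := by
    rw [hS']
    refine le_antisymm (Submodule.span_le.2 ?_) (Submodule.span_le.2 ?_)
    · rintro _ ⟨a, rfl⟩
      have : (j' ∘ F) a = N a • (j' ∘ F') a := by simp [F', smul_smul, hN a]
      rw [this]
      exact Submodule.smul_mem _ _ (Submodule.subset_span ⟨a, rfl⟩)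
    · rintro _ ⟨a, rfl⟩
      have : (j' ∘ F') a = (N a)⁻¹ • (j' ∘ F) a := by simp [F']
      rw [this]
      exact Submodule.smul_mem _ _ (Submodule.subset_span ⟨a, rfl⟩)
  subst hS
  subst hS2
  have hcard := finrank_span_eq_card hE
  let e : ι ≃ Fin (Module.finrank K (Submodule.span K (Set.range (j ∘ E)))) :=
    Fintype.equivFinOfCardEq hcard.symm
  refine ⟨(Module.Basis.span hE).reindex e, (Module.Basis.span hF).reindex e, fun k l x y hy hx => ?_⟩
  rw [Module.Basis.reindex_apply, Module.Basis.span_apply] at hx hy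
  rw [hj hx, hj' hy, hF']
  simp

/-- Expansion of the vectors of an orthogonal family in dual bases of the homogeneous components of
the span of its good members, up to the vectors that are not good. -/
theorem apply_eq_sum_of_dual {Z Q : Type*} [AddCommGroup Q] [Module K Q] (p : B' →ₗ[K] B →ₗ[K] K)
    {E : ι → B} {F : ι → B'} {good : ι → Prop} {deg : ι → Z}
    (orth : ∀ a b, good b → p (F b) (E a) ≠ 0 → good a ∧ deg a = deg b) {d : Z → ℕ}
    {u : ∀ ζ, Fin (d ζ) → B} {v : ∀ ζ, Fin (d ζ) → B'}
    (hu : ∀ a, good a → E a ∈ Submodule.span K (Set.range (u (deg a))))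
    (hv : ∀ ζ k, v ζ k ∈ Submodule.span K (F '' {a | good a ∧ deg a = ζ}))
    (hp : ∀ ζ k l, p (v ζ k) (u ζ l) = if k = l then 1 else 0)
    {s : Finset Z} (hs : ∀ a, good a → deg a ∈ s) (φ : B →ₗ[K] Q) (hφ : ∀ a, ¬ good a → φ (E a) = 0)
    (a : ι) : φ (E a) = ∑ ζ ∈ s, ∑ k, p (v ζ k) (E a) • φ (u ζ k) := by
  have h0 : ∀ ζ k, ¬ (good a ∧ deg a = ζ) → p (v ζ k) (E a) = 0 := by
    intro ζ k hna
    have := hv ζ k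
    generalize v ζ k = y at this
    induction this using Submodule.span_induction with
    | mem x hx =>
      obtain ⟨b, ⟨hb, rfl⟩, rfl⟩ := hx
      by_contra hne
      exact hna (orth a b hb hne)
    | zero => simp
    | add x y _ _ hx hy => simp [hx, hy]
    | smul c x _ hx => simp [hx]
  by_cases ha : good a
  · rw [Finset.sum_eq_single (deg a)]
    · have := hu a ha
      generalize E a = y at this
      generalize deg a = ζ at this
      induction this using Submodule.span_induction with
      | mem x hx =>
        obtain ⟨l, rfl⟩ := hx
        simp [hp]
      | zero => simp
      | add x y _ _ hx hy =>
        rw [map_add, hx, hy, ← Finset.sum_add_distrib]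
        simp [add_smul]
      | smul c x _ hx =>
        rw [map_smul, hx, Finset.smul_sum]
        simp [smul_smul]
    · intro ζ _ hne
      refine Finset.sum_eq_zero fun k _ => ?_
      rw [h0 ζ k fun h => hne h.2.symm, zero_smul]
    · exact fun h => (h (hs a ha)).elim
  · rw [hφ a ha]
    refine (Finset.sum_eq_zero fun ζ _ => Finset.sum_eq_zero fun k _ => ?_).symm
    rw [h0 ζ k fun h => ha h.1, zero_smul]

end DualBases

end SerreTypeA

namespace TwoParam

open SkewPairing SerreTypeA

section Monomials

variable {K : Type*} [Field K] {n : ℕ} {r s : Kˣ}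

variable (r s) in
/-- The PBW monomial in the `𝓔_{i,j}` with exponents `a`, as an element of `borelPos`. -/
noncomputable def posMon (a : Fin (n - 1) → Fin (n - 1) → ℕ) : borelPos n r s :=
  ⟨orderedProd (rootE r s) a, orderedProd_mem _ (fun _ _ => rootEAux_mem _ _) a⟩

variable (r s) in
/-- The PBW monomial in the `𝓕_{i,j}` with exponents `a`, as an element of `borelNeg`. -/
noncomputable def negMon (a : Fin (n - 1) → Fin (n - 1) → ℕ) : borelNeg n r s :=
  ⟨orderedProd (rootF r s) a, orderedProd_mem _ (fun _ _ => rootFAux_mem _ _) a⟩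

theorem coe_rootVec_pos (j l : ℕ) :
    ((rootVec ((r : K)⁻¹) (xPos n r s) j l : borelPos n r s) : U n r s) = rootEAux n r s j l := by
  induction l with
  | zero => rfl
  | succ l ih => simp [rootVec, rootEAux, ih, xPos]

theorem coe_rootVec_neg (j l : ℕ) :
    ((rootVec (s : K) (yNeg n r s) j l : borelNeg n r s) : U n r s) = rootFAux n r s j l := by
  induction l with
  | zero => rfl
  | succ l ih => simp [rootVec, rootFAux, ih, yNeg]

theorem posMon_eq (a : Fin (n - 1) → Fin (n - 1) → ℕ) : posMon r s a
    = ordMon (fun m j => rootVec ((r : K)⁻¹) (xPos n r s) j (m - j)) (extendExp a) (n - 1) := by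
  refine Subtype.ext (Eq.trans ?_ (map_ordMon (borelPos n r s).val.toMonoidHom _ _ _).symm)
  refine Eq.trans ?_ (orderedProd_eq_ordMon _ a)
  refine congrArg (orderedProd · a) (funext fun i => funext fun j => ?_)
  exact (coe_rootVec_pos (K := K) (n := n) (r := r) (s := s) _ _).symm

theorem negMon_eq (a : Fin (n - 1) → Fin (n - 1) → ℕ) : negMon r s a
    = ordMon (fun m j => rootVec (s : K) (yNeg n r s) j (m - j)) (extendExp a) (n - 1) := by
  refine Subtype.ext (Eq.trans ?_ (map_ordMon (borelNeg n r s).val.toMonoidHom _ _ _).symm)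
  refine Eq.trans ?_ (orderedProd_eq_ordMon _ a)
  refine congrArg (orderedProd · a) (funext fun i => funext fun j => ?_)
  exact (coe_rootVec_neg (K := K) (n := n) (r := r) (s := s) _ _).symm

/-- The exponents that occur in a monomial are all less than `ℓ`. -/
def Truncated {m : ℕ} (ℓ : ℕ) (a : Fin m → Fin m → ℕ) : Prop := ∀ i j, j ≤ i → a i j < ℓ

/-- The array of exponents with those that do not occur in a monomial set to zero. -/
def lowerTri {m : ℕ} (a : Fin m → Fin m → ℕ) (i j : Fin m) : ℕ := if j ≤ i then a i j else 0

theorem orderedProd_congr {A : Type*} [Monoid A] {m : ℕ} (x : Fin m → Fin m → A)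
    {a b : Fin m → Fin m → ℕ} (h : ∀ i j, j ≤ i → a i j = b i j) :
    orderedProd x a = orderedProd x b := by
  unfold orderedProd
  congr 1
  refine List.map_congr_left fun i _ => ?_
  congr 1
  refine List.map_congr_left fun j hj => ?_
  rw [h i j (by simpa using (List.mem_filter.1 hj).2)]

theorem pbwDegree_congr {m : ℕ} {a b : Fin m → Fin m → ℕ} (h : ∀ i j, j ≤ i → a i j = b i j) :
    pbwDegree a = pbwDegree b := by
  funext k
  refine Finset.sum_congr rfl fun i _ => Finset.sum_congr rfl fun j _ => ?_
  split_ifs with hk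
  · exact h i j (hk.1.trans hk.2)
  · rfl

theorem eq_lowerTri {m : ℕ} (a : Fin m → Fin m → ℕ) (i j : Fin m) (h : j ≤ i) :
    a i j = lowerTri a i j := by simp [lowerTri, h]

theorem mem_truncPos {ℓ : ℕ} {a : Fin (n - 1) → Fin (n - 1) → ℕ} (hℓ : 0 < ℓ) (ha : Truncated ℓ a) :
    (posMon r s a : U n r s) ∈ truncPos n r s ℓ (pbwDegree a) := by
  refine Submodule.subset_span ⟨lowerTri a, fun i j => ?_, (pbwDegree_congr (eq_lowerTri a)).symm,
    orderedProd_congr _ (eq_lowerTri a)⟩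
  unfold lowerTri
  split_ifs with h
  exacts [ha i j h, hℓ]

theorem mem_truncNeg {ℓ : ℕ} {a : Fin (n - 1) → Fin (n - 1) → ℕ} (hℓ : 0 < ℓ) (ha : Truncated ℓ a) :
    (negMon r s a : U n r s) ∈ truncNeg n r s ℓ (pbwDegree a) := by
  refine Submodule.subset_span ⟨lowerTri a, fun i j => ?_, (pbwDegree_congr (eq_lowerTri a)).symm,
    orderedProd_congr _ (eq_lowerTri a)⟩
  unfold lowerTri
  split_ifs with h
  exacts [ha i j h, hℓ]

section Pairing

variable {p : borelNeg n r s →ₗ[K] borelPos n r s →ₗ[K] K} (hp : IsHopfPairing p) {ℓ : ℕ}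
include hp

theorem IsHopfPairing.apply_negMon_posMon (a b : Fin (n - 1) → Fin (n - 1) → ℕ) :
    p (negMon r s a) (posMon r s b) = ∏ m ∈ Finset.range (n - 1), ∏ i ∈ Finset.range (m + 1),
      if extendExp a m i = extendExp b m i then
        (((1 - (r : K)⁻¹ * s) * (s - r : K)⁻¹) ^ (m - i) * (s - r : K)⁻¹) ^ extendExp a m i
          * qFactorial (r * (s : K)⁻¹) (extendExp a m i) else 0 := by
  rw [negMon_eq, posMon_eq]
  exact hp.borelPairing.apply_ordMon le_rfl _ _

variable (hrs : r ≠ s) (hprim : IsPrimitiveRoot (r / s) ℓ)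
include hprim

/-- A monomial with an exponent at least `ℓ` pairs to zero, since `[ℓ]! = 0` for `q` of order `ℓ`. -/
theorem IsHopfPairing.eq_of_apply_ne_zero (hℓ : 1 < ℓ) {a b : Fin (n - 1) → Fin (n - 1) → ℕ}
    (h : p (negMon r s a) (posMon r s b) ≠ 0) :
    (∀ i j, j ≤ i → a i j = b i j) ∧ Truncated ℓ a := by
  have hq : IsPrimitiveRoot ((r : K) * (s : K)⁻¹) ℓ := by
    have := hprim.map_of_injective (Units.coeHom_injective (M := K))
    simpa [div_eq_mul_inv] using this
  rw [hp.apply_negMon_posMon] at h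
  have h1 : ∀ i j : Fin (n - 1), j ≤ i → _ := fun i j hij =>
    Finset.prod_ne_zero_iff.1 (Finset.prod_ne_zero_iff.1 h i (Finset.mem_range.2 i.2)) (j : ℕ)
      (Finset.mem_range.2 (Nat.lt_succ_of_le hij))
  refine ⟨fun i j hij => ?_, fun i j hij => ?_⟩
  · have := h1 i j hij
    by_contra hne
    rw [if_neg (by simpa [extendExp_coe] using hne)] at this
    exact this rfl
  · have := h1 i j hij
    by_contra hlt
    refine this ?_
    split_ifs
    · rw [extendExp_coe, qFactorial_eq_zero hq hℓ (not_lt.1 hlt), mul_zero]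
    · rfl

include hrs in
theorem IsHopfPairing.apply_self_ne_zero {a : Fin (n - 1) → Fin (n - 1) → ℕ} (ha : Truncated ℓ a) :
    p (negMon r s a) (posMon r s a) ≠ 0 := by
  have hq : IsPrimitiveRoot ((r : K) * (s : K)⁻¹) ℓ := by
    have := hprim.map_of_injective (Units.coeHom_injective (M := K))
    simpa [div_eq_mul_inv] using this
  have hκ : (s : K) - r ≠ 0 := sub_ne_zero.2 fun h => hrs (Units.ext h.symm)
  have h1 : 1 - (r : K)⁻¹ * s ≠ 0 := by
    intro h
    apply hκ
    have hr : (r : K) ≠ 0 := r.ne_zero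
    field_simp at h
    linear_combination -h
  rw [hp.apply_negMon_posMon]
  refine Finset.prod_ne_zero_iff.2 fun m hm => Finset.prod_ne_zero_iff.2 fun i hi => ?_
  have hm := Finset.mem_range.1 hm
  have hi := Finset.mem_range.1 hi
  rw [if_pos rfl]
  refine mul_ne_zero (pow_ne_zero _ (mul_ne_zero (pow_ne_zero _ (mul_ne_zero h1 (inv_ne_zero hκ)))
    (inv_ne_zero hκ))) (qFactorial_ne_zero hq ?_)
  have := ha ⟨m, hm⟩ ⟨i, by omega⟩ (Nat.le_of_lt_succ hi)
  rwa [← extendExp_coe a] at this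

include hrs in
/-- Dual bases of the truncated spaces exist. -/
theorem IsHopfPairing.nonempty_dualBases (hℓ : 1 < ℓ) : Nonempty (DualBases p ℓ) := by
  have key : ∀ ζ, ∃ (u : Module.Basis (Fin (Module.finrank K (truncPos n r s ℓ ζ))) K (truncPos n r s ℓ ζ))
      (v : Module.Basis (Fin (Module.finrank K (truncPos n r s ℓ ζ))) K (truncNeg n r s ℓ ζ)),
      ∀ k l (x : borelPos n r s) (y : borelNeg n r s), (borelNeg n r s).val.toLinearMap y = v k →
        (borelPos n r s).val.toLinearMap x = u l → p y x = if k = l then 1 else 0 := by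
    intro ζ
    classical
    let ι := {a : Fin (n - 1) → Fin (n - 1) → ℕ //
      (∀ i j, a i j < ℓ) ∧ (∀ i j, i < j → a i j = 0) ∧ pbwDegree a = ζ}
    have hfin : Set.Finite {a : Fin (n - 1) → Fin (n - 1) → ℕ | ∀ i j, a i j < ℓ} :=
      Set.Finite.pi' fun _ => Set.Finite.pi' fun _ => Set.finite_lt_nat ℓ
    have : Finite ι := (hfin.subset fun a ha => ha.1).to_subtype
    have hsub : ∀ {a : Fin (n - 1) → Fin (n - 1) → ℕ}, (∀ i j, a i j < ℓ) → pbwDegree a = ζ →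
        ∃ b : ι, ∀ i j, j ≤ i → a i j = b.1 i j := by
      intro a ha hd
      refine ⟨⟨lowerTri a, fun i j => ?_, fun i j hij => if_neg hij.not_ge,
        (pbwDegree_congr (eq_lowerTri a)).symm.trans hd⟩, eq_lowerTri a⟩
      unfold lowerTri
      split_ifs
      exacts [ha i j, by omega]
    refine exists_dual_bases p (ι := ι) (E := fun a => posMon r s a.1) (F := fun a => negMon r s a.1)
      (N := fun a => p (negMon r s a.1) (posMon r s a.1))
      (fun a => hp.apply_self_ne_zero hrs hprim fun i j _ => a.2.1 i j) (fun a b => ?_) _ _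
      Subtype.val_injective Subtype.val_injective ?_ ?_
    · split_ifs with hab
      · rw [hab]
      · by_contra hne
        refine hab (Subtype.ext (funext fun i => funext fun j => ?_))
        rcases le_or_gt j i with hji | hij
        · exact (hp.eq_of_apply_ne_zero hprim hℓ hne).1 i j hji
        · rw [a.2.2.1 i j hij, b.2.2.1 i j hij]
    · refine congrArg (Submodule.span K) (Set.ext fun x => ⟨?_, ?_⟩)
      · rintro ⟨a, ha, hd, rfl⟩
        obtain ⟨b, hb⟩ := hsub ha hd
        exact ⟨b, (orderedProd_congr _ hb).symm⟩
      · rintro ⟨a, rfl⟩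
        exact ⟨a.1, a.2.1, a.2.2.2, rfl⟩
    · refine congrArg (Submodule.span K) (Set.ext fun x => ⟨?_, ?_⟩)
      · rintro ⟨a, ha, hd, rfl⟩
        obtain ⟨b, hb⟩ := hsub ha hd
        exact ⟨b, (orderedProd_congr _ hb).symm⟩
      · rintro ⟨a, rfl⟩
        exact ⟨a.1, a.2.1, a.2.2.2, rfl⟩
  choose u v huv using key
  exact ⟨⟨u, v, fun ζ k l => huv ζ k l _ _ rfl rfl⟩⟩

end Pairing

end Monomials

end TwoParam

/-! ### The twist identity for a truncated canonical element -/

namespace SkewPairing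

open Coalgebra

variable {K H' H : Type*} [Field K] [Ring H'] [Bialgebra K H'] [Ring H] [Bialgebra K H]

theorem exists_comul_eq_sum_of_mem_range {S T : Subalgebra K H} {x : H}
    (h : comul (R := K) x ∈ (Algebra.TensorProduct.map S.val T.val).range) :
    ∃ s : Finset (S × T), comul (R := K) x = ∑ i ∈ s, (i.1 : H) ⊗ₜ (i.2 : H) := by
  obtain ⟨t, ht⟩ := h
  obtain ⟨s, hs⟩ := TensorProduct.exists_finset t
  refine ⟨s, ?_⟩
  rw [← ht, hs]
  simp

variable {U κ : Type*} [Ring U] [Algebra K U] [Fintype κ]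

/-- The families `v` and `u` are complete on the subalgebra `S` of `H` for the homomorphism `φ`: modulo
the kernel of `φ`, every `b ∈ S` equals `∑ (v_k | b) u_k`. -/
def IsCompletePos (p : H' →ₗ[K] H →ₗ[K] K) (v : κ → H') (u : κ → H) (S : Subalgebra K H) {P : Type*}
    [Ring P] [Algebra K P] (φ : H →ₐ[K] P) : Prop :=
  ∀ b ∈ S, φ b = ∑ k, p (v k) b • φ (u k)

/-- The families `v` and `u` are complete on the subalgebra `S'` of `H'` for the homomorphism `φ`: modulo
the kernel of `φ`, every `b' ∈ S'` equals `∑ (b' | u_k) v_k`. -/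
def IsCompleteNeg (p : H' →ₗ[K] H →ₗ[K] K) (v : κ → H') (u : κ → H) (S' : Subalgebra K H') {P : Type*}
    [Ring P] [Algebra K P] (φ : H' →ₐ[K] P) : Prop :=
  ∀ b' ∈ S', φ b' = ∑ k, p b' (u k) • φ (v k)

variable {p : H' →ₗ[K] H →ₗ[K] K} (hp : IsPairing p) {ι' : H' →ₐ[K] U} {ι : H →ₐ[K] U}
  {S' : Subalgebra K H'} {S : Subalgebra K H} {v : κ → H'} {u : κ → H}
  {P₁ P₂ P₃ : Type*} [Ring P₁] [Algebra K P₁] [Ring P₂] [Algebra K P₂] [Ring P₃] [Algebra K P₃]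
  {ρ₁ : U →ₐ[K] P₁} {ρ₂ : U →ₐ[K] P₂} {ρ₃ : U →ₐ[K] P₃}
include hp

/-- Both sides of the twist identity equal `∑ v_σ ⊗ (∑ (v_k₁ | u_σ₁) v_k₂ u_σ₂) ⊗ u_k`, where the middle
factor can also be written as `∑ u_σ₁ v_k₁ (v_k₂ | u_σ₂)` by the relation of the quantum double. -/
theorem IsPairing.twist_identity
    (hS : ∀ x ∈ S, comul (R := K) x ∈ (Algebra.TensorProduct.map (⊤ : Subalgebra K H).val S.val).range)
    (hS' : ∀ x ∈ S', comul (R := K) x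
      ∈ (Algebra.TensorProduct.map S'.val (⊤ : Subalgebra K H').val).range)
    (hu : ∀ k, u k ∈ S) (hv : ∀ k, v k ∈ S') (hD : ∀ b ∈ S, DoubleRel ι' ι p b)
    {Δ : U →ₐ[K] U ⊗[K] U} (hΔ : ∀ b, Δ (ι b) = Algebra.TensorProduct.map ι ι (comul b))
    (hΔ' : ∀ b, Δ (ι' b) = Algebra.TensorProduct.map ι' ι' (comul b))
    (hn₁ : IsCompleteNeg p v u S' (ρ₁.comp ι')) (hp₂ : IsCompletePos p v u S (ρ₂.comp ι))
    (hn₂ : IsCompleteNeg p v u S' (ρ₂.comp ι')) (hp₃ : IsCompletePos p v u S (ρ₃.comp ι))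
    {F : U ⊗[K] U} (hF : F = ∑ k, ι' (v k) ⊗ₜ ι (u k)) :
    Algebra.TensorProduct.map ρ₁ (Algebra.TensorProduct.map ρ₂ ρ₃)
        (Algebra.TensorProduct.assoc K K K _ _ _ (Algebra.TensorProduct.map Δ (AlgHom.id K _) F)) *
      Algebra.TensorProduct.map ρ₁ (Algebra.TensorProduct.map ρ₂ ρ₃)
        (Algebra.TensorProduct.assoc K K K _ _ _ (F ⊗ₜ[K] 1))
    = Algebra.TensorProduct.map ρ₁ (Algebra.TensorProduct.map ρ₂ ρ₃)
        (Algebra.TensorProduct.map (AlgHom.id K _) Δ F) *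
      Algebra.TensorProduct.map ρ₁ (Algebra.TensorProduct.map ρ₂ ρ₃) (1 ⊗ₜ[K] F) := by
  choose s' hs' using fun k => exists_comul_eq_sum_of_mem_range (hS' (v k) (hv k))
  choose s hs using fun k => exists_comul_eq_sum_of_mem_range (hS (u k) (hu k))
  have hL : ∀ k σ, ∑ μ, ∑ i ∈ s' k, p (i.1 * v μ) (u σ) • ρ₂ (ι' i.2 * ι (u μ))
      = ρ₂ (∑ j ∈ s σ, ι' (actL p j.1 (v k)) * ι j.2) := by
    intro k σ
    simp only [hp.mul_left, hs, actL_eq_sum (hs' k), map_sum, map_mul, map_smul, Finset.sum_mul,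
      TensorProduct.map_tmul, LinearMap.mul'_apply, Finset.sum_smul, smul_mul_assoc]
    have h2 : ∀ j : (⊤ : Subalgebra K H) × S, ρ₂ (ι j.2) = ∑ μ, p (v μ) j.2 • ρ₂ (ι (u μ)) :=
      fun j => hp₂ _ j.2.2
    simp only [h2, Finset.mul_sum, mul_smul_comm, Finset.smul_sum, smul_smul]
    calc _ = ∑ μ, ∑ j ∈ s σ, ∑ i ∈ s' k, _ := Finset.sum_congr rfl fun μ _ => Finset.sum_comm
      _ = ∑ j ∈ s σ, ∑ μ, ∑ i ∈ s' k, _ := Finset.sum_comm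
      _ = _ := Finset.sum_congr rfl fun j _ => Finset.sum_comm
  have hR : ∀ k σ, ∑ ν, ∑ j ∈ s σ, p (v k) (j.2 * u ν) • ρ₂ (ι j.1 * ι' (v ν))
      = ρ₂ (∑ j ∈ s σ, ι j.1 * ι' (actR p j.2 (v k))) := by
    intro k σ
    have h2 : ∀ j : (⊤ : Subalgebra K H) × S, ρ₂ (ι' (actR p j.2 (v k)))
        = ∑ ν, p (actR p j.2 (v k)) (u ν) • ρ₂ (ι' (v ν)) := fun j => hn₂ _ <| by
      rw [actR_eq_sum (hs' k)]
      exact sum_mem fun i _ => Subalgebra.smul_mem _ i.1.2 _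
    simp only [map_sum, map_mul, h2, Finset.mul_sum, mul_smul_comm, hp.apply_mul']
    exact Finset.sum_comm
  have h1 : ∀ x ∈ S', ρ₁ (ι' x) = ∑ k, p x (u k) • ρ₁ (ι' (v k)) := hn₁
  have h3 : ∀ x ∈ S, ρ₃ (ι x) = ∑ k, p (v k) x • ρ₃ (ι (u k)) := hp₃
  have lhs : Algebra.TensorProduct.map ρ₁ (Algebra.TensorProduct.map ρ₂ ρ₃)
        (Algebra.TensorProduct.assoc K K K _ _ _ (Algebra.TensorProduct.map Δ (AlgHom.id K _) F)) *
      Algebra.TensorProduct.map ρ₁ (Algebra.TensorProduct.map ρ₂ ρ₃)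
        (Algebra.TensorProduct.assoc K K K _ _ _ (F ⊗ₜ[K] 1))
      = ∑ k, ∑ σ, ρ₁ (ι' (v σ)) ⊗ₜ (ρ₂ (∑ j ∈ s σ, ι' (actL p j.1 (v k)) * ι j.2) ⊗ₜ ρ₃ (ι (u k))) := by
    simp only [← hL]
    simp only [hF, map_sum, Algebra.TensorProduct.map_tmul, hΔ', hs', TensorProduct.sum_tmul,
      Algebra.TensorProduct.assoc_tmul, AlgHom.id_apply, Finset.sum_mul_sum, map_one]
    refine Finset.sum_congr rfl fun k _ => ?_
    have : ∀ (i : S' × (⊤ : Subalgebra K H')) μ, ρ₁ (ι' i.1) * ρ₁ (ι' (v μ))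
        = ∑ σ, p (i.1 * v μ) (u σ) • ρ₁ (ι' (v σ)) := fun i μ => by
      rw [← map_mul, ← map_mul, h1 _ (mul_mem i.1.2 (hv μ))]
    simp only [Finset.sum_mul, Algebra.TensorProduct.tmul_mul_tmul, mul_one,
      this, TensorProduct.sum_tmul, TensorProduct.tmul_sum, map_mul, TensorProduct.tmul_smul,
      ← TensorProduct.smul_tmul']
    rw [Finset.sum_comm]
    calc _ = ∑ i ∈ s' k, ∑ σ, ∑ μ, _ := Finset.sum_congr rfl fun i _ => Finset.sum_comm
      _ = ∑ σ, ∑ i ∈ s' k, ∑ μ, _ := Finset.sum_comm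
      _ = _ := Finset.sum_congr rfl fun σ _ => Finset.sum_comm
  have rhs : Algebra.TensorProduct.map ρ₁ (Algebra.TensorProduct.map ρ₂ ρ₃)
        (Algebra.TensorProduct.map (AlgHom.id K _) Δ F) *
      Algebra.TensorProduct.map ρ₁ (Algebra.TensorProduct.map ρ₂ ρ₃) (1 ⊗ₜ[K] F)
      = ∑ σ, ∑ k, ρ₁ (ι' (v σ)) ⊗ₜ (ρ₂ (∑ j ∈ s σ, ι j.1 * ι' (actR p j.2 (v k))) ⊗ₜ ρ₃ (ι (u k))) := by
    simp only [← hR]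
    simp only [hF, map_sum, Algebra.TensorProduct.map_tmul, hΔ, hs, TensorProduct.tmul_sum,
      AlgHom.id_apply, Finset.sum_mul_sum, map_one]
    refine Finset.sum_congr rfl fun σ _ => ?_
    have : ∀ (j : (⊤ : Subalgebra K H) × S) ν, ρ₃ (ι j.2) * ρ₃ (ι (u ν))
        = ∑ k, p (v k) (j.2 * u ν) • ρ₃ (ι (u k)) := fun j ν => by
      rw [← map_mul, ← map_mul, h3 _ (mul_mem j.2.2 (hu ν))]
    simp only [Finset.sum_mul, Algebra.TensorProduct.tmul_mul_tmul, mul_one,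
      this, TensorProduct.sum_tmul, TensorProduct.tmul_sum, map_mul, TensorProduct.tmul_smul,
      ← TensorProduct.smul_tmul']
    rw [Finset.sum_comm]
    calc _ = ∑ i ∈ s σ, ∑ k, ∑ μ, _ := Finset.sum_congr rfl fun i _ => Finset.sum_comm
      _ = ∑ k, ∑ i ∈ s σ, ∑ μ, _ := Finset.sum_comm
      _ = _ := Finset.sum_congr rfl fun k _ => Finset.sum_comm
  rw [lhs, rhs, Finset.sum_comm]
  refine Finset.sum_congr rfl fun σ _ => Finset.sum_congr rfl fun k _ => ?_
  rw [(doubleRel_iff (hs σ)).1 (hD _ (hu σ)) (v k)]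

end SkewPairing

/-! ### Completeness of the dual bases on the modules of the category -/

namespace TwoParam

open SkewPairing SerreTypeA

theorem map_orderedProd {A B : Type*} [Monoid A] [Monoid B] (φ : A →* B) {m : ℕ} (x : Fin m → Fin m → A)
    (a : Fin m → Fin m → ℕ) : φ (orderedProd x a) = orderedProd (fun i j => φ (x i j)) a := by
  simp [orderedProd, map_list_prod, Function.comp_def]

theorem orderedProd_eq_zero {A : Type*} [MonoidWithZero A] {m : ℕ} {x : Fin m → Fin m → A}
    {a : Fin m → Fin m → ℕ} {i j : Fin m} (hij : j ≤ i) (h : x i j ^ a i j = 0) :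
    orderedProd x a = 0 := by
  refine List.prod_eq_zero (List.mem_map.2 ⟨i, List.mem_finRange i, ?_⟩)
  refine List.prod_eq_zero (List.mem_map.2 ⟨j, ?_, h⟩)
  simpa using hij

theorem mem_span_of_map_mem_span {K M N : Type*} [Field K] [AddCommGroup M] [Module K M]
    [AddCommGroup N] [Module K N] {j : M →ₗ[K] N} (hj : Function.Injective j) {X : Set M} {x : M}
    (h : j x ∈ Submodule.span K (j '' X)) : x ∈ Submodule.span K X := by
  rw [← Submodule.map_span] at h
  obtain ⟨y, hy, hyx⟩ := h
  exact hj hyx ▸ hy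

variable {K : Type*} [Field K] {n : ℕ} {r s : Kˣ}

theorem map_posMon_eq_zero {P : Type*} [Ring P] [Algebra K P] {ρ : U n r s →ₐ[K] P} {ℓ : ℕ}
    (hρ : ∀ i j, j ≤ i → ρ (rootE r s i j ^ ℓ) = 0) {a : Fin (n - 1) → Fin (n - 1) → ℕ}
    (ha : ¬ Truncated ℓ a) : ρ (posMon r s a) = 0 := by
  simp only [Truncated, not_forall, not_lt] at ha
  obtain ⟨i, j, hij, h⟩ := ha
  refine (map_orderedProd (ρ : U n r s →* P) _ _).trans (orderedProd_eq_zero hij ?_)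
  have := hρ i j hij
  rw [map_pow] at this
  exact pow_eq_zero_of_le h this

theorem map_negMon_eq_zero {P : Type*} [Ring P] [Algebra K P] {ρ : U n r s →ₐ[K] P} {ℓ : ℕ}
    (hρ : ∀ i j, j ≤ i → ρ (rootF r s i j ^ ℓ) = 0) {a : Fin (n - 1) → Fin (n - 1) → ℕ}
    (ha : ¬ Truncated ℓ a) : ρ (negMon r s a) = 0 := by
  simp only [Truncated, not_forall, not_lt] at ha
  obtain ⟨i, j, hij, h⟩ := ha
  refine (map_orderedProd (ρ : U n r s →* P) _ _).trans (orderedProd_eq_zero hij ?_)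
  have := hρ i j hij
  rw [map_pow] at this
  exact pow_eq_zero_of_le h this

variable (n r s) in
/-- The subalgebra of `borelPos` generated by the `e_i`. -/
noncomputable def nilPos : Subalgebra K (borelPos n r s) :=
  Algebra.adjoin K (xPos n r s '' Set.Iio (n - 1))

variable (n r s) in
/-- The subalgebra of `borelNeg` generated by the `f_i`. -/
noncomputable def nilNeg : Subalgebra K (borelNeg n r s) :=
  Algebra.adjoin K (yNeg n r s '' Set.Iio (n - 1))

theorem nilPos_le_span (h : n ≤ 3 ∨ (r : K) + s ≠ 0) {b : borelPos n r s} (hb : b ∈ nilPos n r s) :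
    b ∈ Submodule.span K (Set.range (posMon r s)) := by
  refine Submodule.span_mono ?_
    (serreRel_pos.adjoin_le_span_ordMon (commute_middle_pos h) (n - 1) hb)
  rintro _ ⟨a, rfl⟩
  refine ⟨fun i j => a i j, (posMon_eq _).trans (ordMon_congr _ fun i hi j hj => ?_)⟩
  have : j < n - 1 := by omega
  simp [extendExp, hi, this]

theorem nilNeg_le_span (h : n ≤ 3 ∨ (r : K) + s ≠ 0) {b : borelNeg n r s} (hb : b ∈ nilNeg n r s) :
    b ∈ Submodule.span K (Set.range (negMon r s)) := by
  have hC : ∀ j, Commute (yNeg n r s (j + 1)) (rootVec ((s : K)⁻¹)⁻¹ (yNeg n r s) j 2) := by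
    rw [inv_inv]
    exact commute_middle_neg h
  refine Submodule.span_mono ?_ (serreRel_neg.adjoin_le_span_ordMon hC (n - 1) hb)
  rintro _ ⟨a, rfl⟩
  refine ⟨fun i j => a i j, (negMon_eq _).trans ?_⟩
  rw [inv_inv]
  refine ordMon_congr _ fun i hi j hj => ?_
  have : j < n - 1 := by omega
  simp [extendExp, hi, this]

theorem posMon_mem_nilPos (a : Fin (n - 1) → Fin (n - 1) → ℕ) : posMon r s a ∈ nilPos n r s := by
  rw [posMon_eq]
  exact ordMon_mem_adjoin _ _

theorem negMon_mem_nilNeg (a : Fin (n - 1) → Fin (n - 1) → ℕ) : negMon r s a ∈ nilNeg n r s := by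
  rw [negMon_eq]
  exact ordMon_mem_adjoin _ _

theorem comul_nilPos {x : borelPos n r s} (hx : x ∈ nilPos n r s) : Coalgebra.comul (R := K) x
    ∈ (Algebra.TensorProduct.map (⊤ : Subalgebra K (borelPos n r s)).val (nilPos n r s).val).range := by
  refine comul_mem_range_of_adjoin (⊤ : Subalgebra K (borelPos n r s)) (nilPos n r s) ?_ x hx
  rintro _ ⟨i, hi, rfl⟩
  have hmem : xPos n r s i ∈ nilPos n r s := Algebra.subset_adjoin ⟨i, hi, rfl⟩
  rw [xPos_of_lt hi] at hmem ⊢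
  rw [comul_ePos]
  exact add_mem (tmul_mem_range Algebra.mem_top (one_mem _)) (tmul_mem_range Algebra.mem_top hmem)

theorem comul_nilNeg {x : borelNeg n r s} (hx : x ∈ nilNeg n r s) : Coalgebra.comul (R := K) x
    ∈ (Algebra.TensorProduct.map (nilNeg n r s).val (⊤ : Subalgebra K (borelNeg n r s)).val).range := by
  refine comul_mem_range_of_adjoin (nilNeg n r s) (⊤ : Subalgebra K (borelNeg n r s)) ?_ x hx
  rintro _ ⟨i, hi, rfl⟩
  have hmem : yNeg n r s i ∈ nilNeg n r s := Algebra.subset_adjoin ⟨i, hi, rfl⟩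
  rw [yNeg_of_lt hi] at hmem ⊢
  rw [comul_fNeg]
  exact add_mem (tmul_mem_range (one_mem _) Algebra.mem_top) (tmul_mem_range hmem Algebra.mem_top)

section Dual

variable {p : borelNeg n r s →ₗ[K] borelPos n r s →ₗ[K] K} {ℓ : ℕ} (D : DualBases p ℓ)

/-- A finite set of degrees containing those of all truncated PBW monomials. -/
noncomputable def DualBases.degrees : Finset (Fin (n - 1) → ℕ) := by
  classical exact (finite_pbwDegree (n - 1) ℓ).toFinset ∪ D.finite_support.toFinset

/-- The pairs of a degree and an index that label the basis vectors. -/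
abbrev DualBases.Index : Type := Σ ζ : D.degrees, Fin (Module.finrank K (truncPos n r s ℓ ζ.1))

/-- The basis vectors `u_k` as elements of `borelPos`. -/
noncomputable def DualBases.uPos (ζ : Fin (n - 1) → ℕ) (k : Fin (Module.finrank K (truncPos n r s ℓ ζ))) :
    borelPos n r s := ⟨D.u ζ k, truncPos_le ℓ ζ (D.u ζ k).2⟩

/-- The basis vectors `v_k` as elements of `borelNeg`. -/
noncomputable def DualBases.vNeg (ζ : Fin (n - 1) → ℕ) (k : Fin (Module.finrank K (truncPos n r s ℓ ζ))) :
    borelNeg n r s := ⟨D.v ζ k, truncNeg_le ℓ ζ (D.v ζ k).2⟩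

theorem DualBases.F_eq : D.F = ∑ x : D.Index, (borelNeg n r s).val (D.vNeg x.1 x.2)
    ⊗ₜ (borelPos n r s).val (D.uPos x.1 x.2) := by
  rw [Fintype.sum_sigma]
  have : D.F = ∑ ζ ∈ D.degrees, D.Fcomp ζ := by
    refine finsum_eq_sum_of_support_subset _ fun ζ hζ => ?_
    simp only [DualBases.degrees, Finset.coe_union]
    exact Or.inr ((D.finite_support.mem_toFinset).2 hζ)
  rw [this, ← Finset.sum_coe_sort]
  rfl

theorem DualBases.pbwDegree_mem {a : Fin (n - 1) → Fin (n - 1) → ℕ} (hℓ : 0 < ℓ) (ha : Truncated ℓ a) :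
    pbwDegree a ∈ D.degrees := by
  refine Finset.mem_union_left _ ((finite_pbwDegree (n - 1) ℓ).mem_toFinset.2
    ⟨lowerTri a, fun i j => ?_, (pbwDegree_congr (eq_lowerTri a)).symm⟩)
  unfold lowerTri
  split_ifs with h
  exacts [ha i j h, hℓ]

theorem DualBases.uPos_mem_span (ζ k) : D.uPos ζ k
    ∈ Submodule.span K (posMon r s '' {a | Truncated ℓ a ∧ pbwDegree a = ζ}) := by
  refine mem_span_of_map_mem_span (j := (borelPos n r s).val.toLinearMap) Subtype.val_injective ?_
  refine Submodule.span_mono ?_ (D.u ζ k).2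
  rintro _ ⟨a, ha, hd, rfl⟩
  exact ⟨posMon r s a, ⟨a, ⟨fun i j _ => ha i j, hd⟩, rfl⟩, rfl⟩

theorem DualBases.vNeg_mem_span (ζ k) : D.vNeg ζ k
    ∈ Submodule.span K (negMon r s '' {a | Truncated ℓ a ∧ pbwDegree a = ζ}) := by
  refine mem_span_of_map_mem_span (j := (borelNeg n r s).val.toLinearMap) Subtype.val_injective ?_
  refine Submodule.span_mono ?_ (D.v ζ k).2
  rintro _ ⟨a, ha, hd, rfl⟩
  exact ⟨negMon r s a, ⟨a, ⟨fun i j _ => ha i j, hd⟩, rfl⟩, rfl⟩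

theorem DualBases.uPos_mem_nilPos (ζ k) : D.uPos ζ k ∈ nilPos n r s := by
  have : Submodule.span K (posMon r s '' {a | Truncated ℓ a ∧ pbwDegree a = ζ})
      ≤ (nilPos n r s).toSubmodule := by
    rw [Submodule.span_le]
    rintro _ ⟨a, -, rfl⟩
    exact posMon_mem_nilPos a
  exact this (D.uPos_mem_span ζ k)

theorem DualBases.vNeg_mem_nilNeg (ζ k) : D.vNeg ζ k ∈ nilNeg n r s := by
  have : Submodule.span K (negMon r s '' {a | Truncated ℓ a ∧ pbwDegree a = ζ})
      ≤ (nilNeg n r s).toSubmodule := by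
    rw [Submodule.span_le]
    rintro _ ⟨a, -, rfl⟩
    exact negMon_mem_nilNeg a
  exact this (D.vNeg_mem_span ζ k)

theorem DualBases.posMon_mem_span {a : Fin (n - 1) → Fin (n - 1) → ℕ} (hℓ : 0 < ℓ)
    (ha : Truncated ℓ a) :
    posMon r s a ∈ Submodule.span K (Set.range (D.uPos (pbwDegree a))) := by
  refine mem_span_of_map_mem_span (j := (borelPos n r s).val.toLinearMap) Subtype.val_injective ?_
  have h := Submodule.mem_map_of_mem (f := (truncPos n r s ℓ (pbwDegree a)).subtype)
    ((D.u (pbwDegree a)).mem_span ⟨_, mem_truncPos hℓ ha⟩)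
  rw [Submodule.map_span, ← Set.range_comp] at h
  rw [← Set.range_comp]
  exact h

theorem DualBases.negMon_mem_span {a : Fin (n - 1) → Fin (n - 1) → ℕ} (hℓ : 0 < ℓ)
    (ha : Truncated ℓ a) :
    negMon r s a ∈ Submodule.span K (Set.range (D.vNeg (pbwDegree a))) := by
  refine mem_span_of_map_mem_span (j := (borelNeg n r s).val.toLinearMap) Subtype.val_injective ?_
  have h := Submodule.mem_map_of_mem (f := (truncNeg n r s ℓ (pbwDegree a)).subtype)
    ((D.v (pbwDegree a)).mem_span ⟨_, mem_truncNeg hℓ ha⟩)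
  rw [Submodule.map_span, ← Set.range_comp] at h
  rw [← Set.range_comp]
  exact h

variable (hp : IsHopfPairing p) (hprim : IsPrimitiveRoot (r / s) ℓ) (hℓ : 1 < ℓ)
  (hserre : n ≤ 3 ∨ (r : K) + s ≠ 0)
include hp hprim hℓ hserre

/-- The dual bases are complete on `nilPos` for every homomorphism that kills the `𝓔_{i,j}^ℓ`: the monomials
with an exponent at least `ℓ` pair to zero and are mapped to zero. -/
theorem DualBases.isCompletePos {P : Type*} [Ring P] [Algebra K P] {ρ : U n r s →ₐ[K] P}
    (hρ : ∀ i j, j ≤ i → ρ (rootE r s i j ^ ℓ) = 0) :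
    IsCompletePos p (fun x : D.Index => D.vNeg x.1 x.2) (fun x : D.Index => D.uPos x.1 x.2)
      (nilPos n r s) (ρ.comp (borelPos n r s).val) := by
  intro b hb
  replace hb := nilPos_le_span hserre hb
  induction hb using Submodule.span_induction with
  | mem x hx =>
    obtain ⟨a, rfl⟩ := hx
    rw [Fintype.sum_sigma, Finset.sum_coe_sort D.degrees
      (fun ζ => ∑ k, p (D.vNeg ζ k) (posMon r s a) • (ρ.comp (borelPos n r s).val) (D.uPos ζ k))]
    refine apply_eq_sum_of_dual p (E := posMon r s) (F := negMon r s) (good := Truncated ℓ)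
      (deg := pbwDegree) (u := D.uPos) (v := D.vNeg) (fun a b hb h => ?_)
      (fun a ha => D.posMon_mem_span (by omega) ha) D.vNeg_mem_span D.dual
      (fun a ha => D.pbwDegree_mem (by omega) ha) (ρ.comp (borelPos n r s).val).toLinearMap
      (fun a ha => map_posMon_eq_zero hρ ha) a
    have h := (hp.eq_of_apply_ne_zero hprim hℓ h).1
    exact ⟨fun i j hij => h i j hij ▸ hb i j hij, (pbwDegree_congr h).symm⟩
  | zero => simp
  | add x y _ _ hx hy => simp only [map_add, hx, hy, add_smul, Finset.sum_add_distrib]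
  | smul c x _ hx => simp only [map_smul, hx, Finset.smul_sum, smul_assoc]

/-- The dual bases are complete on `nilNeg` for every homomorphism that kills the `𝓕_{i,j}^ℓ`. -/
theorem DualBases.isCompleteNeg {P : Type*} [Ring P] [Algebra K P] {ρ : U n r s →ₐ[K] P}
    (hρ : ∀ i j, j ≤ i → ρ (rootF r s i j ^ ℓ) = 0) :
    IsCompleteNeg p (fun x : D.Index => D.vNeg x.1 x.2) (fun x : D.Index => D.uPos x.1 x.2)
      (nilNeg n r s) (ρ.comp (borelNeg n r s).val) := by
  intro b hb
  replace hb := nilNeg_le_span hserre hb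
  induction hb using Submodule.span_induction with
  | mem x hx =>
    obtain ⟨a, rfl⟩ := hx
    rw [Fintype.sum_sigma, Finset.sum_coe_sort D.degrees
      (fun ζ => ∑ k, p (negMon r s a) (D.uPos ζ k) • (ρ.comp (borelNeg n r s).val) (D.vNeg ζ k))]
    refine apply_eq_sum_of_dual p.flip (E := negMon r s) (F := posMon r s) (good := Truncated ℓ)
      (deg := pbwDegree) (u := D.vNeg) (v := D.uPos) (fun a b hb h => ?_)
      (fun a ha => D.negMon_mem_span (by omega) ha) D.uPos_mem_span
      (fun ζ k l => (D.dual ζ l k).trans (if_congr eq_comm rfl rfl))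
      (fun a ha => D.pbwDegree_mem (by omega) ha) (ρ.comp (borelNeg n r s).val).toLinearMap
      (fun a ha => map_negMon_eq_zero hρ ha) a
    have h := hp.eq_of_apply_ne_zero hprim hℓ h
    exact ⟨h.2, pbwDegree_congr h.1⟩
  | zero => simp
  | add x y _ _ hx hy => simp only [map_add, LinearMap.add_apply, hx, hy, add_smul, Finset.sum_add_distrib]
  | smul c x _ hx => simp only [map_smul, LinearMap.smul_apply, hx, Finset.smul_sum, smul_assoc]

end Dual

/-! ### The twisting element -/

section Twist

variable {𝔎 : Type*} [CommRing 𝔎] [Algebra K 𝔎]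

section TensorAct

variable {A B C M N L : Type*} [Ring A] [Algebra K A] [Ring B] [Algebra K B] [Ring C] [Algebra K C]
  [AddCommGroup M] [Module 𝔎 M] [Module K M] [IsScalarTower K 𝔎 M]
  [AddCommGroup N] [Module 𝔎 N] [Module K N] [IsScalarTower K 𝔎 N]
  [AddCommGroup L] [Module 𝔎 L] [Module K L] [IsScalarTower K 𝔎 L]

theorem tensorAct_tmul_eq_map (ρ : A →ₐ[K] Module.End 𝔎 M) (σ : B →ₐ[K] Module.End 𝔎 N) (a : A) (b : B) :
    tensorAct ρ σ (a ⊗ₜ b) = TensorProduct.map (ρ a) (σ b) :=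
  TensorProduct.ext' fun x y => tensorAct_tmul ρ σ a b x y

/-- The action on a threefold tensor product factors through the algebras of endomorphisms. -/
theorem tensorAct_tensorAct_apply (ρ : A →ₐ[K] Module.End 𝔎 M) (σ : B →ₐ[K] Module.End 𝔎 N)
    (τ : C →ₐ[K] Module.End 𝔎 L) (t : A ⊗[K] (B ⊗[K] C)) :
    tensorAct ρ (tensorAct σ τ) t
      = tensorAct (AlgHom.id K (Module.End 𝔎 M))
        (tensorAct (AlgHom.id K (Module.End 𝔎 N)) (AlgHom.id K (Module.End 𝔎 L)))
        (Algebra.TensorProduct.map ρ (Algebra.TensorProduct.map σ τ) t) := by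
  induction t with
  | zero => simp
  | add x y hx hy => simp only [map_add, hx, hy]
  | tmul a t =>
    induction t with
    | zero => simp
    | add x y hx hy => simp only [TensorProduct.tmul_add, map_add, hx, hy]
    | tmul b c => simp [tensorAct_tmul_eq_map]

end TensorAct

variable {p : borelNeg n r s →ₗ[K] borelPos n r s →ₗ[K] K} {ℓ : ℕ} (D : DualBases p ℓ)
  (hp : IsHopfPairing p) (hprim : IsPrimitiveRoot (r / s) ℓ) (hℓ : 1 < ℓ)
  (hserre : n ≤ 3 ∨ (r : K) + s ≠ 0)
include hp hprim hℓ hserre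

theorem DualBases.twistIdentity {M M' M'' : Type*}
    [AddCommGroup M] [Module 𝔎 M] [Module K M] [IsScalarTower K 𝔎 M]
    [AddCommGroup M'] [Module 𝔎 M'] [Module K M'] [IsScalarTower K 𝔎 M']
    [AddCommGroup M''] [Module 𝔎 M''] [Module K M''] [IsScalarTower K 𝔎 M'']
    {ρ : U n r s →ₐ[K] Module.End 𝔎 M} {ρ' : U n r s →ₐ[K] Module.End 𝔎 M'}
    {ρ'' : U n r s →ₐ[K] Module.End 𝔎 M''} (hρ : InN ℓ ρ) (hρ' : InN ℓ ρ') (hρ'' : InN ℓ ρ'') :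
    TwistIdentity D.F ρ ρ' ρ'' := by
  have h := hp.isPairing.twist_identity (fun x hx => comul_nilPos hx) (fun x hx => comul_nilNeg hx)
    (fun x : D.Index => D.uPos_mem_nilPos x.1 x.2) (fun x : D.Index => D.vNeg_mem_nilNeg x.1 x.2)
    (fun b hb => hp.doubleRel hb) (Δ := comul n r s) (fun b => (map_comul_borelPos b).symm)
    (fun b => (map_comul_borelNeg b).symm)
    (D.isCompleteNeg hp hprim hℓ hserre hρ.rootF_pow) (D.isCompletePos hp hprim hℓ hserre hρ'.rootE_pow)
    (D.isCompleteNeg hp hprim hℓ hserre hρ'.rootF_pow)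
    (D.isCompletePos hp hprim hℓ hserre hρ''.rootE_pow) D.F_eq
  have h2 := congrArg (tensorAct (AlgHom.id K (Module.End 𝔎 M))
    (tensorAct (AlgHom.id K (Module.End 𝔎 M')) (AlgHom.id K (Module.End 𝔎 M'')))) h
  rw [map_mul, map_mul] at h2
  simp only [← tensorAct_tensorAct_apply] at h2
  exact h2

theorem DualBases.isTwistingElement {𝒞 : Set (ModuleAlgebra n r s 𝔎)} (h𝒞 : ∀ A ∈ 𝒞, InN ℓ A.ρ) :
    IsTwistingElement 𝒞 D.F := by
  intro A hA
  have hN := h𝒞 A hA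
  refine ⟨?_, ?_, D.twistIdentity hp hprim hℓ hserre hN hN hN⟩
  -- Completeness at `1`, where `(v_k | 1) = ε(v_k)`.
  · have h := D.isCompletePos hp hprim hℓ hserre hN.rootE_pow 1 (one_mem _)
    simp only [hp.one_right, map_one] at h
    rw [D.F_eq]
    simp only [map_sum, Algebra.TensorProduct.map_tmul, AlgHom.comp_apply, Algebra.ofId_apply,
      tensorAct_tmul_eq_map, AlgHom.id_apply, AlgHom.commutes]
    refine TensorProduct.ext' fun x y => ?_
    have h' := congrArg (fun φ : Module.End 𝔎 A.carrier => x ⊗ₜ[𝔎] φ y) h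
    simp only [Module.End.one_apply] at h'
    rw [LinearMap.id_apply]
    refine Eq.trans ?_ h'.symm
    simp [LinearMap.sum_apply, TensorProduct.tmul_sum, TensorProduct.smul_tmul]
  · have h := D.isCompleteNeg hp hprim hℓ hserre hN.rootF_pow 1 (one_mem _)
    simp only [hp.one_left, map_one] at h
    rw [D.F_eq]
    simp only [map_sum, Algebra.TensorProduct.map_tmul, AlgHom.comp_apply, Algebra.ofId_apply,
      tensorAct_tmul_eq_map, AlgHom.id_apply, AlgHom.commutes]
    refine TensorProduct.ext' fun x y => ?_
    have h' := congrArg (fun φ : Module.End 𝔎 A.carrier => φ x ⊗ₜ[𝔎] y) h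
    simp only [Module.End.one_apply] at h'
    rw [LinearMap.id_apply]
    refine Eq.trans ?_ h'.symm
    simp [LinearMap.sum_apply, TensorProduct.sum_tmul, TensorProduct.smul_tmul]

end Twist

end TwoParam

open TwoParam in
theorem theorem4p9 {K : Type*} [Field K] [CharZero K] (n : ℕ) (hn : 2 ≤ n)
    (r s θ : Kˣ) (d d' ℓ y z : ℕ) (hd : 0 < d) (hd' : 0 < d')
    (hr : IsPrimitiveRoot r d) (hs : IsPrimitiveRoot s d') (hrs : r ≠ s) (hℓ : ℓ = Nat.lcm d d')
    (hθ : IsPrimitiveRoot θ ℓ) (hry : r = θ ^ y) (hsz : s = θ ^ z)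
    (hyz : IsCoprime (∑ k ∈ Finset.range n, (-1) ^ k * (y : ℤ) ^ (n - 1 - k) * (z : ℤ) ^ k) (ℓ : ℤ))
    (hprim : IsPrimitiveRoot (r / s) ℓ) (hserre : n ≤ 3 ∨ (r : K) + s ≠ 0)
    {𝔎 : Type*} [CommRing 𝔎] [Algebra K 𝔎] :
    (∃! p : borelNeg n r s →ₗ[K] borelPos n r s →ₗ[K] K, IsHopfPairing p) ∧
    ∀ p : borelNeg n r s →ₗ[K] borelPos n r s →ₗ[K] K, IsHopfPairing p →
      Nonempty (DualBases p ℓ) ∧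
      ∀ D : DualBases p ℓ,
        (∀ (M M' M'' : Type*)
          [AddCommGroup M] [Module 𝔎 M] [Module K M] [IsScalarTower K 𝔎 M]
          [AddCommGroup M'] [Module 𝔎 M'] [Module K M'] [IsScalarTower K 𝔎 M']
          [AddCommGroup M''] [Module 𝔎 M''] [Module K M''] [IsScalarTower K 𝔎 M'']
          (ρ : U n r s →ₐ[K] Module.End 𝔎 M) (ρ' : U n r s →ₐ[K] Module.End 𝔎 M')
          (ρ'' : U n r s →ₐ[K] Module.End 𝔎 M''),
          InN ℓ ρ → InN ℓ ρ' → InN ℓ ρ'' → TwistIdentity D.F ρ ρ' ρ'') ∧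
        ∀ 𝒞 : Set (ModuleAlgebra n r s 𝔎), (∀ A ∈ 𝒞, InN ℓ A.ρ) → IsTwistingElement 𝒞 D.F := by
  -- `ℓ = 1` would force `r = s`.
  have hℓ1 : 1 < ℓ := by
    have h0 : 0 < ℓ := hℓ ▸ Nat.lcm_pos hd hd'
    rcases Nat.eq_or_lt_of_le h0 with h1 | h1
    · rw [← h1] at hprim
      exact (hrs (div_eq_one.1 (IsPrimitiveRoot.one_right_iff.1 hprim))).elim
    · exact h1
  obtain ⟨p₀, hp₀⟩ := exists_isHopfPairing (n := n) hrs
  refine ⟨⟨p₀, hp₀, fun p hp => hp.unique hp₀⟩, fun p hp => ⟨hp.nonempty_dualBases hrs hprim hℓ1,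
    fun D => ⟨fun M M' M'' => ?_, fun 𝒞 h𝒞 => D.isTwistingElement hp hprim hℓ1 hserre h𝒞⟩⟩⟩
  intros
  exact D.twistIdentity hp hprim hℓ1 hserre ‹_› ‹_› ‹_›
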